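/- \textbf{Setting.} Let $k\ge 3$ be an integer. In $k$-SUM-Indexing over a finite abelian group $U$, one preprocesses $k-1$ lists $A_1,\dots,A_{k-1}\in U^n$, so that for a query $c\in U$ one can decide whether there is $(x_1,\dots,x_{k-1})\in A_1\times\cdots\times A_{k-1}$ with $x_1+\cdots+x_{k-1}=c$ (for $k=3$ this is 3SUM-Indexing). The model is the word RAM with words of $w$ bits, for any $w$ such that $n^{k-1}\le 2^w$ and the elements of $U$ are encoded injectively (and arbitrarily) as $w$-bit words; word operations, memory accesses and the addition of two elements of $U$ take one step each. The query algorithm is one fixed program, which does not depend on $n$, $U$ or $w$. The preprocessing time is not bounded. The space is the number of words of memory, including the lists as far as they are kept and the work space of queries. We say that $k$-SUM-Indexing is solved on uniformly random instances with space $O(s(n))$ and query time $O(t(n))$ if for every $q\in\mathbb N$ there are a query program and constants $C,n_0$ such that for all $n\ge n_0$ and all $U$, $w$ and encodings as above, there is a preprocessing producing at most $C\,s(n)$ words such that, with probability at least $1-n^{-q}$ over the $k-1$ lists chosen uniformly at random from $(U^n)^{k-1}$, every query $c\in U$ is answered correctly in at most $C\,t(n)$ steps. \textbf{Theorem.} Let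 $k\ge 3$ and $0<\delta<1$. Then $k$-SUM-Indexing is solved on uniformly random instances with space $n^{k-1-\delta/2}$ and query time $n^{\delta}$ up to a polylogarithmic factor in either one of the two bounds: there is $d\in\mathbb N$ (depending only on $k$ and $\delta$) such that it is solved (i) with space $O\big(n^{k-1-\delta/2}(\log n)^d\big)$ words and query time $O(n^{\delta})$, and also (ii) with space $O\big(n^{k-1-\delta/2}\big)$ words and query time $O\big(n^{\delta}(\log n)^d\big)$. In particular, for 3SUM-Indexing and $\delta=3/4$, for some $d\in\mathbb N$, it is solved with space $O\big(n^{1.625}(\log n)^d\big)$ and query time $O(n^{0.75})$, and also with space $O(n^{1.625})$ and query time $O\big(n^{0.75}(\log n)^d\big)$. -/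

import Mathlib

namespace KSumIndexing

/-- Binary operations of the word RAM on `w`-bit words. All of them are taken modulo `2 ^ w`;
`mulHi` is the high word of the `2w`-bit product; division by `0` gives `0`. -/
inductive BinOp
  | add | sub | mul | mulHi | div | mod | and | or | xor | shl | shr

/-- Value of a binary word operation. -/
def BinOp.eval {w : ℕ} : BinOp → BitVec w → BitVec w → BitVec w
  | .add, x, y => x + y
  | .sub, x, y => x - y
  | .mul, x, y => x * y
  | .mulHi, x, y => BitVec.ofNat w (x.toNat * y.toNat / 2 ^ w)
  | .div, x, y => BitVec.ofNat w (x.toNat / y.toNat)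
  | .mod, x, y => BitVec.ofNat w (x.toNat % y.toNat)
  | .and, x, y => x &&& y
  | .or, x, y => x ||| y
  | .xor, x, y => x ^^^ y
  | .shl, x, y => BitVec.ofNat w (x.toNat * 2 ^ y.toNat)
  | .shr, x, y => BitVec.ofNat w (x.toNat / 2 ^ y.toNat)

/-- Instructions of the word RAM. The numbers `d a b` name registers. A program is a finite list
of instructions, so it uses a number of registers that depends on the program only. -/
inductive Instr
  /-- put the constant `v` (modulo `2 ^ w`) into register `d` -/
  | const (d v : ℕ)
  /-- register `d` becomes the result of a word operation on registers `a` and `b` -/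
  | op (o : BinOp) (d a b : ℕ)
  /-- register `d` becomes the sum, in the universe, of the elements in registers `a` and `b` -/
  | univAdd (d a b : ℕ)
  /-- register `d` becomes the memory word whose address is in register `a` -/
  | load (d a : ℕ)
  /-- the memory word whose address is in register `a` becomes the content of register `b` -/
  | store (a b : ℕ)
  /-- go to instruction `target` if registers `a` and `b` are equal -/
  | jumpEq (a b target : ℕ)
  /-- go to instruction `target` if register `a` is less than register `b` -/
  | jumpLt (a b target : ℕ)
  /-- stop with the given answer -/
  | halt (answer : Bool)

/-- A configuration of a word RAM with `w`-bit words and a memory of `s` words. -/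
structure Config (w s : ℕ) where
  pc : ℕ
  reg : ℕ → BitVec w
  mem : Fin s → BitVec w

/-- Set register `d` to `v` and go to the next instruction. -/
def Config.setReg {w s : ℕ} (σ : Config w s) (d : ℕ) (v : BitVec w) : Config w s :=
  { pc := σ.pc + 1, reg := Function.update σ.reg d v, mem := σ.mem }

/-- Run the program `P` for at most `T` steps, where every executed instruction (also `halt`) is
one step and `uadd` is the addition of universe elements on words. The result is `some b` if the
run halts with answer `b` within `T` steps; it is `none` if it does not halt within `T` steps, if
it leaves the program, or if it accesses an address outside the `s` words of memory. -/
def run {w s : ℕ} (P : List Instr) (uadd : BitVec w → BitVec w → BitVec w) :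
    ℕ → Config w s → Option Bool
  | 0, _ => none
  | T + 1, σ =>
    match P[σ.pc]? with
    | none => none
    | some (.halt b) => some b
    | some (.const d v) => run P uadd T (σ.setReg d (BitVec.ofNat w v))
    | some (.op o d a b) => run P uadd T (σ.setReg d (o.eval (σ.reg a) (σ.reg b)))
    | some (.univAdd d a b) => run P uadd T (σ.setReg d (uadd (σ.reg a) (σ.reg b)))
    | some (.load d a) =>
        if h : (σ.reg a).toNat < s then
          run P uadd T (σ.setReg d (σ.mem ⟨(σ.reg a).toNat, h⟩))
        else none
    | some (.store a b) =>
        if h : (σ.reg a).toNat < s then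
          run P uadd T
            { σ with
              pc := σ.pc + 1
              mem := Function.update σ.mem ⟨(σ.reg a).toNat, h⟩ (σ.reg b) }
        else none
    | some (.jumpEq a b target) =>
        run P uadd T { σ with pc := if σ.reg a = σ.reg b then target else σ.pc + 1 }
    | some (.jumpLt a b target) =>
        run P uadd T
          { σ with pc := if (σ.reg a).toNat < (σ.reg b).toNat then target else σ.pc + 1 }

/-- The initial configuration of a query: the queried word is in register `0`, all other registers
are `0`, and the memory is the one left by the preprocessing. -/
def queryConfig {w s : ℕ} (c : BitVec w) (mem : Fin s → BitVec w) : Config w s :=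
  { pc := 0, reg := fun i => if i = 0 then c else 0, mem := mem }

/-- Addition of the universe `U`, carried over to words by the encoding `enc`
(on words that encode no element its value is irrelevant). -/
noncomputable def wordAdd {U : Type} [AddCommGroup U] {w : ℕ} (enc : U → BitVec w)
    (x y : BitVec w) : BitVec w :=
  enc (Function.invFun enc x + Function.invFun enc y)

/-- An instance of `k`-SUM-Indexing: `k - 1` lists of `n` elements of the universe `U`. -/
abbrev Instance (k n : ℕ) (U : Type) : Type := Fin (k - 1) → Fin n → U

/-- The element `c` is a sum of one element from each of the `k - 1` lists. -/
def IsSum {k n : ℕ} {U : Type} [AddCommGroup U] (A : Instance k n U) (c : U) : Prop :=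
  ∃ i : Fin (k - 1) → Fin n, ∑ j, A j (i j) = c

/-- With memory content `mem`, the program `P` answers every query on the instance `A` correctly
within `T` steps. -/
def AnswersAll {k n : ℕ} {U : Type} [AddCommGroup U] {w s : ℕ} (P : List Instr)
    (enc : U → BitVec w) (A : Instance k n U) (mem : Fin s → BitVec w) (T : ℕ) : Prop :=
  ∀ c : U, ∃ b : Bool,
    run P (wordAdd enc) T (queryConfig (enc c) mem) = some b ∧ (b = true ↔ IsSum A c)

/-- Probability of the event `E` under the uniform distribution on a finite type `Ω`. -/
noncomputable def uniformProb {Ω : Type} (E : Set Ω) : ℝ := (E.ncard : ℝ) / (Nat.card Ω : ℝ)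

/-- `k`-SUM-Indexing on uniformly random instances is solved with `O(space n)` words of memory and
query time `O(time n)`, with high probability: for every `q` there is a query program `P` (which
knows neither `n` nor the universe) such that for every large `n`, every finite abelian group `U`
as universe, every word length `w` for which elements of `U` (under an arbitrary encoding) and
numbers below `n ^ (k - 1)` fit into a word, there is a preprocessing that maps each instance to
`s = O(space n)` words of memory, which have to hold all stored data and the work space of the
queries, such that with probability at least `1 - n ^ (-q)` over the instance, all queries are
answered correctly within `T = O(time n)` steps. The time of the preprocessing is not charged. -/
def SolvableOnRandom (k : ℕ) (time space : ℕ → ℝ) : Prop :=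
  ∀ q : ℕ, ∃ (P : List Instr) (C : ℝ) (n₀ : ℕ), ∀ n : ℕ, n₀ ≤ n →
    ∀ (U : Type) [AddCommGroup U] [Finite U] (w : ℕ) (enc : U → BitVec w),
      Function.Injective enc → n ^ (k - 1) ≤ 2 ^ w →
      ∃ (s T : ℕ) (preprocess : Instance k n U → (Fin s → BitVec w)),
        (s : ℝ) ≤ C * space n ∧ (T : ℝ) ≤ C * time n ∧
        1 - 1 / (n : ℝ) ^ q ≤
          uniformProb {A : Instance k n U | AnswersAll P enc A (preprocess A) T}

end KSumIndexing

/-! Put K = k - 1. A query c asks to invert the map from index tuples to sums, and the data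
structure is a family of rainbow tables for this map. A column function sends y to the sum of the
entries A j (h j (y)), where the h j are random index functions; whatever y is, its value is u with
probability P(u) = mult(u) / n^K. A table has t independent column functions and m chains. For each
hash value of a chain end it keeps the start of one such chain. A query guesses the column of c,
completes the chain from there, looks up the start and walks again from it. This finds c whenever c
lies on a chain whose end has a hash value of its own.

Chains interfere little because the columns are independent: hits in different columns are
independent, and two chains can merge only in the same column, with probability at most κ = 3^K M /
n^K per column if all multiplicities are at most M (`pr_colFun_eq_and_le`). With m t about n^K / M,
up to a constant, a Bonferroni argument (`pr_found_ge`) shows that a random table finds a given sum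
with probability of order at least 1 / M. Averaging then gives about M log n tables that together
find all sums of a fixed instance (`exists_tables_found_all`); preprocessing is free, so existence
is enough.

The column functions have to be stored as well. Each h j is a multiply-shift hash followed by a
table of about n entries, which is independent enough on pairs (`pr_idxHash_eq_and_le`) and costs t
n K words per rainbow table. Up to polylogarithmic factors the space is t n + n^K / t and the time
is t^2; t is n^(δ/2), divided or multiplied by a power of log n.

Randomness of the instance only serves to make M polylogarithmic. If the universe is not much
smaller than n^K, this holds with high probability (`pr_mult_gt_le`). If it is smaller, with high
probability every element is a sum (`pr_exists_mult_eq_zero_le`), and accepting everything is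
correct. Since the program must be fixed, it interprets a tape of records prepared in memory; it
accepts a non-sum on no instance where tables are used, because there acceptance requires a computed
sum to equal c. -/

namespace KSumIndexing

/-! ### Averages and probabilities on finite types -/

open Classical in
/-- Average of a real function on a finite type. -/
noncomputable def avg {Ω : Type*} [Fintype Ω] (f : Ω → ℝ) : ℝ := (∑ x, f x) / Fintype.card Ω

open Classical in
/-- Indicator of a proposition. -/
noncomputable def ind (p : Prop) : ℝ := if p then 1 else 0

/-- Probability under the uniform distribution on a finite type. -/
noncomputable def pr {Ω : Type*} [Fintype Ω] (p : Ω → Prop) : ℝ := avg fun x => ind (p x)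

lemma ind_true {p : Prop} (h : p) : ind p = 1 := by simp [ind, h]

lemma ind_false {p : Prop} (h : ¬p) : ind p = 0 := by simp [ind, h]

lemma ind_nonneg (p : Prop) : 0 ≤ ind p := by
  unfold ind; split_ifs <;> norm_num

lemma ind_le_one (p : Prop) : ind p ≤ 1 := by
  unfold ind; split_ifs <;> norm_num

lemma ind_mono {p q : Prop} (h : p → q) : ind p ≤ ind q := by
  by_cases hp : p
  · rw [ind_true hp, ind_true (h hp)]
  · rw [ind_false hp]; exact ind_nonneg q

lemma ind_and (p q : Prop) : ind (p ∧ q) = ind p * ind q := by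
  by_cases hp : p <;> by_cases hq : q <;> simp [ind, hp, hq]

section

variable {Ω Ω' : Type*} [Fintype Ω] [Fintype Ω']

lemma avg_mono {f g : Ω → ℝ} (h : ∀ x, f x ≤ g x) : avg f ≤ avg g := by
  unfold avg
  gcongr with x
  exact h x

lemma avg_add (f g : Ω → ℝ) : avg (fun x => f x + g x) = avg f + avg g := by
  simp [avg, Finset.sum_add_distrib, add_div]

lemma avg_sub (f g : Ω → ℝ) : avg (fun x => f x - g x) = avg f - avg g := by
  simp [avg, Finset.sum_sub_distrib, sub_div]

lemma avg_const_mul (c : ℝ) (f : Ω → ℝ) : avg (fun x => c * f x) = c * avg f := by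
  simp [avg, ← Finset.mul_sum, mul_div_assoc]

lemma avg_mul_const (c : ℝ) (f : Ω → ℝ) : avg (fun x => f x * c) = avg f * c := by
  simp [avg, ← Finset.sum_mul, div_mul_eq_mul_div]

lemma avg_const [Nonempty Ω] (c : ℝ) : avg (fun _ : Ω => c) = c := by
  simp [avg]

lemma avg_sum {ι : Type*} (s : Finset ι) (f : ι → Ω → ℝ) :
    avg (fun x => ∑ i ∈ s, f i x) = ∑ i ∈ s, avg (f i) := by
  simp only [avg]
  rw [Finset.sum_comm, Finset.sum_div]

lemma avg_equiv (e : Ω ≃ Ω') (f : Ω' → ℝ) : avg (fun x => f (e x)) = avg f := by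
  simp only [avg]
  rw [Fintype.card_congr e, e.sum_comp]

lemma avg_prod (f : Ω × Ω' → ℝ) : avg f = avg fun x => avg fun y => f (x, y) := by
  simp only [avg, Fintype.sum_prod_type, Fintype.card_prod, Nat.cast_mul]
  rw [← Finset.sum_div, div_div, mul_comm]

lemma avg_nonneg {f : Ω → ℝ} (h : ∀ x, 0 ≤ f x) : 0 ≤ avg f :=
  div_nonneg (Finset.sum_nonneg fun x _ => h x) (Nat.cast_nonneg _)

lemma exists_avg_le [Nonempty Ω] (f : Ω → ℝ) : ∃ x, avg f ≤ f x := by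
  by_contra! h
  have h1 : ∑ x, f x < ∑ _x : Ω, avg f :=
    Finset.sum_lt_sum_of_nonempty Finset.univ_nonempty fun x _ => h x
  have hc : (0 : ℝ) < Fintype.card Ω := by exact_mod_cast Fintype.card_pos
  simp only [Finset.sum_const, Finset.card_univ, nsmul_eq_mul] at h1
  unfold avg at h1
  rw [mul_div_cancel₀ _ hc.ne'] at h1
  exact lt_irrefl _ h1

lemma pr_nonneg (p : Ω → Prop) : 0 ≤ pr p := avg_nonneg fun _ => ind_nonneg _

lemma pr_mono {p q : Ω → Prop} (h : ∀ x, p x → q x) : pr p ≤ pr q :=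
  avg_mono fun x => ind_mono (h x)

lemma pr_congr {p q : Ω → Prop} (h : ∀ x, p x ↔ q x) : pr p = pr q :=
  le_antisymm (pr_mono fun x => (h x).1) (pr_mono fun x => (h x).2)

lemma pr_le_one (p : Ω → Prop) : pr p ≤ 1 := by
  rcases isEmpty_or_nonempty Ω with h | h
  · simp [pr, avg]
  · calc pr p ≤ avg (fun _ : Ω => (1 : ℝ)) := avg_mono fun _ => ind_le_one _
      _ = 1 := avg_const 1

lemma pr_not [Nonempty Ω] (p : Ω → Prop) : pr (fun x => ¬p x) = 1 - pr p := by
  rw [eq_sub_iff_add_eq, pr, pr, ← avg_add, ← avg_const (Ω := Ω) 1]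
  congr 1; funext x
  by_cases h : p x <;> simp [ind, h]

lemma ind_exists_le_sum {ι : Type*} (s : Finset ι) (p : ι → Prop) :
    ind (∃ i ∈ s, p i) ≤ ∑ i ∈ s, ind (p i) := by
  by_cases h : ∃ i ∈ s, p i
  · obtain ⟨i, hi, hp⟩ := h
    calc ind _ ≤ 1 := ind_le_one _
      _ = ind (p i) := (ind_true hp).symm
      _ ≤ _ := Finset.single_le_sum (f := fun i => ind (p i)) (fun _ _ => ind_nonneg _) hi
  · rw [ind_false h]
    exact Finset.sum_nonneg fun _ _ => ind_nonneg _

lemma pr_exists_le_sum {ι : Type*} (s : Finset ι) (p : ι → Ω → Prop) :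
    pr (fun x => ∃ i ∈ s, p i x) ≤ ∑ i ∈ s, pr (p i) := by
  simp only [pr]
  rw [← avg_sum]
  exact avg_mono fun x => ind_exists_le_sum s fun i => p i x

lemma pr_equiv (e : Ω ≃ Ω') (p : Ω' → Prop) : pr (fun x => p (e x)) = pr p :=
  avg_equiv e fun x => ind (p x)

lemma pr_prod (p : Ω × Ω' → Prop) : pr p = avg fun x => pr fun y => p (x, y) :=
  avg_prod _

lemma pr_fst [Nonempty Ω'] (p : Ω → Prop) : pr (fun x : Ω × Ω' => p x.1) = pr p := by
  rw [pr_prod]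
  simp only [pr, avg_const]

lemma pr_snd [Nonempty Ω] (p : Ω' → Prop) : pr (fun x : Ω × Ω' => p x.2) = pr p := by
  rw [pr_prod]
  exact avg_const (Ω := Ω) (pr p)

lemma pr_const_and (c : Prop) (p : Ω → Prop) : pr (fun x => c ∧ p x) = ind c * pr p := by
  simp only [pr, ind_and, avg_const_mul]

lemma sum_ind_eq {U : Type*} [Fintype U] (u : U) (f : U → ℝ) : ∑ v, ind (u = v) * f v = f u := by
  classical
  rw [Finset.sum_eq_single u]
  · simp [ind]
  · intro v _ hv
    rw [ind_false (Ne.symm hv), zero_mul]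
  · simp

lemma pr_eq_sum_fiber {U : Type*} [Fintype U] (X : Ω → U) (p : Ω → Prop) :
    pr p = ∑ u, pr (fun x => X x = u ∧ p x) := by
  simp only [pr]
  rw [← avg_sum]
  congr 1; funext x
  simp only [ind_and]
  exact (sum_ind_eq (X x) fun _ => ind (p x)).symm

lemma avg_pi_prod {ι : Type*} [Fintype ι] [DecidableEq ι] {α : ι → Type*} [∀ i, Fintype (α i)]
    (f : ∀ i, α i → ℝ) : avg (fun ω : ∀ i, α i => ∏ i, f i (ω i)) = ∏ i, avg (f i) := by
  simp only [avg]
  rw [Finset.prod_div_distrib, Fintype.card_pi, Nat.cast_prod, Finset.prod_univ_sum,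
    Fintype.piFinset_univ]

lemma ind_forall {ι : Type*} [Fintype ι] (p : ι → Prop) : ind (∀ i, p i) = ∏ i, ind (p i) := by
  by_cases h : ∀ i, p i
  · rw [ind_true h, Finset.prod_eq_one fun i _ => ind_true (h i)]
  · rw [ind_false h]
    push Not at h
    obtain ⟨i, hi⟩ := h
    exact (Finset.prod_eq_zero (Finset.mem_univ i) (ind_false hi)).symm

lemma pr_pi {ι : Type*} [Fintype ι] [DecidableEq ι] {α : ι → Type*} [∀ i, Fintype (α i)]
    (p : ∀ i, α i → Prop) : pr (fun ω : ∀ i, α i => ∀ i, p i (ω i)) = ∏ i, pr (p i) := by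
  simp only [pr, ind_forall]
  exact avg_pi_prod fun i a => ind (p i a)

lemma avg_fin_succ {H : Type*} [Fintype H] {t : ℕ} (f : (Fin (t + 1) → H) → ℝ) :
    avg f = avg fun h : H => avg fun ω : Fin t → H => f (Fin.cons h ω) := by
  have h := avg_equiv (Fin.consEquiv (fun _ : Fin (t + 1) => H)) f
  rw [← h, avg_prod]
  rfl

lemma pr_fin_succ {H : Type*} [Fintype H] {t : ℕ} (p : (Fin (t + 1) → H) → Prop) :
    pr p = avg fun h : H => pr fun ω : Fin t → H => p (Fin.cons h ω) :=
  avg_fin_succ _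

lemma pr_eq_card_div (p : Ω → Prop) : pr p = ({x | p x}.ncard : ℝ) / Fintype.card Ω := by
  classical
  unfold pr avg ind
  rw [Finset.sum_boole, Set.ncard_eq_toFinset_card' ]
  congr 3
  ext x; simp

lemma pr_eq_apply [DecidableEq Ω] (a : Ω) : pr (fun x => x = a) = 1 / Fintype.card Ω := by
  rw [pr_eq_card_div]
  simp

/-- If a group acts so that the value of `X` is translated and the event `E` is kept, then `X` is
uniform and independent of `E`. -/
lemma pr_eq_and_of_translate {U : Type*} [AddCommGroup U] [Fintype U] (X : Ω → U) (E : Ω → Prop)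
    (T : U → Ω ≃ Ω) (hX : ∀ u ω, X (T u ω) = X ω + u) (hE : ∀ u ω, E (T u ω) ↔ E ω) (c : U) :
    pr (fun ω => X ω = c ∧ E ω) = pr E / Fintype.card U := by
  -- Translation makes all fibres of X equally likely on E, and they add up to the probability of E.
  have h1 : ∀ d, pr (fun ω => X ω = d ∧ E ω) = pr (fun ω => X ω = c ∧ E ω) := by
    intro d
    rw [← pr_equiv (T (d - c)) (fun ω => X ω = d ∧ E ω)]
    refine pr_congr fun ω => ?_
    rw [hX, hE]
    rw [← eq_sub_iff_add_eq, sub_sub_cancel]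
  rw [pr_eq_sum_fiber X E, Finset.sum_congr rfl fun d _ => h1 d]
  have : (Fintype.card U : ℝ) ≠ 0 := by
    have : Nonempty U := ⟨0⟩
    exact_mod_cast Fintype.card_ne_zero
  simp only [Finset.sum_const, Finset.card_univ, nsmul_eq_mul]
  field_simp

/-- The restriction of a uniformly random function along an injection is uniformly random. -/
lemma pr_comp_injective {X Y U : Type*} [Fintype X] [Fintype Y] [Fintype U] [Nonempty U]
    [DecidableEq X] [DecidableEq Y]
    (ι : X → Y) (hι : Function.Injective ι) (p : (X → U) → Prop) :
    pr (fun A : Y → U => p (A ∘ ι)) = pr p := by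
  classical
  let e : X ⊕ {y // y ∉ Set.range ι} ≃ Y :=
    (Equiv.sumCongr (Equiv.ofInjective ι hι) (Equiv.refl _)).trans
      (Equiv.Set.sumCompl (Set.range ι))
  have he : ∀ x, e (Sum.inl x) = ι x := fun x => rfl
  let E : (Y → U) ≃ (X → U) × ({y // y ∉ Set.range ι} → U) :=
    (Equiv.arrowCongr e.symm (Equiv.refl U)).trans (Equiv.sumArrowEquivProdArrow _ _ _)
  rw [← pr_fst (Ω' := {y // y ∉ Set.range ι} → U) p, ← pr_equiv E]
  refine pr_congr fun A => ?_
  have : (E A).1 = A ∘ ι := by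
    funext x
    simp [E, Equiv.sumArrowEquivProdArrow, he]
  rw [this]

end

/-! ### Chains and rainbow tables -/

/-- The point reached from `x` when the functions `F h` are applied for the `h` in the list. -/
def chain {H U : Type*} (F : H → U → U) (hs : List H) (x : U) : U :=
  hs.foldl (fun y h => F h y) x

@[simp] lemma chain_nil {H U : Type*} (F : H → U → U) (x : U) : chain F [] x = x := rfl

@[simp] lemma chain_cons {H U : Type*} (F : H → U → U) (h : H) (hs : List H) (x : U) :
    chain F (h :: hs) x = chain F hs (F h x) := rfl

lemma chain_append {H U : Type*} (F : H → U → U) (hs hs' : List H) (x : U) :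
    chain F (hs ++ hs') x = chain F hs' (chain F hs x) := by
  simp [chain]

lemma chain_take_drop {H U : Type*} (F : H → U → U) (hs : List H) (l : ℕ) (x : U) :
    chain F (hs.drop l) (chain F (hs.take l) x) = chain F hs x := by
  rw [← chain_append, List.take_append_drop]

section rainbow

set_option linter.unusedSectionVars false

variable {H G U V : Type*} [Fintype H] [Fintype G] [Fintype U] [Nonempty H] [Nonempty G]

/-- The value `y` is in column `l + 1` of the chain from `x`, for the column functions `ω`. -/
def AtColumn {t : ℕ} (F : H → U → U) (ω : Fin t → H) (l : ℕ) (x y : U) : Prop :=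
  chain F ((List.ofFn ω).take (l + 1)) x = y

/-- The hash values of the ends of the chains from `x` and from `z` collide. -/
def EndsCollide {t : ℕ} (F : H → U → U) (g : G → U → V) (θ : (Fin t → H) × G) (x z : U) : Prop :=
  g θ.2 (chain F (List.ofFn θ.1) x) = g θ.2 (chain F (List.ofFn θ.1) z)

/-- Fixing the first column function leaves a table with one column less, started at the images of
the starting points. All inductions on t below use this. -/
lemma pr_table_succ {t : ℕ} (p : (Fin (t + 1) → H) × G → Prop) :
    pr p = avg fun h : H => pr fun θ : (Fin t → H) × G => p (Fin.cons h θ.1, θ.2) := by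
  rw [pr_prod, avg_fin_succ]
  congr 1; funext h
  rw [pr_prod]

lemma pr_atColumn (F : H → U → U) (P : U → ℝ) (h1 : ∀ x y, pr (fun h => F h x = y) = P y) :
    ∀ (t l : ℕ), l < t → ∀ x y, pr (fun ω : Fin t → H => AtColumn F ω l x y) = P y := by
  intro t
  induction t with
  | zero => intro l hl; omega
  | succ t ih =>
    intro l hl x y
    rw [pr_fin_succ]
    cases l with
    | zero =>
      simp only [AtColumn, List.ofFn_cons, List.take_succ_cons, List.take_zero, chain_cons,
        chain_nil]
      rw [← h1 x y]
      simp only [pr, avg_const]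
    | succ l =>
      have : ∀ h : H, pr (fun ω : Fin t → H => AtColumn F (Fin.cons h ω : Fin (t + 1) → H) (l + 1) x y)
          = P y := by
        intro h
        rw [← ih l (by omega) (F h x) y]
        simp only [AtColumn, List.ofFn_cons, List.take_succ_cons, chain_cons]
      simp only [this, avg_const]

/-- The later column uses a fresh function whose output law does not depend on its input, so the two
events are exactly independent. This also covers x = z: one chain passing through y twice. -/
lemma pr_atColumn_and (F : H → U → U) (P : U → ℝ)
    (h1 : ∀ x y, pr (fun h => F h x = y) = P y) :
    ∀ (t l l' : ℕ), l' < l → l < t → ∀ x z y,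
      pr (fun ω : Fin t → H => AtColumn F ω l x y ∧ AtColumn F ω l' z y) = P y * P y := by
  intro t
  induction t with
  | zero => intro l l' _ hl; omega
  | succ t ih =>
    intro l l' hl' hl x z y
    rw [pr_fin_succ]
    obtain ⟨l, rfl⟩ : ∃ j, l = j + 1 := ⟨l - 1, by omega⟩
    cases l' with
    | zero =>
      have : ∀ h : H, pr (fun ω : Fin t → H =>
          AtColumn F (Fin.cons h ω : Fin (t + 1) → H) (l + 1) x y ∧
          AtColumn F (Fin.cons h ω : Fin (t + 1) → H) 0 z y) = ind (F h z = y) * P y := by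
        intro h
        rw [← pr_atColumn F P h1 t l (by omega) (F h x) y, ← pr_const_and]
        refine pr_congr fun ω => ?_
        simp only [AtColumn, List.ofFn_cons, List.take_succ_cons, chain_cons, List.take_zero,
          chain_nil, and_comm]
      simp only [this, avg_mul_const]
      congr 1
      exact h1 z y
    | succ l' =>
      have : ∀ h : H, pr (fun ω : Fin t → H =>
          AtColumn F (Fin.cons h ω : Fin (t + 1) → H) (l + 1) x y ∧
          AtColumn F (Fin.cons h ω : Fin (t + 1) → H) (l' + 1) z y) = P y * P y := by
        intro h
        rw [← ih l l' (by omega) (by omega) (F h x) (F h z) y]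
        simp only [AtColumn, List.ofFn_cons, List.take_succ_cons, chain_cons]
      simp only [this, avg_const]

lemma sum_pr_eq_one (F : H → U → U) (P : U → ℝ) (h1 : ∀ x y, pr (fun h => F h x = y) = P y)
    (x : U) : ∑ y, P y = 1 := by
  have := pr_eq_sum_fiber (fun h => F h x) (fun _ : H => True)
  simp only [and_true, h1] at this
  rw [← this]
  simp [pr, ind, avg_const]

lemma pr_merge_le (F : H → U → U) (P : U → ℝ) (κ : ℝ)
    (h1 : ∀ x y, pr (fun h => F h x = y) = P y)
    (h2 : ∀ x z y, x ≠ z → pr (fun h => F h x = y ∧ F h z = y) ≤ κ * P y) (x z : U)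
    (hxz : x ≠ z) : pr (fun h => F h x = F h z) ≤ κ := by
  rw [pr_eq_sum_fiber (fun h => F h x) (fun h => F h x = F h z)]
  calc _ ≤ ∑ y, κ * P y := by
        refine Finset.sum_le_sum fun y _ => le_trans (pr_mono ?_) (h2 x z y hxz)
        rintro h ⟨e, e'⟩
        exact ⟨e, e' ▸ e⟩
    _ = κ := by rw [← Finset.mul_sum, sum_pr_eq_one F P h1 x, mul_one]

/-- Union bound: the chains merge in one of the t columns, at cost κ each, or their distinct ends
have equal hash values, at cost κ'. -/
lemma pr_endsCollide_le (F : H → U → U) (g : G → U → V) (P : U → ℝ) (κ κ' : ℝ)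
    (h1 : ∀ x y, pr (fun h => F h x = y) = P y)
    (h2 : ∀ x z y, x ≠ z → pr (fun h => F h x = y ∧ F h z = y) ≤ κ * P y)
    (h3 : ∀ x z, x ≠ z → pr (fun γ => g γ x = g γ z) ≤ κ') :
    ∀ (t : ℕ) (x z : U), x ≠ z →
      pr (fun θ : (Fin t → H) × G => EndsCollide F g θ x z) ≤ t * κ + κ' := by
  intro t
  induction t with
  | zero =>
    intro x z hxz
    simp only [EndsCollide, List.ofFn_zero, chain_nil]
    rw [pr_snd (fun γ => g γ x = g γ z)]
    simpa using h3 x z hxz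
  | succ t ih =>
    intro x z hxz
    rw [pr_table_succ]
    have hnn : 0 ≤ t * κ + κ' := (pr_nonneg _).trans (ih x z hxz)
    calc _ ≤ avg (fun h : H => ind (F h x = F h z) + (t * κ + κ')) := by
          refine avg_mono fun h => ?_
          simp only [EndsCollide, List.ofFn_cons, chain_cons]
          by_cases hh : F h x = F h z
          · rw [ind_true hh]
            exact (pr_le_one _).trans (by linarith)
          · rw [ind_false hh, zero_add]
            exact ih _ _ hh
      _ = pr (fun h => F h x = F h z) + (t * κ + κ') := by rw [avg_add, avg_const]; rfl
      _ ≤ _ := by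
          have := pr_merge_le F P κ h1 h2 x z hxz
          push_cast
          linarith

/-- The collision bound must keep the factor P y, although the events are not independent. A merge
before column l leaves the column function at l fresh; a merge in column l itself is controlled by
the joint bound `h2`; after it, the collision concerns fresh columns and two distinct points. -/
lemma pr_atColumn_endsCollide_le (F : H → U → U) (g : G → U → V) (P : U → ℝ) (κ κ' : ℝ)
    (h1 : ∀ x y, pr (fun h => F h x = y) = P y)
    (h2 : ∀ x z y, x ≠ z → pr (fun h => F h x = y ∧ F h z = y) ≤ κ * P y)
    (h3 : ∀ x z, x ≠ z → pr (fun γ => g γ x = g γ z) ≤ κ') :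
    ∀ (t l : ℕ), l < t → ∀ (x z y : U), x ≠ z →
      pr (fun θ : (Fin t → H) × G => AtColumn F θ.1 l x y ∧ EndsCollide F g θ x z)
        ≤ P y * (t * κ + κ') := by
  intro t
  induction t with
  | zero => intro l hl; omega
  | succ t ih =>
    intro l hl x z y hxz
    have hP : 0 ≤ P y := h1 x y ▸ pr_nonneg _
    have hnn : 0 ≤ t * κ + κ' :=
      (pr_nonneg _).trans (pr_endsCollide_le F g P κ κ' h1 h2 h3 t x z hxz)
    rw [pr_table_succ]
    cases l with
    | zero =>
      calc _ ≤ avg (fun h : H => ind (F h x = y ∧ F h z = y)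
              + ind (F h x = y) * (t * κ + κ')) := by
            refine avg_mono fun h => ?_
            simp only [AtColumn, EndsCollide, List.ofFn_cons, List.take_succ_cons,
              List.take_zero, chain_cons, chain_nil]
            rw [pr_const_and]
            by_cases hx : F h x = y
            · rw [ind_true hx, one_mul, one_mul]
              by_cases hz : F h z = y
              · rw [ind_true ⟨hx, hz⟩]
                exact (pr_le_one _).trans (by linarith)
              · rw [ind_false fun h => hz h.2, zero_add]
                exact pr_endsCollide_le F g P κ κ' h1 h2 h3 t _ _ fun e => hz (e ▸ hx)
            · rw [ind_false hx, ind_false fun h => hx h.1]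
              simp
        _ = pr (fun h => F h x = y ∧ F h z = y) + P y * (t * κ + κ') := by
            rw [avg_add, avg_mul_const, ← h1 x y]; rfl
        _ ≤ _ := by
            have := h2 x z y hxz
            push_cast
            linarith
    | succ l =>
      calc _ ≤ avg (fun h : H => ind (F h x = F h z) * P y + P y * (t * κ + κ')) := by
            refine avg_mono fun h => ?_
            simp only [AtColumn, EndsCollide, List.ofFn_cons, List.take_succ_cons, chain_cons]
            have hl' : l < t := by omega
            by_cases hh : F h x = F h z
            · rw [ind_true hh, one_mul]
              refine le_trans (pr_mono (q := fun θ : (Fin t → H) × G =>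
                AtColumn F θ.1 l (F h x) y) fun θ hθ => hθ.1) ?_
              rw [pr_fst (fun ω : Fin t → H => AtColumn F ω l (F h x) y),
                pr_atColumn F P h1 t l hl']
              have := mul_nonneg hP hnn
              linarith
            · rw [ind_false hh, zero_mul, zero_add]
              exact ih l hl' _ _ y hh
        _ = pr (fun h => F h x = F h z) * P y + P y * (t * κ + κ') := by
            rw [avg_add, avg_mul_const, avg_const]; rfl
        _ ≤ _ := by
            have := mul_le_mul_of_nonneg_right (pr_merge_le F P κ h1 h2 x z hxz) hP
            push_cast
            linarith

/-- The value `y` is in some column of a chain whose end has a hash value of its own. -/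
def Found {t m : ℕ} (F : H → U → U) (g : G → U → V) (s : Fin m → U) (θ : (Fin t → H) × G)
    (y : U) : Prop :=
  ∃ (i : Fin m) (l : Fin t), AtColumn F θ.1 l (s i) y ∧ ∀ j, j ≠ i → ¬EndsCollide F g θ (s i) (s j)

/-- Bonferroni: the expected number of hits of y is m t P y. Subtracting the hits that also have a
hit in an earlier column and those with a colliding end loses at most half of it, by `hm`. -/
lemma pr_found_ge (F : H → U → U) (g : G → U → V) (P : U → ℝ) (κ κ' : ℝ)
    (h1 : ∀ x y, pr (fun h => F h x = y) = P y)
    (h2 : ∀ x z y, x ≠ z → pr (fun h => F h x = y ∧ F h z = y) ≤ κ * P y)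
    (h3 : ∀ x z, x ≠ z → pr (fun γ => g γ x = g γ z) ≤ κ') (hκ0 : 0 ≤ κ) (hκ0' : 0 ≤ κ')
    {t m : ℕ} (s : Fin m → U) (hs : Function.Injective s) (y : U)
    (hm : m * t * P y + m * (t * κ + κ') ≤ 1 / 2) :
    m * t * P y / 2 ≤ pr (fun θ : (Fin t → H) × G => Found F g s θ y) := by
  classical
  rcases Nat.eq_zero_or_pos m with rfl | hm0
  · simpa using pr_nonneg _
  rcases Nat.eq_zero_or_pos t with rfl | ht0
  · simpa using pr_nonneg _
  have hP : 0 ≤ P y := h1 y y ▸ pr_nonneg _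
  have hκ : 0 ≤ t * κ + κ' := by positivity
  have key : ∀ θ : (Fin t → H) × G,
      ∑ i : Fin m, ∑ l : Fin t, (ind (AtColumn F θ.1 (l : ℕ) (s i) y)
        - ∑ j : Fin m, ∑ l' ∈ Finset.univ.filter (fun l' : Fin t => l' < l),
            ind (AtColumn F θ.1 l (s i) y ∧ AtColumn F θ.1 l' (s j) y)
        - ∑ j ∈ Finset.univ.erase i,
            ind (AtColumn F θ.1 l (s i) y ∧ EndsCollide F g θ (s i) (s j)))
      ≤ ind (Found F g s θ y) := by
    intro θ
    -- The pair (i, l) is a hit in the first column where y occurs at all, on a chain with an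
    -- isolated end.
    let A : Fin m → Fin t → Prop := fun i l => AtColumn F θ.1 l (s i) y ∧
      (∀ j l', l' < l → ¬AtColumn F θ.1 l' (s j) y) ∧
      ∀ j, j ≠ i → ¬EndsCollide F g θ (s i) (s j)
    have hA : ∀ (i : Fin m) (l : Fin t), (ind (AtColumn F θ.1 l (s i) y)
        - ∑ j : Fin m, ∑ l' ∈ Finset.univ.filter (fun l' : Fin t => l' < l),
            ind (AtColumn F θ.1 l (s i) y ∧ AtColumn F θ.1 l' (s j) y)
        - ∑ j ∈ Finset.univ.erase i,
            ind (AtColumn F θ.1 l (s i) y ∧ EndsCollide F g θ (s i) (s j))) ≤ ind (A i l) := by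
      intro i l
      have n1 : 0 ≤ ∑ j : Fin m, ∑ l' ∈ Finset.univ.filter (fun l' : Fin t => l' < l),
            ind (AtColumn F θ.1 l (s i) y ∧ AtColumn F θ.1 l' (s j) y) :=
        Finset.sum_nonneg fun _ _ => Finset.sum_nonneg fun _ _ => ind_nonneg _
      have n2 : 0 ≤ ∑ j ∈ Finset.univ.erase i,
            ind (AtColumn F θ.1 l (s i) y ∧ EndsCollide F g θ (s i) (s j)) :=
        Finset.sum_nonneg fun _ _ => ind_nonneg _
      by_cases hE : AtColumn F θ.1 l (s i) y
      swap
      · rw [ind_false hE]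
        linarith [ind_nonneg (A i l)]
      rw [ind_true hE]
      by_cases hA1 : ∀ j l', l' < l → ¬AtColumn F θ.1 l' (s j) y
      · by_cases hA2 : ∀ j, j ≠ i → ¬EndsCollide F g θ (s i) (s j)
        · rw [ind_true (p := A i l) ⟨hE, hA1, hA2⟩]
          linarith
        · push Not at hA2
          obtain ⟨j, hj, hc⟩ := hA2
          have := Finset.single_le_sum (f := fun j =>
            ind (AtColumn F θ.1 l (s i) y ∧ EndsCollide F g θ (s i) (s j)))
            (fun _ _ => ind_nonneg _) (Finset.mem_erase.2 ⟨hj, Finset.mem_univ j⟩)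
          simp only [ind_true (And.intro hE hc)] at this
          linarith [ind_nonneg (A i l)]
      · push Not at hA1
        obtain ⟨j, l', hl', hc⟩ := hA1
        have t1 := Finset.single_le_sum (f := fun l' : Fin t =>
            ind (AtColumn F θ.1 l (s i) y ∧ AtColumn F θ.1 l' (s j) y))
            (fun _ _ => ind_nonneg _) (s := Finset.univ.filter (fun l' : Fin t => l' < l))
            (Finset.mem_filter.2 ⟨Finset.mem_univ l', hl'⟩)
        have t2 := Finset.single_le_sum (f := fun j : Fin m =>
            ∑ l' ∈ Finset.univ.filter (fun l' : Fin t => l' < l),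
            ind (AtColumn F θ.1 l (s i) y ∧ AtColumn F θ.1 l' (s j) y))
            (fun _ _ => Finset.sum_nonneg fun _ _ => ind_nonneg _) (Finset.mem_univ j)
        simp only [ind_true (And.intro hE hc)] at t1
        linarith [ind_nonneg (A i l)]
    refine (Finset.sum_le_sum fun i _ => Finset.sum_le_sum fun l _ => hA i l).trans ?_
    by_cases hex : ∃ i l, A i l
    · obtain ⟨i, l, hil⟩ := hex
      rw [ind_true (p := Found F g s θ y) ⟨i, l, hil.1, hil.2.2⟩]
      -- Minimality fixes the column. Two chains that meet at y in the same column agree from there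
      -- on, so their ends coincide, against isolation. Hence at most one summand is positive.
      have huniq : ∀ i' l', A i' l' → i' = i ∧ l' = l := by
        intro i' l' h'
        have hl : l' = l := by
          rcases lt_trichotomy l' l with h | h | h
          · exact absurd h'.1 (hil.2.1 i' l' h)
          · exact h
          · exact absurd hil.1 (h'.2.1 i l h)
        subst hl
        refine ⟨?_, rfl⟩
        by_contra hne
        refine hil.2.2 i' hne ?_
        have e : chain F ((List.ofFn θ.1).take (l' + 1)) (s i)
            = chain F ((List.ofFn θ.1).take (l' + 1)) (s i') := hil.1.trans h'.1.symm
        unfold EndsCollide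
        rw [← chain_take_drop F _ (l' + 1) (s i), e, chain_take_drop]
      rw [Finset.sum_eq_single i, Finset.sum_eq_single l]
      · exact ind_le_one _
      · intro l' _ hne
        exact ind_false fun h => hne (huniq _ _ h).2
      · simp
      · intro i' _ hne
        exact Finset.sum_eq_zero fun l' _ => ind_false fun h => hne (huniq _ _ h).1
      · simp
    · push Not at hex
      rw [Finset.sum_eq_zero fun i _ => Finset.sum_eq_zero fun l _ => ind_false (hex i l)]
      exact ind_nonneg _
  have hle := avg_mono key
  refine le_trans ?_ hle
  simp only [avg_sum, avg_sub]
  have hterm : ∀ (i : Fin m) (l : Fin t), P y - m * t * (P y * P y) - m * (P y * (t * κ + κ')) ≤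
      (avg fun θ : (Fin t → H) × G => ind (AtColumn F θ.1 l (s i) y))
        - ∑ j : Fin m, ∑ l' ∈ Finset.univ.filter (fun l' : Fin t => l' < l),
            (avg fun θ : (Fin t → H) × G =>
              ind (AtColumn F θ.1 l (s i) y ∧ AtColumn F θ.1 l' (s j) y))
        - ∑ j ∈ Finset.univ.erase i, (avg fun θ : (Fin t → H) × G =>
            ind (AtColumn F θ.1 l (s i) y ∧ EndsCollide F g θ (s i) (s j))) := by
    intro i l
    have e1 : (avg fun θ : (Fin t → H) × G => ind (AtColumn F θ.1 l (s i) y)) = P y := by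
      rw [← pr_atColumn F P h1 t l l.2 (s i) y, ← pr_fst (Ω' := G)]
      rfl
    have e2 : ∑ j : Fin m, ∑ l' ∈ Finset.univ.filter (fun l' : Fin t => l' < l),
        (avg fun θ : (Fin t → H) × G =>
          ind (AtColumn F θ.1 l (s i) y ∧ AtColumn F θ.1 l' (s j) y)) ≤ m * t * (P y * P y) := by
      calc _ ≤ ∑ _j : Fin m, ∑ _l' : Fin t, P y * P y := by
            refine Finset.sum_le_sum fun j _ => ?_
            refine (Finset.sum_le_sum fun l' hl' => ?_).trans
              (Finset.sum_le_sum_of_subset_of_nonneg (Finset.filter_subset _ _)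
                fun _ _ _ => mul_nonneg hP hP)
            have hlt : l' < l := (Finset.mem_filter.1 hl').2
            have := pr_atColumn_and F P h1 t l l' hlt l.2 (s i) (s j) y
            rw [← this, ← pr_fst (Ω' := G)]
            exact le_of_eq rfl
        _ = _ := by simp [mul_assoc]
    have e3 : ∑ j ∈ Finset.univ.erase i, (avg fun θ : (Fin t → H) × G =>
        ind (AtColumn F θ.1 l (s i) y ∧ EndsCollide F g θ (s i) (s j)))
        ≤ m * (P y * (t * κ + κ')) := by
      calc _ ≤ ∑ _j ∈ Finset.univ.erase i, P y * (t * κ + κ') :=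
            Finset.sum_le_sum fun j hj => pr_atColumn_endsCollide_le F g P κ κ' h1 h2 h3 t l l.2
              (s i) (s j) y fun e => (Finset.mem_erase.1 hj).1 (hs e).symm
        _ ≤ ∑ _j : Fin m, P y * (t * κ + κ') :=
            Finset.sum_le_sum_of_subset_of_nonneg (Finset.erase_subset _ _)
              fun _ _ _ => mul_nonneg hP hκ
        _ = _ := by simp
    rw [e1]
    linarith
  refine le_trans ?_ (Finset.sum_le_sum fun i _ => Finset.sum_le_sum fun l _ => hterm i l)
  simp only [Finset.sum_const, Finset.card_univ, Fintype.card_fin, nsmul_eq_mul]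
  have hmt : (0 : ℝ) ≤ m * t * P y := by positivity
  -- The sum over all pairs is m t P (1 - (m t P + m (t κ + κ'))), with the inner bracket at most
  -- 1/2.
  nlinarith [mul_le_mul_of_nonneg_left hm hmt]

open Classical in
/-- If every value is found with probability at least `p`, some sequence of tables finds all the
values of `W`. -/
lemma exists_tables_found {Θ : Type*} [Fintype Θ] [Nonempty Θ]
    (found : Θ → U → Prop) (p : ℝ)
    (W : Finset U) (hp : ∀ y ∈ W, p ≤ pr (fun θ => found θ y)) (r : ℕ) :
    ∃ θ : Fin r → Θ, (({y ∈ W | ∀ τ, ¬found (θ τ) y} : Finset U).card : ℝ)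
      ≤ (1 - p) ^ r * W.card := by
  induction r with
  | zero => exact ⟨Fin.elim0, by simp⟩
  | succ r ih =>
    obtain ⟨θ, hθ⟩ := ih
    set W' : Finset U := {y ∈ W | ∀ τ, ¬found (θ τ) y} with hW'
    -- Greedy choice: on average a new table finds at least a fraction p of the values still
    -- missing, so some table does.
    obtain ⟨θ₀, h₀⟩ := exists_avg_le fun θ : Θ => ∑ y ∈ W', ind (found θ y)
    have h1 : p * W'.card ≤ ∑ y ∈ W', ind (found θ₀ y) := by
      refine le_trans ?_ h₀
      rw [avg_sum, mul_comm, ← nsmul_eq_mul]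
      exact Finset.card_nsmul_le_sum _ _ _ fun y hy => hp y (Finset.mem_filter.1 hy).1
    have h2 : (({y ∈ W | ∀ τ, ¬found ((Fin.cons θ₀ θ : Fin (r + 1) → Θ) τ) y} : Finset U).card : ℝ)
        = W'.card - ∑ y ∈ W', ind (found θ₀ y) := by
      have e : ({y ∈ W | ∀ τ, ¬found ((Fin.cons θ₀ θ : Fin (r + 1) → Θ) τ) y} : Finset U)
          = W'.filter fun y => ¬found θ₀ y := by
        ext y
        simp only [hW', Finset.mem_filter, Fin.forall_fin_succ, Fin.cons_zero, Fin.cons_succ]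
        tauto
      have e' : ∑ y ∈ W', ind (found θ₀ y) = ((W'.filter fun y => found θ₀ y).card : ℝ) := by
        simp only [ind, Finset.sum_boole]
      rw [e, e', eq_sub_iff_add_eq, add_comm]
      exact_mod_cast Finset.card_filter_add_card_filter_not (s := W') (fun y => found θ₀ y)
    refine ⟨Fin.cons θ₀ θ, ?_⟩
    rw [h2]
    rcases le_or_gt p 1 with hp1 | hp1
    · calc (W'.card : ℝ) - ∑ y ∈ W', ind (found θ₀ y) ≤ (1 - p) * W'.card := by linarith
        _ ≤ (1 - p) * ((1 - p) ^ r * W.card) := by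
            gcongr
        _ = _ := by ring
    -- No probability exceeds 1, so p > 1 is only possible for empty W.
    · have hW : W = ∅ := by
        by_contra hne
        obtain ⟨y, hy⟩ := Finset.nonempty_iff_ne_empty.2 hne
        linarith [hp y hy, pr_le_one fun θ => found θ y]
      have : W' = ∅ := by rw [hW', hW]; rfl
      simp [this, hW]

lemma exists_tables_found_all {Θ : Type*} [Fintype Θ] [Nonempty Θ]
    (found : Θ → U → Prop) (p : ℝ)
    (W : Finset U) (hp : ∀ y ∈ W, p ≤ pr (fun θ => found θ y)) (r : ℕ)
    (hr : (1 - p) ^ r * W.card < 1) :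
    ∃ θ : Fin r → Θ, ∀ y ∈ W, ∃ τ, found (θ τ) y := by
  classical
  obtain ⟨θ, hθ⟩ := exists_tables_found found p W hp r
  refine ⟨θ, fun y hy => ?_⟩
  have h0 : ({y ∈ W | ∀ τ, ¬found (θ τ) y} : Finset U).card = 0 := by
    have := hθ.trans_lt hr
    norm_cast at this
    omega
  by_contra h
  push Not at h
  have : y ∈ ({y ∈ W | ∀ τ, ¬found (θ τ) y} : Finset U) := Finset.mem_filter.2 ⟨hy, h⟩
  rw [Finset.card_eq_zero.1 h0] at this
  simp at this

end rainbow

/-! ### Multiply-shift hashing -/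

/-- Multiply-shift hashing of `w`-bit words to numbers of `l` bits. -/
def mulShift {w : ℕ} (l : ℕ) (b x : BitVec w) : ℕ := ((2 * b + 1) * x).toNat / 2 ^ (w - l)

lemma mulShift_lt {w l : ℕ} (hl : l ≤ w) (b x : BitVec w) : mulShift l b x < 2 ^ l := by
  unfold mulShift
  rw [Nat.div_lt_iff_lt_mul (by positivity), ← pow_add, Nat.add_sub_cancel' hl]
  exact ((2 * b + 1) * x).isLt

/-- Equal leading l bits mean that the two products differ by less than 2^(w - l); this turns a
collision into a congruence with a small residue v. -/
lemma exists_small_of_mulShift_eq {w l : ℕ} (b x z : BitVec w)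
    (h : mulShift l b x = mulShift l b z) :
    ∃ v : ℤ, |v| < 2 ^ (w - l) ∧
      (2 : ℤ) ^ w ∣ (2 * b.toNat + 1) * ((x.toNat : ℤ) - z.toNat) - v := by
  have key : ∀ y : BitVec w, (2 : ℤ) ^ w ∣
      (2 * b.toNat + 1) * (y.toNat : ℤ) - (((2 * b + 1) * y).toNat : ℤ) := by
    intro y
    have h1 : (((2 * b + 1) * y).toNat : ℤ) = ((2 * b.toNat + 1) * (y.toNat : ℤ)) % 2 ^ w := by
      simp [BitVec.toNat_mul, BitVec.toNat_add, Int.mul_emod, Int.add_emod]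
    rw [h1]
    exact Int.dvd_self_sub_emod
  refine ⟨(((2 * b + 1) * x).toNat : ℤ) - ((2 * b + 1) * z).toNat, ?_, ?_⟩
  · unfold mulShift at h
    set X := ((2 * b + 1) * x).toNat
    set Z := ((2 * b + 1) * z).toNat
    have hD : 0 < 2 ^ (w - l) := by positivity
    have h1 := Nat.div_add_mod X (2 ^ (w - l))
    have h2 := Nat.div_add_mod Z (2 ^ (w - l))
    have h3 := Nat.mod_lt X hD
    have h4 := Nat.mod_lt Z hD
    rw [h] at h1
    have h3' : ((X % 2 ^ (w - l) : ℕ) : ℤ) < 2 ^ (w - l) := by exact_mod_cast h3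
    have h4' : ((Z % 2 ^ (w - l) : ℕ) : ℤ) < 2 ^ (w - l) := by exact_mod_cast h4
    have h1' : ((2 ^ (w - l) * (Z / 2 ^ (w - l)) : ℕ) : ℤ) + ((X % 2 ^ (w - l) : ℕ) : ℤ) = X := by
      exact_mod_cast h1
    have h2' : ((2 ^ (w - l) * (Z / 2 ^ (w - l)) : ℕ) : ℤ) + ((Z % 2 ^ (w - l) : ℕ) : ℤ) = Z := by
      exact_mod_cast h2
    rw [abs_lt]
    constructor <;> linarith [Int.natCast_nonneg (X % 2 ^ (w - l)),
      Int.natCast_nonneg (Z % 2 ^ (w - l))]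
  · have := dvd_sub (key x) (key z)
    have e : (2 * (b.toNat : ℤ) + 1) * ((x.toNat : ℤ) - z.toNat)
        - ((((2 * b + 1) * x).toNat : ℤ) - ((2 * b + 1) * z).toNat)
        = (2 * b.toNat + 1) * (x.toNat : ℤ) - (((2 * b + 1) * x).toNat : ℤ)
          - ((2 * b.toNat + 1) * (z.toNat : ℤ) - (((2 * b + 1) * z).toNat : ℤ)) := by ring
    rw [e]
    exact this

/-- With d = x - z and D = 2^(w - l - 1), a collision forces (2b + 1) d to lie in (-D, D) modulo
2^w. If some e satisfies 2 e d ≡ 2 D, then adding e to b shifts this residue by 2 D. The interval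
has 2^l disjoint translates of this kind, so the colliding multipliers also have 2^l disjoint
translates among the 2^w words. -/
lemma card_mulShift_eq_le {w l : ℕ} (hl : l + 1 ≤ w) (x z : BitVec w) (hxz : x ≠ z) :
    {b : BitVec w | mulShift (l + 1) b x = mulShift (l + 1) b z}.ncard * 2 ^ l ≤ 2 ^ w := by
  classical
  set D : ℤ := 2 ^ (w - (l + 1)) with hD
  have hDpos : 0 < D := by positivity
  have hDw : D * 2 ^ (l + 1) = 2 ^ w := by rw [hD, ← pow_add, Nat.sub_add_cancel hl]
  set d : ℤ := (x.toNat : ℤ) - z.toNat with hd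
  have hd0 : d ≠ 0 := by
    intro h
    exact hxz (BitVec.eq_of_toNat_eq (by omega))
  obtain ⟨o, hso, ho⟩ := (Int.finiteMultiplicity_iff.2
    ⟨by norm_num, hd0⟩ : FiniteMultiplicity 2 d).exists_eq_pow_mul_and_not_dvd
  set s := multiplicity 2 d with hs_def
  clear_value s
  have hodd : Odd o := by
    rcases Int.even_or_odd o with h | h
    · exact absurd h.two_dvd ho
    · exact h
  -- If 2^s ≥ D, the residue v is a multiple of 2^s below it, hence 0. Then 2^w would divide 2^s
  -- times an odd number with s < w, so there is no collision at all.
  by_cases hs : w - (l + 1) ≤ s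
  · have : {b : BitVec w | mulShift (l + 1) b x = mulShift (l + 1) b z} = ∅ := by
      ext b
      simp only [Set.mem_ofPred_eq, Set.mem_empty_iff_false, iff_false]
      intro h
      obtain ⟨v, hv, hdvd⟩ := exists_small_of_mulShift_eq b x z h
      have hsw : s < w := by
        by_contra! hws
        have h1 : (2 : ℤ) ^ w ∣ d := hso ▸ Dvd.dvd.mul_right (pow_dvd_pow 2 hws) o
        have h2 := Int.le_of_dvd (abs_pos.2 hd0) ((dvd_abs _ _).2 h1)
        have h3 : |d| < 2 ^ w := by
          have hx : (x.toNat : ℤ) < 2 ^ w := by exact_mod_cast x.isLt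
          have hz : (z.toNat : ℤ) < 2 ^ w := by exact_mod_cast z.isLt
          rw [abs_lt]
          constructor <;> omega
        omega
      have hv0 : v = 0 := by
        have h1 : (2 : ℤ) ^ s ∣ v := by
          have := (pow_dvd_pow (2 : ℤ) hsw.le).trans hdvd
          rw [← hd, hso] at this
          exact (dvd_sub_right (Dvd.dvd.mul_left (Dvd.intro _ rfl) _)).1 this
        refine Int.eq_zero_of_abs_lt_dvd h1 (hv.trans_le ?_)
        exact pow_le_pow_right₀ (by norm_num) hs
      rw [hv0, sub_zero, ← hd, hso] at hdvd
      obtain ⟨j, hj⟩ := Nat.exists_eq_add_of_lt hsw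
      have h1 : (2 : ℤ) ^ s * 2 ^ (j + 1) ∣ 2 ^ s * ((2 * b.toNat + 1) * o) := by
        have e1 : (2 : ℤ) ^ s * 2 ^ (j + 1) = 2 ^ w := by rw [← pow_add, hj]; congr 1
        have e2 : (2 : ℤ) ^ s * ((2 * b.toNat + 1) * o) = (2 * b.toNat + 1) * (2 ^ s * o) := by ring
        rw [e1, e2]
        exact hdvd
      have h2 := (mul_dvd_mul_iff_left (by positivity)).1 h1
      have h3 : (2 : ℤ) ∣ (2 * b.toNat + 1) * o := (Dvd.intro_left (2 ^ j) rfl).trans h2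
      have h4 : Odd ((2 * (b.toNat : ℤ) + 1) * o) := Odd.mul ⟨_, rfl⟩ hodd
      exact (Int.not_even_iff_odd.2 h4) (even_iff_two_dvd.2 h3)
    simp [this]
  · push Not at hs
    have hcop : IsCoprime o ((2 : ℤ) ^ w) := by
      refine IsCoprime.pow_right ?_
      obtain ⟨j, hj⟩ := hodd
      exact ⟨1, -j, by rw [hj]; ring⟩
    obtain ⟨p, q, hpq⟩ := hcop
    -- Here p inverts the odd part of d modulo 2^w, and the power of 2 fills 2^s up to D.
    set e : ℤ := p * 2 ^ (w - (l + 1) - s) with he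
    have hed : (2 : ℤ) ^ w ∣ 2 * e * d - 2 * D := by
      have h1 : D = 2 ^ (w - (l + 1) - s) * 2 ^ s := by
        rw [hD, ← pow_add, Nat.sub_add_cancel hs.le]
      refine ⟨-q * 2 * D, ?_⟩
      have h2 : 2 * e * d = 2 * D * (p * o) := by
        rw [he, hso, h1]; ring
      have h3 : p * o = 1 - q * 2 ^ w := by linarith
      rw [h2, h3]; ring
    set B : Set (BitVec w) := {b | mulShift (l + 1) b x = mulShift (l + 1) b z}
    have hshift : ∀ (b : BitVec w) (k : ℤ),
        (2 : ℤ) ^ w ∣ ((b + BitVec.ofInt w k).toNat : ℤ) - (b.toNat + k) := by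
      intro b k
      have : ((b + BitVec.ofInt w k).toNat : ℤ) = ((b.toNat : ℤ) + k) % 2 ^ w := by
        have h0 : 0 ≤ k % 2 ^ w := Int.emod_nonneg _ (by positivity)
        simp [BitVec.toNat_add, h0]
      rw [this, ← neg_sub]
      exact (dvd_neg).2 Int.dvd_self_sub_emod
    let φ : B × Fin (2 ^ l) → BitVec w := fun c => c.1 + BitVec.ofInt w ((c.2 : ℕ) * e)
    have hφ : Function.Injective φ := by
      rintro ⟨⟨b, hb⟩, i⟩ ⟨⟨b', hb'⟩, i'⟩ h
      obtain ⟨v, hv, hdvd⟩ := exists_small_of_mulShift_eq b x z hb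
      obtain ⟨v', hv', hdvd'⟩ := exists_small_of_mulShift_eq b' x z hb'
      rw [← hd] at hdvd hdvd'
      rw [← hD] at hv hv'
      have h1 : (2 : ℤ) ^ w ∣ (b.toNat + (i : ℕ) * e) - (b'.toNat + (i' : ℕ) * e) := by
        have h2 := hshift b ((i : ℕ) * e)
        have h3 := hshift b' ((i' : ℕ) * e)
        have h4 : b + BitVec.ofInt w ((i : ℕ) * e) = b' + BitVec.ofInt w ((i' : ℕ) * e) := h
        rw [h4] at h2
        have := dvd_sub h3 h2
        ring_nf at this ⊢
        exact this
      have h5 : (2 : ℤ) ^ w ∣ v + 2 * D * (i : ℕ) - (v' + 2 * D * (i' : ℕ)) := by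
        have h6 := Dvd.dvd.mul_left h1 (2 * d)
        have h7 := Dvd.dvd.mul_left hed (((i : ℕ) : ℤ) - (i' : ℕ))
        have := dvd_sub (dvd_sub (dvd_sub h6 h7) hdvd) (dvd_neg.2 hdvd')
        ring_nf at this ⊢
        exact this
      have hi := i.isLt
      have hi' := i'.isLt
      have hpow : (2 : ℤ) ^ w = 2 * D * 2 ^ l := by rw [← hDw, pow_succ]; ring
      have hil : ((i : ℕ) : ℤ) + 1 ≤ 2 ^ l := by exact_mod_cast hi
      have hil' : ((i' : ℕ) : ℤ) + 1 ≤ 2 ^ l := by exact_mod_cast hi'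
      rw [abs_lt] at hv hv'
      have h8 : v + 2 * D * (i : ℕ) - (v' + 2 * D * (i' : ℕ)) = 0 := by
        refine Int.eq_zero_of_abs_lt_dvd h5 ?_
        rw [hpow, abs_lt]
        have u1 := mul_le_mul_of_nonneg_left hil (by linarith : (0 : ℤ) ≤ 2 * D)
        have u2 := mul_le_mul_of_nonneg_left hil' (by linarith : (0 : ℤ) ≤ 2 * D)
        have u3 : 0 ≤ 2 * D * ((i : ℕ) : ℤ) := by positivity
        have u4 : 0 ≤ 2 * D * ((i' : ℕ) : ℤ) := by positivity
        constructor <;> linarith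
      have h9 : v - v' = 0 := by
        refine Int.eq_zero_of_abs_lt_dvd (m := 2 * D) ⟨(i' : ℕ) - (i : ℕ), by linarith⟩ ?_
        rw [abs_lt]
        constructor <;> linarith
      have h10 : 2 * D * (((i : ℕ) : ℤ) - (i' : ℕ)) = 0 := by linarith
      have h11 : (i : ℕ) = i' := by
        rcases mul_eq_zero.1 h10 with h | h <;> omega
      have h12 : i = i' := Fin.ext h11
      subst h12
      have h13 : b = b' := by
        have : b + BitVec.ofInt w ((i : ℕ) * e) = b' + BitVec.ofInt w ((i : ℕ) * e) := h
        exact (BitVec.add_left_inj _).1 this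
      subst h13
      rfl
    have hcard := Nat.card_le_card_of_injective φ hφ
    rw [Nat.card_prod, Nat.card_fin, Nat.card_congr (BitVec.equivFin (m := w)).toEquiv, Nat.card_fin] at hcard
    exact hcard

lemma card_bitVec (w : ℕ) : Fintype.card (BitVec w) = 2 ^ w := by
  rw [Fintype.card_congr (BitVec.equivFin (m := w)).toEquiv, Fintype.card_fin]

/-- Multiply-shift hashing is universal up to a factor of two. -/
lemma pr_mulShift_eq_le {w l : ℕ} (hl : l ≤ w) (x z : BitVec w) (hxz : x ≠ z) :
    pr (fun b : BitVec w => mulShift l b x = mulShift l b z) ≤ 2 / 2 ^ l := by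
  cases l with
  | zero => exact (pr_le_one _).trans (by norm_num)
  | succ l =>
    rw [pr_eq_card_div, card_bitVec, div_le_div_iff₀ (by positivity) (by positivity)]
    have := card_mulShift_eq_le hl x z hxz
    have h : ({b : BitVec w | mulShift (l + 1) b x = mulShift (l + 1) b z}.ncard : ℝ) * 2 ^ l
        ≤ 2 ^ w := by exact_mod_cast this
    push_cast
    rw [pow_succ]
    linarith

/-! ### Multiplicities and random column functions -/

open Classical in
/-- The number of ways to write `y` as a sum of one element from each list. -/
noncomputable def mult {K n : ℕ} {U : Type*} [AddCommGroup U] (A : Fin K → Fin n → U) (y : U) : ℕ :=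
  Fintype.card {i : Fin K → Fin n // ∑ j, A j (i j) = y}

lemma sum_ind_eq_mult {K n : ℕ} {U : Type*} [AddCommGroup U] (A : Fin K → Fin n → U) (y : U) :
    ∑ i : Fin K → Fin n, ind (∑ j, A j (i j) = y) = mult A y := by
  classical
  simp only [ind, mult, Finset.sum_boole, Fintype.card_subtype]

lemma one_le_mult {K n : ℕ} {U : Type*} [AddCommGroup U] (A : Fin K → Fin n → U) (y : U)
    (h : ∃ i : Fin K → Fin n, ∑ j, A j (i j) = y) : 1 ≤ mult A y := by
  classical
  obtain ⟨i, hi⟩ := h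
  unfold mult
  have : Nonempty {i : Fin K → Fin n // ∑ j, A j (i j) = y} := ⟨⟨i, hi⟩⟩
  exact Fintype.card_pos

lemma pr_apply_eq {X Y : Type*} [Fintype X] [Fintype Y] [DecidableEq X] (u : X) (a : Y) :
    pr (fun R : X → Y => R u = a) = 1 / Fintype.card Y := by
  classical
  have : Nonempty Y := ⟨a⟩
  have h := pr_comp_injective (U := Y) (fun _ : Unit => u) (fun _ _ _ => rfl)
    (fun R => ∀ i, R i = a)
  rw [pr_pi (fun _ : Unit => fun r : Y => r = a)] at h
  simpa [pr_eq_apply] using h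

lemma pr_apply_eq_and {X Y : Type*} [Fintype X] [Fintype Y] [DecidableEq X] (u v : X) (huv : u ≠ v)
    (a b : Y) :
    pr (fun R : X → Y => R u = a ∧ R v = b) = 1 / Fintype.card Y * (1 / Fintype.card Y) := by
  classical
  have : Nonempty Y := ⟨a⟩
  have hι : Function.Injective ![u, v] := by
    intro i j
    fin_cases i <;> fin_cases j <;> simp [huv, huv.symm]
  have h := pr_comp_injective (U := Y) ![u, v] hι (fun R => ∀ i, R i = ![a, b] i)
  rw [pr_pi (fun i : Fin 2 => fun r : Y => r = ![a, b] i)] at h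
  simpa [pr_eq_apply, Fin.forall_fin_two, sq] using h

/-- Parameters of a random function from words to `Fin n`: a multiplier for a hash function to `l`
bits and a table. -/
abbrev IdxHash (w l n : ℕ) : Type := BitVec w × (Fin (2 ^ l) → Fin n)

/-- The function from words to `Fin n` given by its parameters. -/
def IdxHash.eval {w l n : ℕ} (hl : l ≤ w) (h : IdxHash w l n) (x : BitVec w) : Fin n :=
  h.2 ⟨mulShift l h.1 x, mulShift_lt hl h.1 x⟩

lemma pr_idxHash_eq {w l n : ℕ} (hl : l ≤ w) (x : BitVec w) (a : Fin n) :
    pr (fun h : IdxHash w l n => h.eval hl x = a) = 1 / n := by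
  rw [pr_prod]
  have h : ∀ c : BitVec w, pr (fun R : Fin (2 ^ l) → Fin n => IdxHash.eval hl (c, R) x = a)
      = 1 / n := by
    intro c
    have h := pr_apply_eq (⟨mulShift l c x, mulShift_lt hl c x⟩ : Fin (2 ^ l)) a
    rwa [Fintype.card_fin] at h
  simp only [h, avg_const]

/-- If the hash values collide (probability at most 2 / 2^l ≤ 2 / n), one table entry decides,
giving 2 / n^2; otherwise two independent entries give 1 / n^2. A table of about n entries thus
replaces a random function on all words, which would not fit into memory. -/
lemma pr_idxHash_eq_and_le {w l n : ℕ} (hl : l ≤ w) (hn : n ≤ 2 ^ l) (x z : BitVec w)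
    (hxz : x ≠ z) (a b : Fin n) :
    pr (fun h : IdxHash w l n => h.eval hl x = a ∧ h.eval hl z = b) ≤ 3 / (n : ℝ) ^ 2 := by
  have hn0 : (0 : ℝ) < n := by exact_mod_cast a.pos
  rw [pr_prod]
  calc _ ≤ avg (fun c : BitVec w => 1 / (n : ℝ) * ind (mulShift l c x = mulShift l c z)
          + 1 / (n : ℝ) * (1 / n)) := by
        refine avg_mono fun c => ?_
        by_cases hc : mulShift l c x = mulShift l c z
        · rw [ind_true hc]
          refine le_trans (pr_mono (q := fun R : Fin (2 ^ l) → Fin n =>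
            R ⟨mulShift l c x, mulShift_lt hl c x⟩ = a) fun R h => h.1) ?_
          rw [pr_apply_eq, Fintype.card_fin]
          have : 0 ≤ 1 / (n : ℝ) * (1 / n) := by positivity
          linarith
        · rw [ind_false hc, mul_zero, zero_add]
          have h := pr_apply_eq_and (⟨mulShift l c x, mulShift_lt hl c x⟩ : Fin (2 ^ l))
            ⟨mulShift l c z, mulShift_lt hl c z⟩ (fun e => hc (by simpa using e)) a b
          rw [Fintype.card_fin] at h
          exact le_of_eq h
    _ = 1 / n * pr (fun c : BitVec w => mulShift l c x = mulShift l c z) + 1 / (n : ℝ) * (1 / n) := by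
        rw [avg_add, avg_const_mul, avg_const]; rfl
    _ ≤ 1 / n * (2 / 2 ^ l) + 1 / (n : ℝ) * (1 / n) := by
        gcongr
        exact pr_mulShift_eq_le hl x z hxz
    _ ≤ 1 / n * (2 / n) + 1 / (n : ℝ) * (1 / n) := by
        gcongr
        exact_mod_cast hn
    _ = 3 / (n : ℝ) ^ 2 := by
        field_simp
        norm_num

/-- The random sum of list elements that is assigned to a universe element. -/
def colFun {K n w l : ℕ} {U : Type*} [AddCommGroup U] (hl : l ≤ w) (enc : U → BitVec w)
    (A : Fin K → Fin n → U) (h : Fin K → IdxHash w l n) (y : U) : U :=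
  ∑ j, A j ((h j).eval hl (enc y))

/-- The tuple of indices is uniform for every input; this is the hypothesis `h1` on column
functions. -/
lemma pr_colFun_eq {K n w l : ℕ} {U : Type*} [AddCommGroup U] (hl : l ≤ w) (enc : U → BitVec w)
    (A : Fin K → Fin n → U) (x y : U) :
    pr (fun h : Fin K → IdxHash w l n => colFun hl enc A h x = y) = mult A y / (n : ℝ) ^ K := by
  rw [pr_eq_sum_fiber (fun h j => (h j).eval hl (enc x)), ← sum_ind_eq_mult, Finset.sum_div]
  refine Finset.sum_congr rfl fun ξ _ => ?_
  calc _ = pr (fun h : Fin K → IdxHash w l n => (∑ j, A j (ξ j) = y) ∧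
          ∀ j, (h j).eval hl (enc x) = ξ j) := by
        refine pr_congr fun h => ?_
        constructor
        · rintro ⟨h1, h2⟩
          subst h1
          exact ⟨h2, fun _ => rfl⟩
        · rintro ⟨h1, h2⟩
          have : (fun j => (h j).eval hl (enc x)) = ξ := funext h2
          subst this
          exact ⟨rfl, h1⟩
    _ = _ := by
        rw [pr_const_and, pr_pi (fun j => fun c : IdxHash w l n => c.eval hl (enc x) = ξ j)]
        simp only [pr_idxHash_eq]
        simp [div_eq_mul_inv]

/-- Summing over pairs of representations of y gives (mult y)^2 (3 / n^2)^K. Bounding only one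
factor mult y by M leaves the shape κ * P y of hypothesis `h2`. -/
lemma pr_colFun_eq_and_le {K n w l : ℕ} {U : Type*} [AddCommGroup U] (hl : l ≤ w)
    (hn : n ≤ 2 ^ l) (enc : U → BitVec w) (henc : Function.Injective enc)
    (A : Fin K → Fin n → U) (M : ℕ) (hM : ∀ y, mult A y ≤ M) (x z y : U) (hxz : x ≠ z) :
    pr (fun h : Fin K → IdxHash w l n => colFun hl enc A h x = y ∧ colFun hl enc A h z = y)
      ≤ 3 ^ K * M / (n : ℝ) ^ K * (mult A y / (n : ℝ) ^ K) := by
  rw [pr_eq_sum_fiber (fun h : Fin K → IdxHash w l n =>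
    ((fun j => (h j).eval hl (enc x), fun j => (h j).eval hl (enc z)) :
      (Fin K → Fin n) × (Fin K → Fin n)))]
  calc _ ≤ ∑ ξ : (Fin K → Fin n) × (Fin K → Fin n),
          ind (∑ j, A j (ξ.1 j) = y) * ind (∑ j, A j (ξ.2 j) = y) * (3 / (n : ℝ) ^ 2) ^ K := by
        refine Finset.sum_le_sum fun ξ _ => ?_
        calc _ ≤ pr (fun h : Fin K → IdxHash w l n =>
              ((∑ j, A j (ξ.1 j) = y) ∧ (∑ j, A j (ξ.2 j) = y)) ∧
              ∀ j, (h j).eval hl (enc x) = ξ.1 j ∧ (h j).eval hl (enc z) = ξ.2 j) := by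
              refine pr_mono ?_
              rintro h ⟨h1, h2, h3⟩
              subst h1
              exact ⟨⟨h2, h3⟩, fun _ => ⟨rfl, rfl⟩⟩
          _ ≤ _ := by
              rw [pr_const_and, ind_and, pr_pi (fun j => fun c : IdxHash w l n =>
                c.eval hl (enc x) = ξ.1 j ∧ c.eval hl (enc z) = ξ.2 j)]
              refine mul_le_mul_of_nonneg_left ?_ (mul_nonneg (ind_nonneg _) (ind_nonneg _))
              calc _ ≤ ∏ _j : Fin K, 3 / (n : ℝ) ^ 2 :=
                    Finset.prod_le_prod (fun _ _ => pr_nonneg _) fun j _ =>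
                      pr_idxHash_eq_and_le hl hn _ _ (fun e => hxz (henc e)) _ _
                _ = _ := by simp only [Finset.prod_const, Finset.card_univ, Fintype.card_fin]
    _ = (mult A y : ℝ) * mult A y * (3 / (n : ℝ) ^ 2) ^ K := by
        rw [← Finset.sum_mul, ← sum_ind_eq_mult, Finset.sum_mul_sum, Fintype.sum_prod_type]
    _ ≤ M * mult A y * (3 / (n : ℝ) ^ 2) ^ K := by
        gcongr
        exact hM y
    _ = _ := by
        rw [div_pow, ← pow_mul, mul_comm 2 K, pow_mul, div_mul_div_comm, ← sq]
        ring

/-! ### Upper bounds for the multiplicities of a random instance -/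

lemma pr_fin_succ' {H : Type*} [Fintype H] {t : ℕ} (p : (Fin (t + 1) → H) → Prop) :
    pr p = avg fun ω : Fin t → H => pr fun h : H => p (Fin.cons h ω) := by
  have h := pr_equiv ((Equiv.prodComm _ _).trans (Fin.consEquiv (fun _ : Fin (t + 1) => H))) p
  rw [← h, pr_prod]
  rfl

section

set_option linter.unusedSectionVars false

variable {U : Type*} [AddCommGroup U] [Fintype U]

/-- Reflection of all values of a function at the value at `i₀`. -/
def reflectAt {ι : Type*} [DecidableEq ι] (i₀ : ι) : (ι → U) ≃ (ι → U) :=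
  Function.Involutive.toPerm (fun a i => if i = i₀ then a i₀ else a i₀ - a i) (by
    intro a
    funext i
    by_cases h : i = i₀
    · simp [h]
    · simp [h])

open Classical in
-- Reflection at i₀ preserves the distribution and turns the difference a i₀ - a i into the single
-- entry a i, so that the s conditions become independent.
lemma pr_forall_mem_le {n s : ℕ} (B : Finset U) (I : Finset (Fin n)) (i₀ : Fin n) (hi₀ : i₀ ∈ I)
    (hI : I.card = s + 1) (b : U) :
    pr (fun a : Fin n → U => ∀ i ∈ I.erase i₀, b + a i₀ - a i ∈ B)
      = ((B.card : ℝ) / Fintype.card U) ^ s := by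
  have hU : (Fintype.card U : ℝ) ≠ 0 := by exact_mod_cast Fintype.card_ne_zero
  calc _ = pr (fun a : Fin n → U => ∀ i, i ∈ I.erase i₀ → b + a i ∈ B) := by
        rw [← pr_equiv (reflectAt i₀) (fun a : Fin n → U => ∀ i, i ∈ I.erase i₀ → b + a i ∈ B)]
        refine pr_congr fun a => forall₂_congr fun i hi => ?_
        have : reflectAt i₀ a i = a i₀ - a i := by
          show (if i = i₀ then a i₀ else a i₀ - a i) = _
          rw [if_neg (Finset.ne_of_mem_erase hi)]
        rw [this, add_sub_assoc]
    _ = ∏ i, pr (fun u : U => i ∈ I.erase i₀ → b + u ∈ B) :=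
        pr_pi fun i => fun u : U => i ∈ I.erase i₀ → b + u ∈ B
    _ = ∏ i, if i ∈ I.erase i₀ then (B.card : ℝ) / Fintype.card U else 1 := by
        refine Finset.prod_congr rfl fun i _ => ?_
        by_cases hi : i ∈ I.erase i₀
        · simp only [hi, forall_const, if_true]
          refine (pr_equiv (Equiv.addLeft b) (fun u => u ∈ B)).trans ?_
          rw [pr_eq_card_div]
          simp
        · simp only [hi, false_imp_iff, if_false]
          simp [pr, ind, avg_const]
    _ = _ := by
        rw [Finset.prod_ite_mem, Finset.univ_inter, Finset.prod_const, Finset.card_erase_of_mem hi₀,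
          hI, Nat.add_sub_cancel]

open Classical in
-- The union bound is over the (s + 1)-sets I. The element y ranges over the whole universe, but y -
-- a i₀ lies in B for one i₀ in I, which leaves only B.card choices.
lemma pr_many_mem_le (n s : ℕ) (B : Finset U) :
    pr (fun a : Fin n → U => ∃ y, s + 1 ≤ (Finset.univ.filter fun i => y - a i ∈ B).card)
      ≤ n.choose (s + 1) * (B.card * ((B.card : ℝ) / Fintype.card U) ^ s) := by
  have hne : ∀ I ∈ Finset.powersetCard (s + 1) (Finset.univ : Finset (Fin n)), I.Nonempty := by
    intro I hI
    rw [← Finset.card_pos, (Finset.mem_powersetCard.1 hI).2]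
    omega
  calc _ ≤ pr (fun a : Fin n → U => ∃ I ∈ Finset.powersetCard (s + 1) Finset.univ,
          ∃ y, ∀ i ∈ I, y - a i ∈ B) := by
        refine pr_mono ?_
        rintro a ⟨y, hy⟩
        obtain ⟨I, hI, hc⟩ := Finset.exists_subset_card_eq hy
        exact ⟨I, Finset.mem_powersetCard.2 ⟨Finset.subset_univ _, hc⟩, y,
          fun i hi => (Finset.mem_filter.1 (hI hi)).2⟩
    _ ≤ ∑ I ∈ Finset.powersetCard (s + 1) Finset.univ,
          pr (fun a : Fin n → U => ∃ y, ∀ i ∈ I, y - a i ∈ B) := pr_exists_le_sum _ _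
    _ ≤ ∑ _I ∈ Finset.powersetCard (s + 1) (Finset.univ : Finset (Fin n)),
          B.card * ((B.card : ℝ) / Fintype.card U) ^ s := by
        refine Finset.sum_le_sum fun I hI => ?_
        obtain ⟨i₀, hi₀⟩ := hne I hI
        calc _ ≤ pr (fun a : Fin n → U => ∃ b ∈ B, ∀ i ∈ I.erase i₀, b + a i₀ - a i ∈ B) := by
              refine pr_mono ?_
              rintro a ⟨y, hy⟩
              refine ⟨y - a i₀, hy i₀ hi₀, fun i hi => ?_⟩
              rw [sub_add_cancel]
              exact hy i (Finset.mem_of_mem_erase hi)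
          _ ≤ ∑ b ∈ B, pr (fun a : Fin n → U => ∀ i ∈ I.erase i₀, b + a i₀ - a i ∈ B) :=
              pr_exists_le_sum _ _
          _ = _ := by
              rw [Finset.sum_congr rfl fun b _ => pr_forall_mem_le B I i₀ hi₀
                (Finset.mem_powersetCard.1 hI).2 b]
              simp
    _ = _ := by simp

lemma mult_cons {K n : ℕ} (a : Fin n → U) (A : Fin K → Fin n → U) (y : U) :
    mult (Fin.cons a A : Fin (K + 1) → Fin n → U) y = ∑ i, mult A (y - a i) := by
  have h : (mult (Fin.cons a A : Fin (K + 1) → Fin n → U) y : ℝ)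
      = ((∑ i, mult A (y - a i) : ℕ) : ℝ) := by
    push_cast
    simp only [← sum_ind_eq_mult]
    rw [← (Fin.consEquiv (fun _ : Fin (K + 1) => Fin n)).sum_comp, Fintype.sum_prod_type]
    refine Finset.sum_congr rfl fun i _ => Finset.sum_congr rfl fun ξ _ => ?_
    simp only [Fin.consEquiv_apply, Fin.sum_univ_succ, Fin.cons_zero, Fin.cons_succ]
    congr 1
    rw [eq_sub_iff_add_eq', eq_iff_iff]
  exact_mod_cast h

lemma card_support_mult_le {K n : ℕ} (A : Fin K → Fin n → U) :
    (Finset.univ.filter fun y => mult A y ≠ 0).card ≤ n ^ K := by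
  classical
  calc _ ≤ (Finset.univ.image fun i : Fin K → Fin n => ∑ j, A j (i j)).card := by
        refine Finset.card_le_card fun y hy => ?_
        have h := (Finset.mem_filter.1 hy).2
        by_contra hne
        refine h ?_
        unfold mult
        rw [Fintype.card_eq_zero_iff]
        exact ⟨fun i => hne (Finset.mem_image.2 ⟨i, Finset.mem_univ _, i.2⟩)⟩
    _ ≤ Fintype.card (Fin K → Fin n) := Finset.card_image_le
    _ = _ := by simp

open Classical in
-- Only those i contribute for which y - a i is a sum over the remaining lists; so each new list
-- multiplies the maximal multiplicity by at most s.
lemma mult_cons_le {K n s M : ℕ} (a : Fin n → U) (A : Fin K → Fin n → U) (hM : ∀ y, mult A y ≤ M)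
    (y : U) (h : (Finset.univ.filter fun i =>
      y - a i ∈ Finset.univ.filter fun z => mult A z ≠ 0).card ≤ s) :
    mult (Fin.cons a A : Fin (K + 1) → Fin n → U) y ≤ M * s := by
  rw [mult_cons]
  calc _ = ∑ i ∈ Finset.univ.filter (fun i =>
        y - a i ∈ Finset.univ.filter fun z => mult A z ≠ 0), mult A (y - a i) := by
        rw [Finset.sum_filter]
        refine Finset.sum_congr rfl fun i _ => ?_
        by_cases h0 : mult A (y - a i) = 0 <;> simp [h0]
    _ ≤ _ := by
        refine (Finset.sum_le_card_nsmul _ _ M fun i _ => hM _).trans ?_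
        rw [smul_eq_mul, mul_comm]
        exact Nat.mul_le_mul_left M h

/-- With high probability no value has many representations as a sum of list elements. -/
lemma pr_mult_gt_le {n s : ℕ} (hn : 1 ≤ n) (N : ℝ) :
    ∀ K : ℕ, (n : ℝ) ^ K ≤ N → pr (fun A : Fin K → Fin n → U => ∃ y, s ^ K < mult A y)
      ≤ K * (N ^ (s + 1) / ((Fintype.card U : ℝ) ^ s * (s + 1).factorial)) := by
  classical
  intro K
  induction K with
  | zero =>
    intro _
    have : ∀ A : Fin 0 → Fin n → U, ¬∃ y, s ^ 0 < mult A y := by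
      rintro A ⟨y, hy⟩
      have h : mult A y ≤ Fintype.card (Fin 0 → Fin n) := Fintype.card_subtype_le _
      simp only [Fintype.card_unique] at h
      rw [pow_zero] at hy
      omega
    simp only [pr, ind_false (this _)]
    simp [avg]
  | succ K ih =>
    intro hN
    have hn1 : (1 : ℝ) ≤ n := by exact_mod_cast hn
    have hU : (0 : ℝ) < Fintype.card U := by exact_mod_cast Fintype.card_pos
    have ih' := ih ((pow_le_pow_right₀ hn1 (Nat.le_succ K)).trans hN)
    -- The bound N is kept fixed through the induction, so that every list contributes the same
    -- error ε.
    set ε := N ^ (s + 1) / ((Fintype.card U : ℝ) ^ s * (s + 1).factorial) with hε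
    rw [pr_fin_succ']
    calc _ ≤ avg (fun A : Fin K → Fin n → U => ind (∃ y, s ^ K < mult A y) + ε) := by
          refine avg_mono fun A => ?_
          by_cases hA : ∃ y, s ^ K < mult A y
          · rw [ind_true hA]
            refine (pr_le_one _).trans ?_
            have : 0 ≤ ε := by
              have : (0 : ℝ) ≤ N := (by positivity : (0 : ℝ) ≤ (n : ℝ) ^ (K + 1)).trans hN
              positivity
            linarith
          · rw [ind_false hA, zero_add]
            push Not at hA
            set B := Finset.univ.filter fun z => mult A z ≠ 0 with hB
            have hBc : (B.card : ℝ) ≤ (n : ℝ) ^ K := by exact_mod_cast card_support_mult_le A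
            calc _ ≤ pr (fun a : Fin n → U => ∃ y, s + 1 ≤
                    (Finset.univ.filter fun i => y - a i ∈ B).card) := by
                  refine pr_mono ?_
                  rintro a ⟨y, hy⟩
                  refine ⟨y, ?_⟩
                  by_contra! hlt
                  have := mult_cons_le a A hA y (Nat.lt_succ_iff.1 hlt)
                  rw [← pow_succ] at this
                  omega
              _ ≤ _ := pr_many_mem_le n s B
              _ ≤ (n : ℝ) ^ (s + 1) / (s + 1).factorial *
                    ((n : ℝ) ^ K * ((n : ℝ) ^ K / Fintype.card U) ^ s) := by
                  gcongr
                  exact Nat.choose_le_pow_div (s + 1) n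
              _ = ((n : ℝ) ^ (K + 1)) ^ (s + 1) /
                    ((Fintype.card U : ℝ) ^ s * (s + 1).factorial) := by
                  rw [div_pow, pow_succ (n : ℝ) K, mul_pow, pow_succ ((n : ℝ) ^ K) s]
                  field_simp
              _ ≤ ε := by
                  rw [hε]
                  gcongr
      _ = pr (fun A : Fin K → Fin n → U => ∃ y, s ^ K < mult A y) + ε := by
          rw [avg_add, avg_const]; rfl
      _ ≤ _ := by
          push_cast
          linarith

end

/-! ### Small universes: every element is a sum -/

section

variable {U : Type*} [AddCommGroup U] [Fintype U]

/-- Translating the one entry A j (x j) translates the sum and keeps every event that ignores this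
entry. -/
lemma pr_listSum_eq_and {K n : ℕ} (x : Fin K → Fin n) (j : Fin K) (c : U)
    (E : (Fin K → Fin n → U) → Prop)
    (hE : ∀ u A, E (A + fun j' i' => if j' = j ∧ i' = x j then u else 0) ↔ E A) :
    pr (fun A : Fin K → Fin n → U => (∑ j, A j (x j)) = c ∧ E A) = pr E / Fintype.card U := by
  refine pr_eq_and_of_translate (fun A : Fin K → Fin n → U => ∑ j, A j (x j)) E
    (fun u => Equiv.addRight fun j' i' => if j' = j ∧ i' = x j then u else 0) ?_ hE c
  intro u A
  simp only [Equiv.coe_addRight, Pi.add_apply, Finset.sum_add_distrib]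
  congr 1
  rw [Finset.sum_eq_single j]
  · simp
  · intro j' _ hj'
    simp [hj']
  · simp

lemma pr_listSum_eq {K n : ℕ} (hK : 0 < K) (x : Fin K → Fin n) (c : U) :
    pr (fun A : Fin K → Fin n → U => (∑ j, A j (x j)) = c) = 1 / Fintype.card U := by
  have h := pr_listSum_eq_and x ⟨0, hK⟩ c (fun _ => True) (fun _ _ => Iff.rfl)
  simp only [and_true] at h
  rw [h]
  simp [pr, ind, avg_const]

/-- Where the tuples differ, x uses an entry that x' does not. Pairwise independence is all that the
second moment needs. -/
lemma pr_listSum_eq_and_eq {K n : ℕ} (hK : 0 < K) (x x' : Fin K → Fin n) (hx : x ≠ x') (c : U) :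
    pr (fun A : Fin K → Fin n → U => (∑ j, A j (x j)) = c ∧ (∑ j, A j (x' j)) = c)
      = 1 / Fintype.card U * (1 / Fintype.card U) := by
  obtain ⟨j, hj⟩ := Function.ne_iff.1 hx
  rw [pr_listSum_eq_and x j c fun A => (∑ j, A j (x' j)) = c, pr_listSum_eq hK]
  · ring
  · intro u A
    have : ∑ j', (if j' = j ∧ x' j' = x j then u else 0) = 0 := by
      refine Finset.sum_eq_zero fun j' _ => if_neg ?_
      rintro ⟨rfl, h⟩
      exact hj h.symm
    simp only [Pi.add_apply, Finset.sum_add_distrib, this, add_zero]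

/-- Chebyshev's inequality for the number of representations. -/
lemma pr_mult_eq_zero_le {K n : ℕ} (hK : 0 < K) (hn : 0 < n) (c : U) :
    pr (fun A : Fin K → Fin n → U => mult A c = 0) ≤ Fintype.card U / (n : ℝ) ^ K := by
  classical
  have hU : (0 : ℝ) < Fintype.card U := by exact_mod_cast Fintype.card_pos
  have hn' : (0 : ℝ) < n := by exact_mod_cast hn
  set q : ℝ := 1 / Fintype.card U with hq
  set N : ℝ := (n : ℝ) ^ K with hN
  have hN0 : 0 < N := by positivity
  have hq0 : 0 < q := by positivity
  have hcard : (Fintype.card (Fin K → Fin n) : ℝ) = N := by simp [hN]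
  have hE : avg (fun A : Fin K → Fin n → U => (mult A c : ℝ)) = N * q := by
    simp only [← sum_ind_eq_mult]
    rw [avg_sum]
    have : ∀ x : Fin K → Fin n,
        avg (fun A : Fin K → Fin n → U => ind ((∑ j, A j (x j)) = c)) = q :=
      fun x => pr_listSum_eq hK x c
    simp only [this, Finset.sum_const, Finset.card_univ, nsmul_eq_mul, hcard]
  have hE2 : avg (fun A : Fin K → Fin n → U => (mult A c : ℝ) * mult A c) ≤ N * q + N * N * (q * q) := by
    simp only [← sum_ind_eq_mult, Finset.sum_mul_sum, ← ind_and]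
    simp only [avg_sum]
    calc _ ≤ ∑ x : Fin K → Fin n, ∑ x' : Fin K → Fin n, (ind (x = x') * q + q * q) := by
          refine Finset.sum_le_sum fun x _ => Finset.sum_le_sum fun x' _ => ?_
          by_cases h : x = x'
          · subst h
            rw [ind_true rfl, one_mul]
            simp only [and_self]
            have : avg (fun A : Fin K → Fin n → U => ind ((∑ j, A j (x j)) = c)) = q :=
              pr_listSum_eq hK x c
            rw [this]
            nlinarith
          · rw [ind_false h, zero_mul, zero_add]
            exact (pr_listSum_eq_and_eq hK x x' h c).le
      _ = _ := by
          simp only [Finset.sum_add_distrib, sum_ind_eq _ (fun _ => q), Finset.sum_const,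
            Finset.card_univ, nsmul_eq_mul, hcard]
          ring
  -- The indicator of mult = 0 is at most ((mult - N q) / (N q))^2, and the variance is at most the
  -- mean N q.
  calc _ ≤ avg (fun A : Fin K → Fin n → U =>
          (1 / (N * q)) ^ 2 * ((mult A c : ℝ) * mult A c - 2 * (N * q) * mult A c + (N * q) ^ 2)) := by
        refine avg_mono fun A => ?_
        have e : (mult A c : ℝ) * mult A c - 2 * (N * q) * mult A c + (N * q) ^ 2
            = ((mult A c : ℝ) - N * q) ^ 2 := by ring
        rw [e]
        by_cases h : mult A c = 0
        · rw [ind_true h, h, Nat.cast_zero, zero_sub, neg_sq, ← mul_pow, one_div,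
            inv_mul_cancel₀ (by positivity), one_pow]
        · rw [ind_false h]
          positivity
    _ = (1 / (N * q)) ^ 2 * (avg (fun A : Fin K → Fin n → U => (mult A c : ℝ) * mult A c)
          - 2 * (N * q) * (N * q) + (N * q) ^ 2) := by
        rw [avg_const_mul, avg_add, avg_sub, avg_const_mul, avg_const, hE]
    _ ≤ (1 / (N * q)) ^ 2 * (N * q) := by
        gcongr
        linarith
    _ = _ := by
        rw [hq]
        field_simp

/-- Chebyshev alone is too weak for a union bound over the universe. Cutting each list into G
disjoint blocks of length b gives G independent instances; c is missed only if each of them misses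
it. -/
lemma pr_exists_mult_eq_zero_le {K n b G : ℕ} (hK : 0 < K) (hb : 0 < b) (hG : G * b ≤ n) :
    pr (fun A : Fin K → Fin n → U => ∃ c, mult A c = 0)
      ≤ Fintype.card U * ((Fintype.card U : ℝ) / (b : ℝ) ^ K) ^ G := by
  classical
  let ι : Fin G × Fin K × Fin b → Fin K × Fin n :=
    fun x => (x.2.1, Fin.castLE hG (finProdFinEquiv (x.1, x.2.2)))
  have hι : Function.Injective ι := by
    rintro ⟨g, j, i⟩ ⟨g', j', i'⟩ h
    simp only [ι, Prod.mk.injEq] at h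
    have h2 := finProdFinEquiv.injective (Fin.castLE_injective hG h.2)
    simp only [Prod.mk.injEq] at h2
    simp [h.1, h2.1, h2.2]
  have key : ∀ c : U, pr (fun A : Fin K → Fin n → U => mult A c = 0)
      ≤ ((Fintype.card U : ℝ) / (b : ℝ) ^ K) ^ G := by
    intro c
    let p : (Fin G × Fin K × Fin b → U) → Prop :=
      fun φ => ∀ g, mult (fun j i => φ (g, j, i)) c = 0
    calc _ = pr (fun A : Fin K × Fin n → U => mult (fun j i => A (j, i)) c = 0) := by
          rw [← pr_equiv (Equiv.curry (Fin K) (Fin n) U)]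
          rfl
      _ ≤ pr (fun A : Fin K × Fin n → U => p (A ∘ ι)) := by
          refine pr_mono fun A hA g => ?_
          by_contra hne
          unfold mult at hA hne
          rw [Fintype.card_eq_zero_iff] at hA hne
          rw [not_isEmpty_iff] at hne
          obtain ⟨i, hi⟩ := hne
          exact hA.false ⟨fun j => (ι (g, j, i j)).2, hi⟩
      _ = pr p := pr_comp_injective ι hι p
      _ = pr (fun B : Fin G → Fin K → Fin b → U => ∀ g, mult (B g) c = 0) := by
          rw [← pr_equiv ((Equiv.curry (Fin G) (Fin K × Fin b) U).trans
            (Equiv.piCongrRight fun _ => Equiv.curry (Fin K) (Fin b) U))]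
          rfl
      _ = ∏ _g : Fin G, pr (fun B : Fin K → Fin b → U => mult B c = 0) :=
          pr_pi fun _ => fun B : Fin K → Fin b → U => mult B c = 0
      _ ≤ ∏ _g : Fin G, (Fintype.card U : ℝ) / (b : ℝ) ^ K :=
          Finset.prod_le_prod (fun _ _ => pr_nonneg _) fun _ _ => pr_mult_eq_zero_le hK hb c
      _ = _ := by rw [Finset.prod_const, Finset.card_univ, Fintype.card_fin]
  calc _ = pr (fun A : Fin K → Fin n → U => ∃ c ∈ Finset.univ, mult A c = 0) := by simp
    _ ≤ ∑ c, pr (fun A : Fin K → Fin n → U => mult A c = 0) := pr_exists_le_sum _ _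
    _ ≤ ∑ _c : U, ((Fintype.card U : ℝ) / (b : ℝ) ^ K) ^ G :=
        Finset.sum_le_sum fun c _ => key c
    _ = _ := by simp

end

/-! ### The query program and its simulation -/

/-- The query program: an interpreter of the records that the preprocessing leaves at the beginning
of the memory. Every record consists of an operation code, a multiplier, a base address and a shift.
Register `1` points to the next word, register `2` holds the current element, register `3` the
accumulator. -/
def queryProgram : List Instr :=
  [.const 10 1,
   .load 5 1, .op .add 1 1 10,
   .load 6 1, .op .add 1 1 10,
   .load 7 1, .op .add 1 1 10,
   .load 8 1, .op .add 1 1 10,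
   .op .mul 9 6 2, .op .shr 9 9 8, .op .add 9 9 7, .load 9 9,
   .const 4 0, .jumpEq 5 4 26,
   .const 4 1, .jumpEq 5 4 28,
   .const 4 2, .jumpEq 5 4 31,
   .const 4 3, .jumpEq 5 4 33,
   .const 4 4, .jumpEq 5 4 35,
   .const 4 5, .jumpEq 5 4 37,
   .halt false,
   .univAdd 3 3 9, .jumpEq 0 0 0,
   .op .or 2 3 3, .jumpEq 2 0 37, .jumpEq 0 0 0,
   .op .or 2 9 9, .jumpEq 0 0 0,
   .op .or 2 0 0, .jumpEq 0 0 0,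
   .op .or 3 6 6, .jumpEq 0 0 0,
   .halt true]

/-- Operations of the records: add a table entry to the accumulator; make the accumulator the
current element and accept if it is the queried one; replace the current element by a table entry;
replace it by the queried element; initialize the accumulator; accept; reject. -/
inductive RecOp
  | add | fin | jump | reset | init | accept | reject

/-- Code of an operation. -/
def RecOp.code : RecOp → ℕ
  | .add => 0 | .fin => 1 | .jump => 2 | .reset => 3 | .init => 4 | .accept => 5 | .reject => 6

/-- A record. -/
structure Rec (w : ℕ) where
  op : RecOp
  mult : BitVec w
  base : BitVec w
  shift : BitVec w

/-- The address of the table entry that belongs to the current element `z`. -/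
def Rec.addr {w : ℕ} (r : Rec w) (z : BitVec w) : ℕ :=
  (r.mult * z).toNat / 2 ^ r.shift.toNat + r.base.toNat

/-- Acceptance by a list of records, for current element `z` and accumulator `acc`. -/
def recRun {w : ℕ} (uadd : BitVec w → BitVec w → BitVec w) (M : ℕ → BitVec w) (y : BitVec w) :
    List (Rec w) → BitVec w → BitVec w → Bool
  | [], _, _ => false
  | r :: rs, z, acc =>
    match r.op with
    | .add => recRun uadd M y rs z (uadd acc (M (r.addr z)))
    | .fin => if acc = y then true else recRun uadd M y rs acc acc
    | .jump => recRun uadd M y rs (M (r.addr z)) acc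
    | .reset => recRun uadd M y rs y acc
    | .init => recRun uadd M y rs z r.mult
    | .accept => true
    | .reject => false

/-- The record `r` is stored at address `p`, and its table is within the first `s` words. -/
def RecAt {w : ℕ} (M : ℕ → BitVec w) (s p : ℕ) (r : Rec w) : Prop :=
  p + 3 < s ∧ M p = BitVec.ofNat w r.op.code ∧ M (p + 1) = r.mult ∧ M (p + 2) = r.base ∧
    M (p + 3) = r.shift ∧ ∀ z, r.addr z < s

/-- A record that rejects. -/
def rejectRec (w : ℕ) : Rec w := ⟨.reject, 0, 0, 0⟩

/-- The records are stored one after the other from address `p` on, followed by a rejecting one. -/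
def Stored {w : ℕ} (M : ℕ → BitVec w) (s : ℕ) : ℕ → List (Rec w) → Prop
  | p, [] => RecAt M s p (rejectRec w)
  | p, r :: rs => RecAt M s p r ∧ Stored M s (p + 4) rs

lemma run_mono {w s : ℕ} (P : List Instr) (uadd : BitVec w → BitVec w → BitVec w) (b : Bool) :
    ∀ (T T' : ℕ) (σ : Config w s), T ≤ T' → run P uadd T σ = some b → run P uadd T' σ = some b := by
  intro T
  induction T with
  | zero => intro T' σ _ h; simp [run] at h
  | succ T ih =>
    intro T' σ hT h
    obtain ⟨T', rfl⟩ : ∃ j, T' = j + 1 := ⟨T' - 1, by omega⟩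
    have hT' : T ≤ T' := by omega
    unfold run at h ⊢
    split at h <;> simp_all
    all_goals first
      | exact ih _ _ hT' h
      | exact h.imp fun _ h => ih _ _ hT' h

/-- The 13 instructions before the dispatch. The addressed table entry is loaded for every record,
even if the operation ignores it; this is why `RecAt` asks for a valid address for all z. -/
lemma run_fetch {w s : ℕ} (uadd : BitVec w → BitVec w → BitVec w) (M : ℕ → BitVec w)
    (hs : s ≤ 2 ^ w) (p : ℕ) (r : Rec w) (hr : RecAt M s p r) (reg : ℕ → BitVec w)
    (h1 : reg 1 = BitVec.ofNat w p) (T : ℕ) :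
    ∃ reg' : ℕ → BitVec w,
      run queryProgram uadd (T + 13) ⟨0, reg, fun i : Fin s => M i⟩
        = run queryProgram uadd T ⟨13, reg', fun i : Fin s => M i⟩ ∧ reg' 0 = reg 0 ∧ reg' 1 = BitVec.ofNat w (p + 4) ∧ reg' 2 = reg 2 ∧
      reg' 3 = reg 3 ∧ reg' 5 = BitVec.ofNat w r.op.code ∧ reg' 6 = r.mult ∧
      reg' 9 = M (r.addr (reg 2)) := by
  obtain ⟨hp, m0, m1, m2, m3, hsafe⟩ := hr
  have haddr : ∀ q, q < s → (BitVec.ofNat w q).toNat = q := fun q hq => by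
    rw [BitVec.toNat_ofNat, Nat.mod_eq_of_lt (by omega)]
  have hadd : ∀ q, BitVec.ofNat w q + BitVec.ofNat w 1 = BitVec.ofNat w (q + 1) := fun q =>
    (BitVec.ofNat_add q 1).symm
  have a0 := haddr p (by omega)
  have a1 := haddr (p + 1) (by omega)
  have a2 := haddr (p + 2) (by omega)
  have a3 := haddr (p + 3) (by omega)
  have hv := hsafe (reg 2)
  have b0 : p < s := by omega
  have b1 : p + 1 < s := by omega
  have b2 : p + 2 < s := by omega
  have e9 : (BitVec.ofNat w ((r.mult * reg 2).toNat / 2 ^ r.shift.toNat) + r.base).toNat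
      = r.addr (reg 2) := by
    have h := haddr _ hv
    unfold Rec.addr at h ⊢
    rw [← h, BitVec.ofNat_add, BitVec.ofNat_toNat, BitVec.setWidth_eq]
  -- The final registers stay a metavariable; the simulation below determines them.
  apply Exists.intro
  refine ⟨?_, ?_, ?_, ?_, ?_, ?_, ?_, ?_⟩
  · simp [-BitVec.toNat_add, -BitVec.toNat_mul, -BitVec.toNat_ofNat, run, queryProgram, Config.setReg, h1, hadd, a0, a1, a2, a3, b0, b1, b2, hp, BinOp.eval, m0, m1, m2, m3, e9, hv]
    rfl
  all_goals simp

/-- The bound on w keeps the seven operation codes distinct as words. Every branch takes at most 13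
steps, so a record costs at most 26 in total. -/
lemma run_dispatch {w s : ℕ} (uadd : BitVec w → BitVec w → BitVec w) (hw : 8 ≤ 2 ^ w)
    (mem : Fin s → BitVec w) (o : RecOp) (reg : ℕ → BitVec w)
    (h5 : reg 5 = BitVec.ofNat w o.code) (T : ℕ) :
    ∃ reg' : ℕ → BitVec w, reg' 0 = reg 0 ∧ reg' 1 = reg 1 ∧
      match o with
      | .add => reg' 2 = reg 2 ∧ reg' 3 = uadd (reg 3) (reg 9) ∧
          run queryProgram uadd (T + 4) ⟨13, reg, mem⟩ = run queryProgram uadd T ⟨0, reg', mem⟩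
      | .fin => if reg 3 = reg 0 then
            run queryProgram uadd (T + 7) ⟨13, reg, mem⟩ = some true
          else reg' 2 = reg 3 ∧ reg' 3 = reg 3 ∧
          run queryProgram uadd (T + 7) ⟨13, reg, mem⟩ = run queryProgram uadd T ⟨0, reg', mem⟩
      | .jump => reg' 2 = reg 9 ∧ reg' 3 = reg 3 ∧
          run queryProgram uadd (T + 8) ⟨13, reg, mem⟩ = run queryProgram uadd T ⟨0, reg', mem⟩
      | .reset => reg' 2 = reg 0 ∧ reg' 3 = reg 3 ∧
          run queryProgram uadd (T + 10) ⟨13, reg, mem⟩ = run queryProgram uadd T ⟨0, reg', mem⟩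
      | .init => reg' 2 = reg 2 ∧ reg' 3 = reg 6 ∧
          run queryProgram uadd (T + 12) ⟨13, reg, mem⟩ = run queryProgram uadd T ⟨0, reg', mem⟩
      | .accept => run queryProgram uadd (T + 13) ⟨13, reg, mem⟩ = some true
      | .reject => run queryProgram uadd (T + 13) ⟨13, reg, mem⟩ = some false := by
  have hne : ∀ i j, i < 8 → j < 8 → i ≠ j → BitVec.ofNat w i ≠ BitVec.ofNat w j := by
    intro i j hi hj hij h
    have := congrArg BitVec.toNat h
    rw [BitVec.toNat_ofNat, BitVec.toNat_ofNat, Nat.mod_eq_of_lt (by omega),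
      Nat.mod_eq_of_lt (by omega)] at this
    exact hij this
  cases o with
  | add =>
    refine ⟨Function.update (Function.update reg 4 0) 3 (uadd (reg 3) (reg 9)), ?_, ?_, ?_, ?_, ?_⟩
    rotate_right
    · simp [run, queryProgram, Config.setReg, h5, RecOp.code]
    all_goals simp
  | fin =>
    have n1 := hne 1 0 (by norm_num) (by norm_num) (by norm_num)
    refine ⟨Function.update (Function.update reg 4 (BitVec.ofNat w 1)) 2 (reg 3), ?_, ?_, ?_⟩
    rotate_right
    · by_cases h : reg 3 = reg 0
      · simp [run, queryProgram, Config.setReg, h5, RecOp.code, n1, h,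
          BinOp.eval]
      · simp [run, queryProgram, Config.setReg, h5, RecOp.code, n1, h,
          BinOp.eval]
    all_goals simp
  | jump =>
    have n1 := hne 2 0 (by norm_num) (by norm_num) (by norm_num)
    have n2 := hne 2 1 (by norm_num) (by norm_num) (by norm_num)
    refine ⟨Function.update (Function.update reg 4 (BitVec.ofNat w 2)) 2 (reg 9), ?_, ?_, ?_, ?_, ?_⟩
    rotate_right
    · simp [run, queryProgram, Config.setReg, h5, RecOp.code, n1, n2,
          BinOp.eval]
    all_goals simp
  | reset =>
    have n1 := hne 3 0 (by norm_num) (by norm_num) (by norm_num)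
    have n2 := hne 3 1 (by norm_num) (by norm_num) (by norm_num)
    have n3 := hne 3 2 (by norm_num) (by norm_num) (by norm_num)
    refine ⟨Function.update (Function.update reg 4 (BitVec.ofNat w 3)) 2 (reg 0), ?_, ?_, ?_, ?_, ?_⟩
    rotate_right
    · simp [run, queryProgram, Config.setReg, h5, RecOp.code, n1, n2, n3,
          BinOp.eval]
    all_goals simp
  | init =>
    have n1 := hne 4 0 (by norm_num) (by norm_num) (by norm_num)
    have n2 := hne 4 1 (by norm_num) (by norm_num) (by norm_num)
    have n3 := hne 4 2 (by norm_num) (by norm_num) (by norm_num)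
    have n4 := hne 4 3 (by norm_num) (by norm_num) (by norm_num)
    refine ⟨Function.update (Function.update reg 4 (BitVec.ofNat w 4)) 3 (reg 6), ?_, ?_, ?_, ?_, ?_⟩
    rotate_right
    · simp [run, queryProgram, Config.setReg, h5, RecOp.code, n1, n2, n3,
          n4, BinOp.eval]
    all_goals simp
  | accept =>
    have n1 := hne 5 0 (by norm_num) (by norm_num) (by norm_num)
    have n2 := hne 5 1 (by norm_num) (by norm_num) (by norm_num)
    have n3 := hne 5 2 (by norm_num) (by norm_num) (by norm_num)
    have n4 := hne 5 3 (by norm_num) (by norm_num) (by norm_num)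
    have n5 := hne 5 4 (by norm_num) (by norm_num) (by norm_num)
    refine ⟨reg, rfl, rfl, ?_⟩
    simp [run, queryProgram, Config.setReg, h5, RecOp.code, n1, n2, n3, n4,
      n5]
  | reject =>
    have n1 := hne 6 0 (by norm_num) (by norm_num) (by norm_num)
    have n2 := hne 6 1 (by norm_num) (by norm_num) (by norm_num)
    have n3 := hne 6 2 (by norm_num) (by norm_num) (by norm_num)
    have n4 := hne 6 3 (by norm_num) (by norm_num) (by norm_num)
    have n5 := hne 6 4 (by norm_num) (by norm_num) (by norm_num)
    have n6 := hne 6 5 (by norm_num) (by norm_num) (by norm_num)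
    refine ⟨reg, rfl, rfl, ?_⟩
    simp [run, queryProgram, Config.setReg, h5, RecOp.code, n1, n2, n3, n4,
      n5, n6]

/-- The extra 26 steps pay for the rejecting terminator; steps that a record leaves unused are
absorbed by `run_mono`. -/
lemma run_stored {w s : ℕ} (uadd : BitVec w → BitVec w → BitVec w) (hw : 8 ≤ 2 ^ w)
    (M : ℕ → BitVec w) (hs : s ≤ 2 ^ w) (rs : List (Rec w)) :
    ∀ (p : ℕ) (reg : ℕ → BitVec w), Stored M s p rs → reg 1 = BitVec.ofNat w p →
      run queryProgram uadd (26 * (rs.length + 1)) ⟨0, reg, fun i : Fin s => M i⟩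
        = some (recRun uadd M (reg 0) rs (reg 2) (reg 3)) := by
  induction rs with
  | nil =>
    intro p reg hst h1
    obtain ⟨reg', hrun, -, -, -, -, h5, -, -⟩ := run_fetch uadd M hs p _ hst reg h1 13
    obtain ⟨_, -, -, h⟩ := run_dispatch uadd hw (fun i : Fin s => M i) .reject reg' h5 0
    exact hrun.trans h
  | cons r rs ih =>
    intro p reg hst h1
    obtain ⟨hr, hst⟩ := hst
    have hlen : 26 * ((r :: rs).length + 1) = 26 * (rs.length + 1) + 13 + 13 := by
      simp only [List.length_cons]; ring
    obtain ⟨reg', hrun, h0, h1', h2, h3, h5, h6, h9⟩ :=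
      run_fetch uadd M hs p r hr reg h1 (26 * (rs.length + 1) + 13)
    rw [hlen, hrun]
    have key := fun j => run_dispatch uadd hw (fun i : Fin s => M i) r.op reg' h5
      (26 * (rs.length + 1) + j)
    unfold recRun
    obtain ⟨op, mu, ba, sh⟩ := r
    cases op <;> dsimp only at key ⊢
    · obtain ⟨g, g0, g1, g2, g3, hg⟩ := key 9
      rw [hg]
      refine run_mono _ _ _ _ _ _ (Nat.le_add_right _ 9) ?_
      rw [ih (p + 4) g hst (g1.trans h1'), g0, g2, g3, h0, h2, h3, h9]
    · obtain ⟨g, g0, g1, hg⟩ := key 6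
      rw [← h0, ← h3]
      by_cases hc : reg' 3 = reg' 0
      · rw [if_pos hc] at hg ⊢
        exact hg
      · rw [if_neg hc] at hg ⊢
        rw [hg.2.2]
        refine run_mono _ _ _ _ _ _ (Nat.le_add_right _ 6) ?_
        rw [ih (p + 4) g hst (g1.trans h1'), g0, hg.1, hg.2.1]
    · obtain ⟨g, g0, g1, g2, g3, hg⟩ := key 5
      rw [hg]
      refine run_mono _ _ _ _ _ _ (Nat.le_add_right _ 5) ?_
      rw [ih (p + 4) g hst (g1.trans h1'), g0, g2, g3, h0, h3, h9]
    · obtain ⟨g, g0, g1, g2, g3, hg⟩ := key 3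
      rw [hg]
      refine run_mono _ _ _ _ _ _ (Nat.le_add_right _ 3) ?_
      rw [ih (p + 4) g hst (g1.trans h1'), g0, g2, g3, h0, h3]
    · obtain ⟨g, g0, g1, g2, g3, hg⟩ := key 1
      rw [hg]
      refine run_mono _ _ _ _ _ _ (Nat.le_add_right _ 1) ?_
      rw [ih (p + 4) g hst (g1.trans h1'), g0, g2, g3, h0, h2, h6]
    · obtain ⟨g, g0, g1, hg⟩ := key 0
      exact hg
    · obtain ⟨g, g0, g1, hg⟩ := key 0
      exact hg

lemma wordAdd_enc {U : Type} [AddCommGroup U] {w : ℕ} {enc : U → BitVec w}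
    (henc : Function.Injective enc) (x y : U) : wordAdd enc (enc x) (enc y) = enc (x + y) := by
  unfold wordAdd
  rw [Function.leftInverse_invFun henc x, Function.leftInverse_invFun henc y]

/-- The words of a list of records. -/
def recWords {w : ℕ} : List (Rec w) → List (BitVec w)
  | [] => []
  | r :: rs => BitVec.ofNat w r.op.code :: r.mult :: r.base :: r.shift :: recWords rs

lemma stored_of_recWords {w : ℕ} (M : ℕ → BitVec w) (s : ℕ) (rs : List (Rec w)) :
    ∀ p, (∀ i, i < 4 * (rs.length + 1) → M (p + i) = (recWords (rs ++ [rejectRec w])).getD i 0) →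
      (∀ r ∈ rs, ∀ z, r.addr z < s) → p + 4 * (rs.length + 1) ≤ s → Stored M s p rs := by
  induction rs with
  | nil =>
    intro p hM _ hp
    simp only [List.length_nil] at hM hp
    refine ⟨by omega, hM 0 (by norm_num), hM 1 (by norm_num), hM 2 (by norm_num),
      hM 3 (by norm_num), fun z => ?_⟩
    simp only [Rec.addr, rejectRec]
    simp
    omega
  | cons r rs ih =>
    intro p hM hr hp
    simp only [List.length_cons] at hM hp
    refine ⟨⟨by omega, hM 0 (by omega), hM 1 (by omega), hM 2 (by omega), hM 3 (by omega),
      hr r (by simp)⟩, ih (p + 4) (fun i hi => ?_) (fun r' h' => hr r' (by simp [h'])) (by omega)⟩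
    have := hM (i + 4) (by omega)
    rw [show p + 4 + i = p + (i + 4) by ring, this]
    simp [recWords]

/-! ### Records that search one table -/

section tape

variable {U : Type} [AddCommGroup U] {K n w l t : ℕ}

/-- The value of a column function, on words. -/
def colWord (hl : l ≤ w) (A : Fin K → Fin n → U) (h : Fin K → IdxHash w l n) (z : BitVec w) : U :=
  ∑ j, A j ((h j).eval hl z)

/-- The record that adds one table entry, for a hash function with multiplier `2 * b + 1` to `l`
bits and a table at address `base`. -/
def tableRec (o : RecOp) (l : ℕ) (b : BitVec w) (base : ℕ) : Rec w :=
  ⟨o, 2 * b + 1, BitVec.ofNat w base, BitVec.ofNat w (w - l)⟩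

lemma tableRec_addr (o : RecOp) (l : ℕ) (b : BitVec w) (base : ℕ) (hb : base < 2 ^ w)
    (z : BitVec w) : (tableRec o l b base).addr z = mulShift l b z + base := by
  have hw : w - l < 2 ^ w := (Nat.sub_le w l).trans_lt Nat.lt_two_pow_self
  simp only [Rec.addr, tableRec, mulShift]
  rw [BitVec.toNat_ofNat, BitVec.toNat_ofNat, Nat.mod_eq_of_lt hb, Nat.mod_eq_of_lt hw]

/-- The records that evaluate one column function. -/
def colRecs (enc : U → BitVec w) (l : ℕ) (h : Fin K → IdxHash w l n) (base : Fin K → ℕ) :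
    List (Rec w) :=
  -- The multiplier field carries the initial accumulator. The shift by w sends the obligatory load
  -- to address 0; in `fin` the zero multiplier does the same.
  ⟨.init, enc 0, 0, BitVec.ofNat w w⟩ ::
    ((List.finRange K).map fun j => tableRec .add l (h j).1 (base j)) ++ [⟨.fin, 0, 0, 0⟩]

lemma recRun_colRecs (hl : l ≤ w) {enc : U → BitVec w} (henc : Function.Injective enc)
    (A : Fin K → Fin n → U) (M : ℕ → BitVec w) (y : BitVec w) (h : Fin K → IdxHash w l n)
    (base : Fin K → ℕ) (hbase : ∀ j, base j < 2 ^ w)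
    (hM : ∀ j (u : Fin (2 ^ l)), M (u + base j) = enc (A j ((h j).2 u)))
    (rest : List (Rec w)) (z acc : BitVec w) :
    recRun (wordAdd enc) M y (colRecs enc l h base ++ rest) z acc =
      if enc (colWord hl A h z) = y then true
      else recRun (wordAdd enc) M y rest (enc (colWord hl A h z)) (enc (colWord hl A h z)) := by
  have key : ∀ (js : List (Fin K)) (a : U) (rest : List (Rec w)),
      recRun (wordAdd enc) M y ((js.map fun j => tableRec .add l (h j).1 (base j)) ++ rest) z (enc a)
        = recRun (wordAdd enc) M y rest z
          (enc (a + (js.map fun j => A j ((h j).eval hl z)).sum)) := by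
    intro js
    induction js with
    | nil => intro a rest; simp
    | cons j js ih =>
      intro a rest
      have e : M ((tableRec .add l (h j).1 (base j)).addr z) = enc (A j ((h j).eval hl z)) := by
        rw [tableRec_addr _ _ _ _ (hbase j)]
        exact hM j ⟨mulShift l (h j).1 z, mulShift_lt hl _ _⟩
      simp only [List.map_cons, List.cons_append, List.sum_cons]
      rw [recRun]
      simp only [tableRec] at e ⊢
      rw [e, wordAdd_enc henc]
      have := ih (a + A j ((h j).eval hl z)) rest
      simp only [tableRec] at this
      rw [this, add_assoc]
  unfold colRecs
  rw [List.cons_append, List.cons_append, recRun]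
  simp only [List.append_assoc]
  rw [key, zero_add, ← Fin.sum_univ_def, List.singleton_append, recRun]
  rfl

/-- Running the records `L` either accepts, and then `c` is a sum, or goes on with what follows. -/
def Passes (enc : U → BitVec w) (A : Fin K → Fin n → U) (M : ℕ → BitVec w) (c : U)
    (L : List (Rec w)) : Prop :=
  ∀ rest z acc, (recRun (wordAdd enc) M (enc c) (L ++ rest) z acc = true ∧ mult A c ≠ 0) ∨
    ∃ z' acc', recRun (wordAdd enc) M (enc c) (L ++ rest) z acc
      = recRun (wordAdd enc) M (enc c) rest z' acc'

lemma Passes.nil (enc : U → BitVec w) (A : Fin K → Fin n → U) (M : ℕ → BitVec w) (c : U) :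
    Passes enc A M c [] := fun _ z acc => Or.inr ⟨z, acc, rfl⟩

lemma Passes.append {enc : U → BitVec w} {A : Fin K → Fin n → U} {M : ℕ → BitVec w} {c : U}
    {L L' : List (Rec w)} (h : Passes enc A M c L) (h' : Passes enc A M c L') :
    Passes enc A M c (L ++ L') := by
  intro rest z acc
  rw [List.append_assoc]
  rcases h (L' ++ rest) z acc with h1 | ⟨z', acc', h1⟩
  · exact Or.inl h1
  · rw [h1]
    exact h' rest z' acc'

lemma Passes.flatMap {ι : Type*} {enc : U → BitVec w} {A : Fin K → Fin n → U}
    {M : ℕ → BitVec w} {c : U} (is : List ι) (L : ι → List (Rec w))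
    (h : ∀ i, Passes enc A M c (L i)) : Passes enc A M c (is.flatMap L) := by
  induction is with
  | nil => exact Passes.nil _ _ _ _
  | cons i is ih =>
    rw [List.flatMap_cons]
    exact (h i).append ih

lemma passes_colRecs (hl : l ≤ w) {enc : U → BitVec w} (henc : Function.Injective enc)
    (A : Fin K → Fin n → U) (M : ℕ → BitVec w) (c : U) (h : Fin K → IdxHash w l n)
    (base : Fin K → ℕ) (hbase : ∀ j, base j < 2 ^ w)
    (hM : ∀ j (u : Fin (2 ^ l)), M (u + base j) = enc (A j ((h j).2 u))) :
    Passes enc A M c (colRecs enc l h base) := by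
  intro rest z acc
  rw [recRun_colRecs hl henc A M _ h base hbase hM]
  split_ifs with heq
  · left
    refine ⟨rfl, ?_⟩
    have := one_le_mult A c ⟨_, henc heq⟩
    omega
  · exact Or.inr ⟨_, _, rfl⟩

lemma recRun_chain (hl : l ≤ w) {enc : U → BitVec w} (henc : Function.Injective enc)
    (A : Fin K → Fin n → U) (M : ℕ → BitVec w) (y : BitVec w)
    (ω : Fin t → Fin K → IdxHash w l n)
    (base : Fin t → Fin K → ℕ) (hbase : ∀ c j, base c j < 2 ^ w)
    (hM : ∀ c j (u : Fin (2 ^ l)), M (u + base c j) = enc (A j ((ω c j).2 u)))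
    (cs : List (Fin t)) : ∀ (rest : List (Rec w)) (x : U) (acc : BitVec w),
    recRun (wordAdd enc) M y (cs.flatMap (fun c => colRecs enc l (ω c) (base c)) ++ rest)
        (enc x) acc = true ∨
      ∃ acc', recRun (wordAdd enc) M y (cs.flatMap (fun c => colRecs enc l (ω c) (base c)) ++ rest)
        (enc x) acc = recRun (wordAdd enc) M y rest
          (enc (chain (colFun hl enc A) (cs.map ω) x)) acc' := by
  induction cs with
  | nil => intro rest x acc; exact Or.inr ⟨acc, rfl⟩
  | cons c cs ih =>
    intro rest x acc
    rw [List.flatMap_cons, List.append_assoc,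
      recRun_colRecs hl henc A M _ (ω c) (base c) (hbase c) (hM c)]
    split_ifs with heq
    · exact Or.inl rfl
    · rw [List.map_cons, chain_cons]
      exact ih rest (colFun hl enc A (ω c) x) _

/-- The comparison with the query happens only at the end of a column, so at least one column is
needed. -/
lemma recRun_chain_eq (hl : l ≤ w) {enc : U → BitVec w} (henc : Function.Injective enc)
    (A : Fin K → Fin n → U) (M : ℕ → BitVec w) (y : U)
    (ω : Fin t → Fin K → IdxHash w l n)
    (base : Fin t → Fin K → ℕ) (hbase : ∀ c j, base c j < 2 ^ w)
    (hM : ∀ c j (u : Fin (2 ^ l)), M (u + base c j) = enc (A j ((ω c j).2 u)))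
    (cs : List (Fin t)) (hcs : cs ≠ []) (rest : List (Rec w)) (x : U) (acc : BitVec w)
    (hy : chain (colFun hl enc A) (cs.map ω) x = y) :
    recRun (wordAdd enc) M (enc y) (cs.flatMap (fun c => colRecs enc l (ω c) (base c)) ++ rest)
        (enc x) acc = true := by
  obtain ⟨cs', c, rfl⟩ := List.eq_nil_or_concat cs |>.resolve_left hcs
  rw [List.concat_eq_append, List.map_append, chain_append] at hy
  rw [List.concat_eq_append, List.flatMap_append, List.append_assoc]
  rcases recRun_chain hl henc A M (enc y) ω base hbase hM cs'
    ([c].flatMap (fun c => colRecs enc l (ω c) (base c)) ++ rest) x acc with h | ⟨acc', h⟩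
  · exact h
  · rw [h, List.flatMap_cons, List.flatMap_nil, List.append_nil,
      recRun_colRecs hl henc A M _ (ω c) (base c) (hbase c) (hM c), if_pos]
    exact congrArg enc hy

/-- The records for one table and one column in which the queried element may be. -/
def segment (enc : U → BitVec w) (l l' : ℕ) (ω : Fin t → Fin K → IdxHash w l n) (γ : BitVec w)
    (base : Fin t → Fin K → ℕ) (base' : ℕ) (c : Fin t) : List (Rec w) :=
  ⟨.reset, 0, 0, 0⟩ ::
    (((List.finRange t).drop (c + 1)).flatMap fun c => colRecs enc l (ω c) (base c)) ++
    tableRec .jump l' γ base' ::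
    (((List.finRange t).take (c + 1)).flatMap fun c => colRecs enc l (ω c) (base c))

/-- Soundness needs nothing about the table of chain ends: from any word, even one that encodes no
element, a column function produces a genuine sum of list entries. -/
lemma passes_segment (hl : l ≤ w) {enc : U → BitVec w} (henc : Function.Injective enc)
    (A : Fin K → Fin n → U) (M : ℕ → BitVec w) (y : U) (l' : ℕ)
    (ω : Fin t → Fin K → IdxHash w l n) (γ : BitVec w)
    (base : Fin t → Fin K → ℕ) (hbase : ∀ c j, base c j < 2 ^ w)
    (hM : ∀ c j (u : Fin (2 ^ l)), M (u + base c j) = enc (A j ((ω c j).2 u)))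
    (base' : ℕ) (c : Fin t) : Passes enc A M y (segment enc l l' ω γ base base' c) := by
  have hcol : ∀ cs : List (Fin t),
      Passes enc A M y (cs.flatMap fun c => colRecs enc l (ω c) (base c)) := fun cs =>
    Passes.flatMap cs _ fun c => passes_colRecs hl henc A M y (ω c) (base c) (hbase c) (hM c)
  have h1 : Passes enc A M y [(⟨.reset, 0, 0, 0⟩ : Rec w)] :=
    fun rest z acc => Or.inr ⟨enc y, acc, rfl⟩
  have h2 : Passes enc A M y [tableRec .jump l' γ base'] :=
    fun rest z acc => Or.inr ⟨_, acc, rfl⟩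
  have := (h1.append (hcol ((List.finRange t).drop (c + 1)))).append
    (h2.append (hcol ((List.finRange t).take (c + 1))))
  simpa [segment] using this

/-- From y in column c, the later columns lead to the end of the chain from x. The entry stored for
that end is x, and the first c + 1 columns lead from x back to y. -/
lemma recRun_segment (hl : l ≤ w) {enc : U → BitVec w} (henc : Function.Injective enc)
    (A : Fin K → Fin n → U) (M : ℕ → BitVec w) (y : U) (l' : ℕ)
    (ω : Fin t → Fin K → IdxHash w l n) (γ : BitVec w)
    (base : Fin t → Fin K → ℕ) (hbase : ∀ c j, base c j < 2 ^ w)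
    (hM : ∀ c j (u : Fin (2 ^ l)), M (u + base c j) = enc (A j ((ω c j).2 u)))
    (base' : ℕ) (hbase' : base' < 2 ^ w) (c : Fin t) (x : U)
    (hx : M (mulShift l' γ (enc (chain (colFun hl enc A) (List.ofFn ω) x)) + base') = enc x)
    (hy : AtColumn (colFun hl enc A) ω c x y) (rest : List (Rec w)) (z acc : BitVec w) :
    recRun (wordAdd enc) M (enc y) (segment enc l l' ω γ base base' c ++ rest) z acc = true := by
  unfold AtColumn at hy
  rw [List.ofFn_eq_map] at hx hy
  rw [← List.map_take] at hy
  unfold segment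
  rw [List.append_assoc, List.cons_append, recRun]
  simp only
  rcases recRun_chain hl henc A M (enc y) ω base hbase hM ((List.finRange t).drop (c + 1))
    ((tableRec .jump l' γ base' :: (((List.finRange t).take (c + 1)).flatMap
      fun c => colRecs enc l (ω c) (base c))) ++ rest) y acc with h | ⟨acc', h⟩
  · exact h
  · rw [h, List.cons_append, recRun]
    have e : chain (colFun hl enc A) (((List.finRange t).drop (c + 1)).map ω) y
        = chain (colFun hl enc A) ((List.finRange t).map ω) x := by
      rw [← hy, List.map_take, List.map_drop, chain_take_drop]
    have e' := hx
    rw [← e, ← tableRec_addr .jump l' γ base' hbase'] at e'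
    simp only [tableRec] at e' ⊢
    rw [e']
    refine recRun_chain_eq hl henc A M y ω base hbase hM _ ?_ rest x acc' hy
    have := c.pos
    simp only [ne_eq, List.take_eq_nil_iff]
    rintro (h | h)
    · omega
    · have := congrArg List.length h
      simp at this
      omega

end tape

/-! ### Memory layout -/

lemma exists_function_of_parts {W : Type*} [Inhabited W] (f₀ : ℕ → W) (o : ℕ) {c c' : ℕ}
    (f : Fin c → W) (f' : Fin c' → W) :
    ∃ M : ℕ → W, (∀ i, i < o → M i = f₀ i) ∧ (∀ i : Fin c, M (o + i) = f i) ∧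
      ∀ i : Fin c', M (o + c + i) = f' i := by
  refine ⟨fun i => if i < o then f₀ i else if h : i - o < c then f ⟨i - o, h⟩ else
    if h : i - o - c < c' then f' ⟨i - o - c, h⟩ else default, ?_, ?_, ?_⟩
  · intro i hi
    simp [hi]
  · intro i
    simp
  · intro i
    have h1 : ¬ o + c + (i : ℕ) < o := by omega
    have h2 : ¬ o + c + (i : ℕ) - o < c := by omega
    have h3 : o + c + (i : ℕ) - o - c = i := by omega
    simp [h1, h2, h3]

/-- Number of records for `r` tables with `t` columns. -/
def numRecs (K t r : ℕ) : ℕ := r * (t * (t * (K + 2) + 2))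

/-- Number of words of memory for `r` tables with `t` columns, where the column functions hash to
`l` bits and the ends of the chains to `l'` bits. -/
def memSize (K t r l l' : ℕ) : ℕ :=
  4 * (numRecs K t r + 1) + r * t * K * 2 ^ l + r * 2 ^ l'

section

variable {U : Type} [AddCommGroup U] {K n w l l' t r m : ℕ}

lemma length_colRecs (enc : U → BitVec w) (h : Fin K → IdxHash w l n) (base : Fin K → ℕ) :
    (colRecs enc l h base).length = K + 2 := by
  simp [colRecs]

lemma length_segment (enc : U → BitVec w) (ω : Fin t → Fin K → IdxHash w l n) (γ : BitVec w)
    (base : Fin t → Fin K → ℕ) (base' : ℕ) (c : Fin t) :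
    (segment enc l l' ω γ base base' c).length = t * (K + 2) + 2 := by
  have h : ∀ cs : List (Fin t), (cs.flatMap fun c => colRecs enc l (ω c) (base c)).length
      = cs.length * (K + 2) := by
    intro cs
    induction cs with
    | nil => simp
    | cons c cs ih => simp [ih, length_colRecs]; ring
  have hc : (c : ℕ) + 1 ≤ t := c.isLt
  simp only [segment, List.length_append, List.length_cons, h, List.length_drop, List.length_take,
    List.length_finRange, min_eq_left hc]
  obtain ⟨d, hd⟩ := Nat.exists_eq_add_of_le hc
  have : t - (c + 1) = d := by omega
  rw [this]
  conv_rhs => rw [hd]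
  ring

lemma addr_segment_lt (enc : U → BitVec w) (ω : Fin t → Fin K → IdxHash w l n) (γ : BitVec w)
    (base : Fin t → Fin K → ℕ) (base' : ℕ) (c : Fin t) (s : ℕ) (hl : l ≤ w) (hl' : l' ≤ w)
    (hbase : ∀ c j, base c j + 2 ^ l ≤ s) (hbase' : base' + 2 ^ l' ≤ s) (hs : s ≤ 2 ^ w)
    (rec : Rec w) (hr : rec ∈ segment enc l l' ω γ base base' c) (z : BitVec w) :
    rec.addr z < s := by
  have hs0 : 0 < s := lt_of_lt_of_le (by positivity) ((Nat.le_add_left _ _).trans hbase')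
  have h2l : 0 < 2 ^ l := by positivity
  have h2l' : 0 < 2 ^ l' := by positivity
  have hcol : ∀ c, rec ∈ colRecs enc l (ω c) (base c) → rec.addr z < s := by
    intro c hc
    simp only [colRecs, List.cons_append, List.mem_cons, List.mem_append, List.mem_map,
      List.mem_finRange, true_and, List.not_mem_nil, or_false] at hc
    rcases hc with rfl | ⟨j, rfl⟩ | rfl
    · have hw : w < 2 ^ w := Nat.lt_two_pow_self
      simp only [Rec.addr, BitVec.toNat_ofNat, Nat.mod_eq_of_lt hw]
      rw [Nat.div_eq_of_lt (BitVec.isLt _)]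
      simpa using hs0
    · have := hbase c j
      rw [tableRec_addr _ _ _ _ (by omega)]
      have := mulShift_lt hl (ω c j).1 z
      omega
    · simpa [Rec.addr] using hs0
  simp only [segment, List.cons_append, List.mem_cons, List.mem_append, List.mem_flatMap] at hr
  rcases hr with rfl | ⟨c', -, h⟩ | rfl | ⟨c', -, h⟩
  · simpa [Rec.addr] using hs0
  · exact hcol c' h
  · rw [tableRec_addr _ _ _ _ (by omega)]
    have := mulShift_lt hl' γ z
    omega
  · exact hcol c' h

/-- If the tables find all sums, there is a memory content with which the query program answers
all queries correctly. -/
theorem exists_memory_of_found (hl : l ≤ w) (hl' : l' ≤ w) {enc : U → BitVec w}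
    (henc : Function.Injective enc) (A : Fin K → Fin n → U)
    (θ : Fin r → (Fin t → Fin K → IdxHash w l n) × BitVec w) (s : Fin m → U)
    (hθ : ∀ y, mult A y ≠ 0 → ∃ τ, Found (colFun hl enc A)
      (fun (γ : BitVec w) y => mulShift l' γ (enc y)) s (θ τ) y)
    (hs : memSize K t r l l' ≤ 2 ^ w) (hw : 8 ≤ 2 ^ w) :
    ∃ mem : Fin (memSize K t r l l') → BitVec w, ∀ c : U, ∃ b : Bool,
      run queryProgram (wordAdd enc) (26 * (numRecs K t r + 1)) (queryConfig (enc c) mem) = some b ∧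
        (b = true ↔ mult A c ≠ 0) := by
  classical
  set o : ℕ := 4 * (numRecs K t r + 1) with ho
  set S := memSize K t r l l' with hS
  have hSo : S = o + r * t * K * 2 ^ l + r * 2 ^ l' := rfl
  let idx : Fin r → Fin t → Fin K → Fin (r * t * K) :=
    fun τ c j => finProdFinEquiv (finProdFinEquiv (τ, c), j)
  let base : Fin r → Fin t → Fin K → ℕ := fun τ c j => o + 2 ^ l * (idx τ c j : ℕ)
  let base' : Fin r → ℕ := fun τ => o + r * t * K * 2 ^ l + 2 ^ l' * (τ : ℕ)
  let tape : List (Rec w) := (List.finRange r).flatMap fun τ =>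
    (List.finRange t).flatMap fun c => segment enc l l' (θ τ).1 (θ τ).2 (base τ) (base' τ) c
  let hash : Fin r → U → ℕ := fun τ x =>
    mulShift l' (θ τ).2 (enc (chain (colFun hl enc A) (List.ofFn (θ τ).1) x))
  let f : Fin (r * t * K * 2 ^ l) → BitVec w := fun i =>
    let p := finProdFinEquiv.symm i
    let q := finProdFinEquiv.symm p.1
    let q' := finProdFinEquiv.symm q.1
    enc (A q.2 (((θ q'.1).1 q'.2 q.2).2 p.2))
  -- Colliding ends leave an arbitrary one of their starts; for an isolated end the choice is
  -- forced.
  let f' : Fin (r * 2 ^ l') → BitVec w := fun i =>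
    let p := finProdFinEquiv.symm i
    if h : ∃ i, hash p.1 (s i) = p.2 then enc (s h.choose) else 0
  obtain ⟨M, hM0, hM1, hM2⟩ := exists_function_of_parts
    (fun i => (recWords (tape ++ [rejectRec w])).getD i 0) o f f'
  have hlen : tape.length = numRecs K t r := by
    simp only [tape, List.length_flatMap, length_segment, numRecs]
    simp
  have hbaseS : ∀ τ c j, base τ c j + 2 ^ l ≤ S := by
    intro τ c j
    have h1 : (idx τ c j : ℕ) + 1 ≤ r * t * K := (idx τ c j).isLt
    have h2 := Nat.mul_le_mul_left (2 ^ l) h1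
    simp only [base]
    rw [hSo, mul_comm (r * t * K)]
    rw [mul_add, mul_one] at h2
    omega
  have hbaseS' : ∀ τ, base' τ + 2 ^ l' ≤ S := by
    intro τ
    have h1 : (τ : ℕ) + 1 ≤ r := τ.isLt
    have h2 := Nat.mul_le_mul_left (2 ^ l') h1
    simp only [base']
    rw [hSo, mul_comm r (2 ^ l')]
    rw [mul_add, mul_one] at h2
    omega
  have hbase : ∀ τ c j, base τ c j < 2 ^ w := fun τ c j =>
    lt_of_lt_of_le (Nat.lt_add_of_pos_right (by positivity)) ((hbaseS τ c j).trans hs)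
  have hbase' : ∀ τ, base' τ < 2 ^ w := fun τ =>
    lt_of_lt_of_le (Nat.lt_add_of_pos_right (by positivity)) ((hbaseS' τ).trans hs)
  have hMtab : ∀ τ c j (u : Fin (2 ^ l)),
      M (u + base τ c j) = enc (A j (((θ τ).1 c j).2 u)) := by
    intro τ c j u
    have h := hM1 (finProdFinEquiv (idx τ c j, u))
    simp only [f, Equiv.symm_apply_apply, idx] at h
    rw [← h]
    congr 1
    simp only [base, idx, finProdFinEquiv_apply_val]
    ring
  have hMend : ∀ τ i, (∀ j, j ≠ i → hash τ (s i) ≠ hash τ (s j)) →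
      M (hash τ (s i) + base' τ) = enc (s i) := by
    intro τ i hi
    have hlt : hash τ (s i) < 2 ^ l' := mulShift_lt hl' _ _
    have h := hM2 (finProdFinEquiv (τ, ⟨hash τ (s i), hlt⟩))
    have hex : ∃ i', hash τ (s i') = hash τ (s i) := ⟨i, rfl⟩
    simp only [f', Equiv.symm_apply_apply, dif_pos hex] at h
    have hch : hex.choose = i := by
      by_contra hne
      exact hi _ hne hex.choose_spec.symm
    rw [hch] at h
    rw [← h]
    congr 1
    simp only [base', finProdFinEquiv_apply_val]
    ring
  have hstored : Stored M S 0 tape := by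
    refine stored_of_recWords M S tape 0 (fun i hi => ?_) (fun rec hrec z => ?_) ?_
    · rw [zero_add]
      exact hM0 i (by rw [hlen] at hi; exact hi)
    · simp only [tape, List.mem_flatMap] at hrec
      obtain ⟨τ, -, c, -, hrec⟩ := hrec
      exact addr_segment_lt enc _ _ _ _ c S hl hl' (hbaseS τ) (hbaseS' τ) hs rec hrec z
    · rw [hlen, zero_add, hSo]
      omega
  refine ⟨fun i => M i, fun c => ⟨recRun (wordAdd enc) M (enc c) tape 0 0, ?_, ?_⟩⟩
  · have := run_stored (wordAdd enc) hw M hs tape 0 (fun i => if i = 0 then enc c else 0)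
      hstored (by simp)
    rw [hlen] at this
    exact this
  · have hpass : ∀ τ c', Passes enc A M c
        (segment enc l l' (θ τ).1 (θ τ).2 (base τ) (base' τ) c') := fun τ c' =>
      passes_segment hl henc A M c l' _ _ _ (hbase τ) (hMtab τ) _ c'
    -- Soundness: if all segments pass, the terminator rejects. Completeness: the segment of the
    -- right table and column accepts, unless an earlier one already has.
    constructor
    · intro h
      have hp : Passes enc A M c tape := Passes.flatMap _ _ fun τ => Passes.flatMap _ _ (hpass τ)
      rcases hp [] 0 0 with h' | ⟨z, acc, h'⟩
      · exact h'.2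
      · rw [List.append_nil, h] at h'
        simp [recRun] at h'
    · intro h
      obtain ⟨τ, i, c', hcol, hends⟩ := hθ c h
      obtain ⟨pre, post, hsplit⟩ := List.append_of_mem (List.mem_finRange τ)
      obtain ⟨pre', post', hsplit'⟩ := List.append_of_mem (List.mem_finRange c')
      let seg : Fin r → Fin t → List (Rec w) := fun τ c =>
        segment enc l l' (θ τ).1 (θ τ).2 (base τ) (base' τ) c
      have htape : tape = (pre.flatMap (fun τ => (List.finRange t).flatMap (seg τ)) ++
          pre'.flatMap (seg τ)) ++ (seg τ c' ++ (post'.flatMap (seg τ) ++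
            post.flatMap (fun τ => (List.finRange t).flatMap (seg τ)))) := by
        have : tape = (List.finRange r).flatMap (fun τ => (List.finRange t).flatMap (seg τ)) := rfl
        have hseg : (List.finRange t).flatMap (seg τ)
            = pre'.flatMap (seg τ) ++ (seg τ c' ++ post'.flatMap (seg τ)) := by
          rw [hsplit', List.flatMap_append, List.flatMap_cons]
        rw [this, hsplit, List.flatMap_append, List.flatMap_cons, hseg]
        simp only [List.append_assoc]
      have hp : Passes enc A M c (pre.flatMap (fun τ => (List.finRange t).flatMap (seg τ)) ++
          pre'.flatMap (seg τ)) :=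
        (Passes.flatMap _ _ fun τ => Passes.flatMap _ _ (hpass τ)).append
          (Passes.flatMap _ _ (hpass τ))
      rw [htape]
      rcases hp (seg τ c' ++ (post'.flatMap (seg τ) ++
        post.flatMap (fun τ => (List.finRange t).flatMap (seg τ)))) 0 0 with h' | ⟨z, acc, h'⟩
      · exact h'.1
      · rw [h']
        exact recRun_segment hl henc A M c l' _ _ _ (hbase τ) (hMtab τ) _ (hbase' τ) c' (s i)
          (hMend τ i hends) hcol _ z acc

end

/-! ### Memory contents for a given instance -/

/-- With a single accepting record, the query program accepts everything. -/
lemma exists_memory_accept {U : Type} [AddCommGroup U] {w : ℕ} (enc : U → BitVec w)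
    (hw : 8 ≤ 2 ^ w) :
    ∃ mem : Fin 8 → BitVec w, ∀ c : U,
      run queryProgram (wordAdd enc) 52 (queryConfig (enc c) mem) = some true := by
  let rec₀ : Rec w := ⟨.accept, 0, 0, 0⟩
  let M : ℕ → BitVec w := fun i => (recWords ([rec₀] ++ [rejectRec w])).getD i 0
  have hst : Stored M 8 0 [rec₀] := by
    refine stored_of_recWords M 8 [rec₀] 0 (fun i _ => by rw [zero_add]) ?_ (by simp)
    intro r hr z
    rw [List.mem_singleton] at hr
    subst hr
    simp [rec₀, Rec.addr]
  exact ⟨fun i => M i, fun c => run_stored (wordAdd enc) hw M hw [rec₀] 0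
    (fun i => if i = 0 then enc c else 0) hst (by simp)⟩

/-- For an instance without values of large multiplicity there is a memory content with which the
query program answers all queries correctly. -/
theorem exists_memory_of_mult_le {U : Type} [AddCommGroup U] [Fintype U]
    {K n w l l' t r m M : ℕ} (hl : l ≤ w) (hl' : l' ≤ w) (hn : 0 < n) (hnl : n ≤ 2 ^ l)
    (hml : 16 * m ≤ 2 ^ l') {enc : U → BitVec w}
    (henc : Function.Injective enc) (A : Fin K → Fin n → U) (hM : ∀ y, mult A y ≤ M)
    (hmU : m ≤ Fintype.card U) (hm : 8 * 3 ^ K * M * t * m ≤ n ^ K)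
    (hr : (K : ℝ) * Real.log n < r * (m * t / (2 * (n : ℝ) ^ K)))
    (hs : memSize K t r l l' ≤ 2 ^ w) (hw : 8 ≤ 2 ^ w) :
    ∃ mem : Fin (memSize K t r l l') → BitVec w, ∀ c : U, ∃ b : Bool,
      run queryProgram (wordAdd enc) (26 * (numRecs K t r + 1)) (queryConfig (enc c) mem) = some b ∧
        (b = true ↔ mult A c ≠ 0) := by
  classical
  -- Any m distinct starting points will do.
  obtain ⟨s⟩ : Nonempty (Fin m ↪ U) := by
    rw [Function.Embedding.nonempty_iff_card_le, Fintype.card_fin]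
    exact hmU
  set N : ℝ := (n : ℝ) ^ K with hN
  have hn' : (0 : ℝ) < n := by exact_mod_cast hn
  have hN0 : 0 < N := by positivity
  have : Nonempty (Fin n) := ⟨⟨0, hn⟩⟩
  set κ : ℝ := 3 ^ K * M / N with hκ
  set κ' : ℝ := 2 / 2 ^ l' with hκ'
  have hm' : 8 * 3 ^ K * M * t * m ≤ N := by rw [hN]; exact_mod_cast hm
  have hfound : ∀ y ∈ Finset.univ.filter (fun y => mult A y ≠ 0), m * t / (2 * N) ≤
      pr (fun θ : (Fin t → Fin K → IdxHash w l n) × BitVec w => Found (colFun hl enc A)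
        (fun (γ : BitVec w) y => mulShift l' γ (enc y)) s θ y) := by
    intro y hy
    have hy1 : 1 ≤ mult A y := Nat.one_le_iff_ne_zero.2 (Finset.mem_filter.1 hy).2
    have hy1' : (1 : ℝ) ≤ mult A y := by exact_mod_cast hy1
    refine le_trans ?_ (pr_found_ge (colFun hl enc A)
      (fun (γ : BitVec w) y => mulShift l' γ (enc y)) (fun y => mult A y / N) κ κ'
      (fun x y => pr_colFun_eq hl enc A x y)
      (fun x z y hxz => pr_colFun_eq_and_le hl hnl enc henc A M hM x z y hxz)
      (fun x z hxz => pr_mulShift_eq_le hl' _ _ fun e => hxz (henc e))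
      (by positivity) (by positivity) s s.injective y ?_)
    · calc (m : ℝ) * t / (2 * N) = m * t * (1 / N) / 2 := by field_simp
        _ ≤ _ := by gcongr
    · have hyM : (mult A y : ℝ) ≤ 3 ^ K * M := by
        have h1 : (mult A y : ℝ) ≤ M := by exact_mod_cast hM y
        have h2 : (1 : ℝ) ≤ 3 ^ K := one_le_pow₀ (by norm_num)
        nlinarith [(Nat.cast_nonneg M : (0 : ℝ) ≤ M)]
      -- The three losses in `pr_found_ge` are at most 1/8 each, which leaves room below 1/2.
      have e1 : (m : ℝ) * t * (mult A y / N) ≤ 1 / 8 := by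
        rw [← mul_div_assoc, div_le_iff₀ hN0]
        have := mul_le_mul_of_nonneg_left hyM (by positivity : (0 : ℝ) ≤ m * t)
        linarith
      have e2 : (m : ℝ) * (t * κ) ≤ 1 / 8 := by
        rw [hκ, ← mul_div_assoc, ← mul_div_assoc, div_le_iff₀ hN0]
        linarith
      have e3 : (m : ℝ) * κ' ≤ 1 / 8 := by
        have h1 : (16 : ℝ) * m ≤ 2 ^ l' := by exact_mod_cast hml
        rw [hκ', ← mul_div_assoc, div_le_iff₀ (by positivity)]
        linarith
      linarith
  obtain ⟨θ, hθ⟩ := exists_tables_found_all _ _ _ hfound r (by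
    set p : ℝ := m * t / (2 * N)
    rcases (Finset.univ.filter (fun y => mult A y ≠ 0)).eq_empty_or_nonempty with he | ⟨y, hy⟩
    · rw [he]
      simp
    have hp1 : p ≤ 1 := (hfound y hy).trans (pr_le_one _)
    have hcard : ((Finset.univ.filter (fun y => mult A y ≠ 0)).card : ℝ) ≤ N := by
      rw [hN]
      exact_mod_cast card_support_mult_le A
    -- At most n^K sums have to be found, and r p > K log n makes the expected number of missed ones
    -- less than 1.
    calc (1 - p) ^ r * ((Finset.univ.filter (fun y => mult A y ≠ 0)).card : ℝ)
        ≤ Real.exp (-p) ^ r * N := by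
          gcongr
          exact Real.one_sub_le_exp_neg p
      _ = Real.exp (K * Real.log n - r * p) := by
          have : N = Real.exp (K * Real.log n) := by
            rw [hN, mul_comm, Real.exp_mul, Real.exp_log hn', Real.rpow_natCast]
          rw [this, ← Real.exp_nat_mul, ← Real.exp_add]
          congr 1
          ring
      _ < 1 := by
          rw [Real.exp_lt_one_iff]
          linarith)
  exact exists_memory_of_found hl hl' henc A θ s
    (fun y hy => hθ y (Finset.mem_filter.2 ⟨Finset.mem_univ y, hy⟩)) hs hw

/-! ### Probabilities of bad instances -/

lemma isSum_iff_mult_ne_zero {k n : ℕ} {U : Type} [AddCommGroup U] (A : Instance k n U) (c : U) :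
    IsSum A c ↔ mult A c ≠ 0 := by
  classical
  constructor
  · intro h
    have := one_le_mult A c h
    omega
  · intro h
    unfold mult at h
    rw [← Nat.pos_iff_ne_zero, Fintype.card_pos_iff] at h
    exact ⟨h.some.1, h.some.2⟩

lemma uniformProb_ge {Ω : Type} [Fintype Ω] [Nonempty Ω] (E : Set Ω) (p : Ω → Prop) (ε : ℝ)
    (hp : pr p ≤ ε) (h : ∀ x, ¬p x → x ∈ E) : 1 - ε ≤ uniformProb E := by
  have h1 : uniformProb E = pr (fun x => x ∈ E) := by
    rw [pr_eq_card_div, uniformProb, Nat.card_eq_fintype_card]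
    rfl
  rw [h1]
  calc 1 - ε ≤ 1 - pr p := by linarith
    _ = pr (fun x => ¬p x) := (pr_not p).symm
    _ ≤ _ := pr_mono h

lemma log_le_natLog_succ (n : ℕ) (hn : 0 < n) : Real.log n ≤ (Nat.log 2 n + 1 : ℕ) := by
  have h : (n : ℝ) ≤ 2 ^ (Nat.log 2 n + 1) := by
    exact_mod_cast (Nat.lt_pow_succ_log_self (by norm_num) n).le
  have h2 := Real.log_le_log (by exact_mod_cast hn) h
  rw [Real.log_pow] at h2
  have h3 : Real.log 2 ≤ 1 := by
    have := Real.log_two_lt_d9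
    linarith
  have h4 : (0 : ℝ) ≤ (Nat.log 2 n + 1 : ℕ) := Nat.cast_nonneg _
  nlinarith

lemma exp_neg_le_pow (n a : ℕ) (hn : 0 < n) :
    Real.exp (-((a * (Nat.log 2 n + 1) : ℕ) : ℝ)) ≤ 1 / (n : ℝ) ^ a := by
  have hn' : (0 : ℝ) < n := by exact_mod_cast hn
  rw [Real.exp_neg, ← one_div]
  refine one_div_le_one_div_of_le (by positivity) ?_
  calc (n : ℝ) ^ a = Real.exp (a * Real.log n) := by
        rw [mul_comm, Real.exp_mul, Real.exp_log hn', Real.rpow_natCast]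
    _ ≤ _ := by
        rw [Real.exp_le_exp]
        push_cast
        gcongr
        exact_mod_cast log_le_natLog_succ n hn

/-- If the universe is a bit smaller than the number of index tuples, then with high probability
every element is a sum. -/
lemma pr_exists_not_sum_le {U : Type} [AddCommGroup U] [Fintype U] {K n a : ℕ} (hK : 0 < K)
    (hn : 0 < n) (ha : 0 < a) (hnG : 2 * (a * (Nat.log 2 n + 1)) ≤ n)
    (hU : Fintype.card U * (3 * (2 * (a * (Nat.log 2 n + 1))) ^ K) ≤ n ^ K) :
    pr (fun A : Fin K → Fin n → U => ∃ c, mult A c = 0) ≤ (n : ℝ) ^ K * (1 / (n : ℝ) ^ a) := by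
  set G := a * (Nat.log 2 n + 1) with hG
  have hG0 : 0 < G := by positivity
  set b := n / G with hb
  have hb0 : 0 < b := Nat.div_pos (by omega) hG0
  have hn' : (0 : ℝ) < n := by exact_mod_cast hn
  have hGb : G * b ≤ n := Nat.mul_div_le n G
  have hb2 : (n : ℝ) ≤ 2 * G * b := by
    have h1 : n < G * (b + 1) := Nat.lt_mul_div_succ n hG0
    have h2 : G * (b + 1) ≤ 2 * G * b := by
      calc G * (b + 1) ≤ G * (b + b) := Nat.mul_le_mul_left G (by omega)
        _ = _ := by ring
    exact_mod_cast h1.le.trans h2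
  have hU' : (Fintype.card U : ℝ) * (3 * (2 * G) ^ K) ≤ (n : ℝ) ^ K := by exact_mod_cast hU
  have hUn : (Fintype.card U : ℝ) ≤ (n : ℝ) ^ K := by
    refine le_trans ?_ hU'
    have h1 : (1 : ℝ) ≤ 3 * (2 * G) ^ K := by
      have h2 : (1 : ℝ) ≤ 2 * G := by
        have : (1 : ℝ) ≤ G := by exact_mod_cast hG0
        linarith
      have := one_le_pow₀ h2 (n := K)
      linarith
    exact le_mul_of_one_le_right (Nat.cast_nonneg _) h1
  have hb0' : (0 : ℝ) < b := by exact_mod_cast hb0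
  -- The factor 3 ≥ e gives each block failure probability at most 1/e; G blocks then give e^(-G) ≤
  -- n^(-a).
  have hratio : (Fintype.card U : ℝ) / (b : ℝ) ^ K ≤ Real.exp (-1) := by
    have h3 : (Fintype.card U : ℝ) / (b : ℝ) ^ K ≤ 1 / 3 := by
      rw [div_le_div_iff₀ (by positivity) (by norm_num)]
      have h4 : (n : ℝ) ^ K ≤ (2 * G) ^ K * b ^ K := by
        rw [← mul_pow]
        gcongr
      have h5 : (0 : ℝ) < (2 * G) ^ K := by positivity
      have h6 : (2 * (G : ℝ)) ^ K * (Fintype.card U * 3) ≤ (2 * G) ^ K * (1 * b ^ K) := by linarith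
      exact le_of_mul_le_mul_left h6 h5
    have h4 : (1 : ℝ) / 3 ≤ Real.exp (-1) := by
      rw [Real.exp_neg, ← one_div]
      exact one_div_le_one_div_of_le (Real.exp_pos 1) (by linarith [Real.exp_one_lt_d9])
    exact h3.trans h4
  calc _ ≤ Fintype.card U * ((Fintype.card U : ℝ) / (b : ℝ) ^ K) ^ G :=
        pr_exists_mult_eq_zero_le hK hb0 hGb
    _ ≤ (n : ℝ) ^ K * Real.exp (-1) ^ G := by gcongr
    _ = (n : ℝ) ^ K * Real.exp (-(G : ℝ)) := by
        rw [← Real.exp_nat_mul]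
        congr 2
        ring
    _ ≤ _ := by
        gcongr
        exact exp_neg_le_pow n a hn

/-- From s^s / s! ≤ e^s with s = 9 Λ follows Λ^s / s! ≤ (e / 9)^s, which is at most e^(-s) because
e^2 ≤ 9. -/
lemma pow_div_factorial_le (Λ : ℕ) :
    (Λ : ℝ) ^ (9 * Λ) / (9 * Λ + 1).factorial ≤ Real.exp (-((9 * Λ : ℕ) : ℝ)) := by
  set s := 9 * Λ with hs
  have h1 : (s : ℝ) ^ s / s.factorial ≤ Real.exp s :=
    Real.pow_div_factorial_le_exp s (Nat.cast_nonneg _) s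
  have h2 : (s : ℝ) = 9 * Λ := by rw [hs]; push_cast; ring
  have h3 : Real.exp s * Real.exp s ≤ 9 ^ s := by
    rw [← Real.exp_add, ← two_mul, mul_comm, Real.exp_mul, Real.rpow_ofNat, ← Real.exp_one_rpow,
      Real.rpow_natCast, ← pow_mul, mul_comm, pow_mul]
    gcongr
    nlinarith [Real.exp_one_lt_d9, Real.exp_pos 1]
  have h4 : (Λ : ℝ) ^ s / s.factorial ≤ Real.exp (-(s : ℝ)) := by
    rw [Real.exp_neg, ← one_div, le_div_iff₀ (Real.exp_pos _)]
    have h5 : (Λ : ℝ) ^ s / s.factorial * 9 ^ s ≤ Real.exp s := by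
      rw [h2, mul_pow, ← h2] at h1
      calc _ = 9 ^ s * (Λ : ℝ) ^ s / s.factorial := by ring
        _ ≤ _ := h1
    have h6 := mul_le_mul_of_nonneg_left h3
      (by positivity : (0 : ℝ) ≤ (Λ : ℝ) ^ s / s.factorial)
    have h7 : (Λ : ℝ) ^ s / s.factorial * Real.exp s * Real.exp s ≤ 1 * Real.exp s := by linarith
    exact le_of_mul_le_mul_right h7 (Real.exp_pos _)
  refine le_trans ?_ h4
  gcongr
  exact Nat.le_succ s

/-- If the universe is not much smaller than the number of index tuples, then with high probability
all multiplicities are small. -/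
lemma pr_exists_mult_gt_le {U : Type} [AddCommGroup U] [Fintype U] {K n a Λ : ℕ}
    (hn : 0 < n) (hΛ : a * (Nat.log 2 n + 1) ≤ Λ) (hU : n ^ K ≤ Fintype.card U * Λ) :
    pr (fun A : Fin K → Fin n → U => ∃ y, (9 * Λ) ^ K < mult A y)
      ≤ K * ((n : ℝ) ^ K * (1 / (n : ℝ) ^ a)) := by
  refine (pr_mult_gt_le (s := 9 * Λ) hn ((n : ℝ) ^ K) K le_rfl).trans ?_
  have hU0 : (0 : ℝ) < Fintype.card U := by exact_mod_cast Fintype.card_pos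
  have hU' : (n : ℝ) ^ K ≤ Fintype.card U * Λ := by exact_mod_cast hU
  have hn' : (0 : ℝ) < n := by exact_mod_cast hn
  gcongr
  set s := 9 * Λ with hs
  calc ((n : ℝ) ^ K) ^ (s + 1) / ((Fintype.card U : ℝ) ^ s * (s + 1).factorial)
      = (n : ℝ) ^ K * ((((n : ℝ) ^ K) / Fintype.card U) ^ s / (s + 1).factorial) := by
        rw [div_pow, pow_succ]
        field_simp
    _ ≤ (n : ℝ) ^ K * ((Λ : ℝ) ^ s / (s + 1).factorial) := by
        gcongr
        rw [div_le_iff₀ hU0]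
        linarith
    _ ≤ (n : ℝ) ^ K * Real.exp (-(s : ℝ)) := by
        gcongr
        exact pow_div_factorial_le Λ
    _ ≤ (n : ℝ) ^ K * Real.exp (-((a * (Nat.log 2 n + 1) : ℕ) : ℝ)) := by
        gcongr
        omega
    _ ≤ _ := by
        gcongr
        exact exp_neg_le_pow n a hn

lemma pow_mul_one_div_le {n K q : ℕ} (hn : 0 < n) :
    (n : ℝ) ^ K * (1 / (n : ℝ) ^ (q + K + 2)) = 1 / (n : ℝ) ^ (q + 2) := by
  have hn' : (0 : ℝ) < n := by exact_mod_cast hn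
  rw [show q + K + 2 = K + (q + 2) by ring, pow_add (n : ℝ) K]
  field_simp

/-! ### Choice of the parameters for chains of length t -/

lemma two_pow_clog_le {x : ℕ} (hx : 0 < x) : 2 ^ Nat.clog 2 x ≤ 2 * x := by
  rcases Nat.lt_or_ge 1 x with h | h
  · have h1 := Nat.pow_pred_clog_lt_self (by norm_num : 1 < 2) h
    have h2 : 0 < Nat.clog 2 x := Nat.clog_pos (by norm_num) h
    obtain ⟨j, hj⟩ := Nat.exists_eq_add_of_lt h2
    rw [hj] at h1 ⊢
    simp only [zero_add, Nat.pred_eq_sub_one, Nat.add_sub_cancel] at h1 ⊢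
    rw [pow_succ]
    omega
  · have : x = 1 := by omega
    subst this
    simp

/-- The data structure for chains of length `t`, for instances in which every element has at most
`M` representations. -/
lemma exists_memory_of_lt_card {U : Type} [AddCommGroup U] [Fintype U]
    {K n t w M Λ L R : ℕ} (hK : 0 < K) (hn0 : 0 < n) (ht : 1 ≤ t) (htn : t ≤ n) (hM0 : 0 < M)
    (hΛM : Λ ≤ M) (hU : n ^ K < Fintype.card U * Λ) (hL : L = Nat.log 2 n + 1)
    (hR : R = 33 * (3 ^ K * M * K * L))
    (hsize : (R : ℝ) * (26 * K + 130) * (t * n + (n : ℝ) ^ K / t) ≤ (n : ℝ) ^ K)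
    {enc : U → BitVec w} (henc : Function.Injective enc) (hw : n ^ K ≤ 2 ^ w) (hw8 : 8 ≤ 2 ^ w) :
    ∃ s T : ℕ, (s : ℝ) ≤ R * (26 * K + 130) * (t * n + (n : ℝ) ^ K / t) ∧
      T ≤ R * (26 * K + 130) * t ^ 2 ∧
      ∀ A : Fin K → Fin n → U, (∀ y, mult A y ≤ M) →
        ∃ mem : Fin s → BitVec w, ∀ c : U, ∃ b : Bool,
          run queryProgram (wordAdd enc) T (queryConfig (enc c) mem) = some b ∧
            (b = true ↔ mult A c ≠ 0) := by
  classical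
  have hn' : (0 : ℝ) < n := by exact_mod_cast hn0
  have ht' : (0 : ℝ) < t := by exact_mod_cast ht
  have ht1 : (1 : ℝ) ≤ t := by exact_mod_cast ht
  have hn1 : (1 : ℝ) ≤ n := by exact_mod_cast hn0
  have htn' : (t : ℝ) ≤ n := by exact_mod_cast htn
  have hL1 : 0 < L := by omega
  have hlogL : Real.log n ≤ L := by
    rw [hL]
    exact log_le_natLog_succ n hn0
  obtain ⟨N, hN⟩ : ∃ N : ℝ, N = (n : ℝ) ^ K := ⟨_, rfl⟩
  have hN0 : 0 < N := by rw [hN]; positivity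
  have hNt : 0 < N / t := by positivity
  obtain ⟨B, hB⟩ : ∃ B, B = 3 ^ K * M := ⟨_, rfl⟩
  have hB0 : 0 < B := by rw [hB]; positivity
  have hMB : M ≤ B := by rw [hB]; exact Nat.le_mul_of_pos_left _ (by positivity)
  rw [← hB] at hR
  have hBK : B ≤ B * K * L := by
    rw [mul_assoc]
    exact Nat.le_mul_of_pos_right _ (by positivity)
  have hR0 : 0 < R := by rw [hR]; positivity
  -- Q is the factor in the size condition of `exists_memory_of_mult_le`, so ⌊n^K / Q⌋ is the
  -- largest admissible number of chains.
  obtain ⟨Q, hQ⟩ : ∃ Q, Q = 8 * B * t := ⟨_, rfl⟩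
  have hQ0 : 0 < Q := by rw [hQ]; positivity
  -- Since m ≥ n^K / (16 B t), one table succeeds with probability at least m t / (2 n^K) ≥ 1 / (32
  -- B); so r > 32 B K L exceeds what K log n requires.
  obtain ⟨r, hr⟩ : ∃ r, r = 32 * (B * K * L) + 1 := ⟨_, rfl⟩
  have hr1 : 1 ≤ r := by omega
  have hrR : r ≤ R := by omega
  rw [← hN] at hsize ⊢
  have hQN : Q ≤ n ^ K := by
    have h1 : (8 * B : ℕ) ≤ R := by omega
    have h2 : ((8 * B : ℕ) : ℝ) ≤ R := by exact_mod_cast h1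
    have h3 : (Q : ℝ) ≤ N := by
      refine le_trans ?_ hsize
      calc (Q : ℝ) = (8 * B : ℕ) * (t * 1) := by rw [hQ]; push_cast; ring
        _ ≤ R * (26 * K + 130) * (t * n + N / t) := by
          gcongr
          · nlinarith [(Nat.cast_nonneg K : (0 : ℝ) ≤ K), (Nat.cast_nonneg R : (0 : ℝ) ≤ R),
              mul_nonneg (Nat.cast_nonneg R : (0 : ℝ) ≤ R) (Nat.cast_nonneg K : (0 : ℝ) ≤ K)]
          · nlinarith
    rw [hN] at h3
    exact_mod_cast h3
  obtain ⟨m, hm⟩ : ∃ m, m = n ^ K / Q := ⟨_, rfl⟩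
  have hm0 : 0 < m := by rw [hm]; exact Nat.div_pos hQN hQ0
  have hQm : Q * m ≤ n ^ K := by rw [hm]; exact Nat.mul_div_le _ _
  have hQm2 : n ^ K ≤ 2 * Q * m := by
    have h1 : n ^ K < Q * (m + 1) := by rw [hm]; exact Nat.lt_mul_div_succ _ hQ0
    have h2 : Q * (m + 1) ≤ Q * (m + m) := Nat.mul_le_mul_left _ (by omega)
    have h3 : Q * (m + m) = 2 * Q * m := by ring
    omega
  have hmU : m ≤ Fintype.card U := by
    have h1 : Λ ≤ Q := by
      refine (hΛM.trans hMB).trans ?_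
      rw [hQ]
      calc B ≤ B * (8 * t) := Nat.le_mul_of_pos_right _ (by positivity)
        _ = _ := by ring
    have h2 : m * Λ ≤ n ^ K := by
      calc m * Λ ≤ m * Q := Nat.mul_le_mul_left _ h1
        _ ≤ n ^ K := by rw [mul_comm]; exact hQm
    exact (lt_of_mul_lt_mul_right (h2.trans_lt hU) (Nat.zero_le _)).le
  obtain ⟨l, hl⟩ : ∃ l, l = Nat.clog 2 n := ⟨_, rfl⟩
  obtain ⟨l', hl'⟩ : ∃ l', l' = Nat.clog 2 (16 * m) := ⟨_, rfl⟩
  have hl2 : 2 ^ l ≤ 2 * n := by rw [hl]; exact two_pow_clog_le hn0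
  have hl2' : 2 ^ l' ≤ 32 * m := by
    have := two_pow_clog_le (by omega : 0 < 16 * m)
    rw [← hl'] at this
    omega
  have h32 : (32 : ℝ) * m ≤ 4 * (N / t) := by
    rw [← mul_div_assoc, le_div_iff₀ ht']
    have h1 : 8 * t * m ≤ Q * m := by
      refine Nat.mul_le_mul_right _ ?_
      rw [hQ]
      calc 8 * t ≤ B * (8 * t) := Nat.le_mul_of_pos_left _ hB0
        _ = _ := by ring
    have h2 : ((8 * t * m : ℕ) : ℝ) ≤ N := by
      rw [hN]; exact_mod_cast h1.trans hQm
    push_cast at h2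
    linarith
  have hnum : numRecs K t r ≤ r * t ^ 2 * (K + 4) := by
    have h1 : t * (K + 2) + 2 ≤ t * (K + 4) := by nlinarith
    calc numRecs K t r ≤ r * (t * (t * (K + 4))) :=
          Nat.mul_le_mul_left _ (Nat.mul_le_mul_left _ h1)
      _ = _ := by ring
  have hmem : (memSize K t r l l' : ℝ) ≤ R * (26 * K + 130) * (t * n + N / t) := by
    have h1 : memSize K t r l l' ≤ 4 * (r * t ^ 2 * (K + 4) + 1) + r * t * K * (2 * n)
        + r * (32 * m) := by
      unfold memSize
      exact Nat.add_le_add (Nat.add_le_add (Nat.mul_le_mul_left _ (Nat.add_le_add_right hnum 1))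
        (Nat.mul_le_mul_left _ hl2)) (Nat.mul_le_mul_left _ hl2')
    have h2 : (memSize K t r l l' : ℝ) ≤ 4 * (r * (t : ℝ) ^ 2 * (K + 4) + 1)
        + r * t * K * (2 * n) + r * (32 * m) := by exact_mod_cast h1
    have hr1' : (1 : ℝ) ≤ r := by exact_mod_cast hr1
    have h3 : (t : ℝ) ^ 2 ≤ t * n := by rw [sq]; gcongr
    have h5 : (1 : ℝ) ≤ r * (t * n) := one_le_mul_of_one_le_of_one_le hr1'
      (one_le_mul_of_one_le_of_one_le ht1 hn1)
    have hrR' : (r : ℝ) ≤ R := by exact_mod_cast hrR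
    have hK0 : (0 : ℝ) ≤ K := Nat.cast_nonneg K
    have h6 : (6 * (K : ℝ) + 20) * (t * n) ≤ (26 * K + 130) * (t * n) := by
      gcongr <;> norm_num
    have h7 : 4 * (N / t) ≤ (26 * (K : ℝ) + 130) * (N / t) := by
      gcongr
      linarith
    calc (memSize K t r l l' : ℝ)
        ≤ 4 * (r * (t : ℝ) ^ 2 * (K + 4) + 1) + r * t * K * (2 * n) + r * (32 * m) := h2
      _ ≤ 4 * (r * (t * n) * (K + 4) + r * (t * n)) + r * t * K * (2 * n)
          + r * (4 * (N / t)) := by gcongr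
      _ = r * ((6 * K + 20) * (t * n) + 4 * (N / t)) := by ring
      _ ≤ R * ((26 * K + 130) * (t * n) + (26 * K + 130) * (N / t)) := by gcongr
      _ = _ := by ring
  -- The size hypothesis keeps the memory below n^K ≤ 2^w, so all addresses fit into a word.
  have hmemw : memSize K t r l l' ≤ 2 ^ w := by
    have h1 : (memSize K t r l l' : ℝ) ≤ (n ^ K : ℕ) := by
      push_cast
      rw [← hN]
      exact hmem.trans hsize
    exact (Nat.cast_le.1 h1).trans hw
  have hlw : l ≤ w := by
    have h1 : 2 ^ l ≤ memSize K t r l l' := by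
      unfold memSize
      have := Nat.le_mul_of_pos_left (2 ^ l) (by positivity : 0 < r * t * K)
      omega
    exact (Nat.pow_le_pow_iff_right (by norm_num)).1 (h1.trans hmemw)
  have hlw' : l' ≤ w := by
    have h1 : 2 ^ l' ≤ memSize K t r l l' := by
      unfold memSize
      have := Nat.le_mul_of_pos_left (2 ^ l') (by omega : 0 < r)
      omega
    exact (Nat.pow_le_pow_iff_right (by norm_num)).1 (h1.trans hmemw)
  have hrlog : (K : ℝ) * Real.log n < r * (m * t / (2 * (n : ℝ) ^ K)) := by
    rw [← hN]
    have h1 : (K : ℝ) * Real.log n ≤ K * L := by gcongr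
    refine h1.trans_lt ?_
    rw [← mul_div_assoc, lt_div_iff₀ (by positivity)]
    have h2 : N ≤ 2 * (8 * B * t) * m := by
      rw [hQ] at hQm2
      rw [hN]; exact_mod_cast hQm2
    have h3 : (r : ℝ) = 32 * (B * K * L) + 1 := by rw [hr]; push_cast; ring
    have hm0' : (0 : ℝ) < m := by exact_mod_cast hm0
    have h4 : (0 : ℝ) < m * t := by positivity
    have h5 : (K : ℝ) * L * (2 * N) ≤ K * L * (2 * (2 * (8 * B * t) * m)) := by
      gcongr
    rw [h3]
    calc (K : ℝ) * L * (2 * N) ≤ K * L * (2 * (2 * (8 * B * t) * m)) := h5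
      _ < K * L * (2 * (2 * (8 * B * t) * m)) + m * t := by linarith
      _ = _ := by ring
  refine ⟨memSize K t r l l', 26 * (numRecs K t r + 1), hmem, ?_, fun A hA => ?_⟩
  · have h2 : 1 ≤ r * t ^ 2 := Nat.one_le_iff_ne_zero.2 (by positivity)
    -- The constant 26 K + 130 is 26 (K + 4) + 26.
    calc 26 * (numRecs K t r + 1) ≤ 26 * (r * t ^ 2 * (K + 4) + r * t ^ 2) :=
          Nat.mul_le_mul_left _ (Nat.add_le_add hnum h2)
      _ = r * ((26 * K + 130) * t ^ 2) := by ring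
      _ ≤ R * ((26 * K + 130) * t ^ 2) := Nat.mul_le_mul_right _ hrR
      _ = _ := by ring
  · refine exists_memory_of_mult_le hlw hlw' hn0 ?_ ?_ henc A hA hmU ?_ hrlog hmemw hw8
    · rw [hl]; exact Nat.le_pow_clog (by norm_num) n
    · rw [hl']; exact Nat.le_pow_clog (by norm_num) _
    · rw [mul_assoc 8 (3 ^ K) M, ← hB, ← hQ]; exact hQm

/-- The data structure for chains of length `t`, without asymptotic simplifications. -/
theorem exists_preprocess (K q : ℕ) (hK : 0 < K) :
    ∃ C : ℕ, ∀ n t : ℕ, 1 ≤ t → t ≤ n →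
      (C : ℝ) * ((Nat.log 2 n + 1 : ℕ) : ℝ) ^ (K ^ 2 + 1) * (t * n + (n : ℝ) ^ K / t)
        ≤ (n : ℝ) ^ K →
      ∀ (U : Type) [AddCommGroup U] [Finite U] (w : ℕ) (enc : U → BitVec w),
        Function.Injective enc → n ^ K ≤ 2 ^ w →
        ∃ (s T : ℕ) (preprocess : (Fin K → Fin n → U) → (Fin s → BitVec w)),
          (s : ℝ) ≤ C * ((Nat.log 2 n + 1 : ℕ) : ℝ) ^ (K ^ 2 + 1) * (t * n + (n : ℝ) ^ K / t) ∧
          (T : ℝ) ≤ C * ((Nat.log 2 n + 1 : ℕ) : ℝ) ^ (K ^ 2 + 1) * (t : ℝ) ^ 2 ∧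
          1 - 1 / (n : ℝ) ^ q ≤ uniformProb {A : Fin K → Fin n → U | ∀ c : U, ∃ b : Bool,
            run queryProgram (wordAdd enc) T (queryConfig (enc c) (preprocess A)) = some b ∧
              (b = true ↔ mult A c ≠ 0)} := by
  classical
  -- An error n^K n^(-a) is n^(-(q + 2)); the spare n^2 absorbs the factor K from the number of
  -- lists.
  obtain ⟨a, ha⟩ : ∃ a, a = q + K + 2 := ⟨_, rfl⟩
  obtain ⟨c₁, hc₁⟩ : ∃ c₁ : ℕ, c₁ = (27 * (2 * a) ^ K) ^ K := ⟨_, rfl⟩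
  obtain ⟨c₂, hc₂⟩ : ∃ c₂ : ℕ, c₂ = 33 * 3 ^ K * c₁ * K * (26 * K + 130) := ⟨_, rfl⟩
  obtain ⟨C, hC⟩ : ∃ C : ℕ, C = c₂ + 2 * a + K + 52 := ⟨_, rfl⟩
  refine ⟨C, fun n t ht htn hsize U _ _ w enc henc hw => ?_⟩
  have : Fintype U := Fintype.ofFinite U
  obtain ⟨L, hL⟩ : ∃ L, L = Nat.log 2 n + 1 := ⟨_, rfl⟩
  obtain ⟨D, hD⟩ : ∃ D, D = K ^ 2 + 1 := ⟨_, rfl⟩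
  rw [← hL, ← hD] at hsize ⊢
  have hL1 : 1 ≤ L := by omega
  have hD0 : 0 < D := by rw [hD]; positivity
  have hn0 : 0 < n := by omega
  have hn' : (0 : ℝ) < n := by exact_mod_cast hn0
  have hn1 : (1 : ℝ) ≤ n := by exact_mod_cast hn0
  have ht' : (0 : ℝ) < t := by exact_mod_cast ht
  have ht1 : (1 : ℝ) ≤ t := by exact_mod_cast ht
  have hL1' : (1 : ℝ) ≤ L := by exact_mod_cast hL1
  have hLD : (1 : ℝ) ≤ (L : ℝ) ^ D := one_le_pow₀ hL1'
  have hCL0 : (0 : ℝ) ≤ (C : ℝ) * (L : ℝ) ^ D := by positivity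
  have hN0 : (0 : ℝ) < (n : ℝ) ^ K := by positivity
  obtain ⟨X, hX⟩ : ∃ X : ℝ, X = t * n + (n : ℝ) ^ K / t := ⟨_, rfl⟩
  rw [← hX] at hsize ⊢
  have hX1 : (1 : ℝ) ≤ X := by
    have h1 : (1 : ℝ) ≤ t * n := one_le_mul_of_one_le_of_one_le ht1 hn1
    have h2 : 0 < (n : ℝ) ^ K / t := by positivity
    linarith
  -- The size hypothesis forces C L^D ≤ t ≤ n. The summands of C thereby supply every lower bound on
  -- n that is needed.
  have hCt : (C : ℝ) * (L : ℝ) ^ D ≤ t := by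
    have h1 : (C : ℝ) * (L : ℝ) ^ D * ((n : ℝ) ^ K / t) ≤ (n : ℝ) ^ K := by
      refine le_trans (mul_le_mul_of_nonneg_left ?_ hCL0) hsize
      rw [hX]
      linarith [mul_pos ht' hn']
    rw [← mul_div_assoc, div_le_iff₀ ht', mul_comm ((n : ℝ) ^ K)] at h1
    exact le_of_mul_le_mul_right h1 hN0
  have hCt' : C * L ^ D ≤ t := by exact_mod_cast hCt
  have hLDn : 1 ≤ L ^ D := Nat.one_le_pow _ _ hL1
  have hLLD : L ≤ L ^ D := Nat.le_self_pow hD0.ne' L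
  have hCn : C ≤ n := (Nat.le_mul_of_pos_right C hLDn).trans (hCt'.trans htn)
  have hKn : K ≤ n := by omega
  have hwn : n ≤ n ^ K := Nat.le_self_pow hK.ne' n
  have hw8 : 8 ≤ 2 ^ w := by
    have : 8 ≤ n := by omega
    exact (this.trans hwn).trans hw
  have hG : 2 * (a * L) ≤ n := by
    calc 2 * (a * L) = 2 * a * L := by ring
      _ ≤ C * L ^ D := Nat.mul_le_mul (by omega) hLLD
      _ ≤ n := hCt'.trans htn
  obtain ⟨Λ, hΛ⟩ : ∃ Λ, Λ = 3 * (2 * (a * L)) ^ K := ⟨_, rfl⟩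
  have hprob1 : 1 / (n : ℝ) ^ (q + 2) ≤ 1 / (n : ℝ) ^ q :=
    one_div_le_one_div_of_le (by positivity) (pow_le_pow_right₀ hn1 (by omega))
  -- Both cases share the threshold Λ: below it everything is a sum and one accepting record
  -- suffices, above it multiplicities are at most (9 Λ)^K.
  by_cases hU : Fintype.card U * Λ ≤ n ^ K
  · obtain ⟨mem, hmem⟩ := exists_memory_accept enc hw8
    have hC52 : (52 : ℝ) ≤ C := by
      have : 52 ≤ C := by omega
      exact_mod_cast this
    have hC52' : (52 : ℝ) ≤ (C : ℝ) * (L : ℝ) ^ D :=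
      hC52.trans (le_mul_of_one_le_right (by linarith) hLD)
    refine ⟨8, 52, fun _ => mem, ?_, ?_, ?_⟩
    · push_cast
      have := le_mul_of_one_le_right hCL0 hX1
      linarith
    · push_cast
      have := le_mul_of_one_le_right hCL0 (one_le_pow₀ ht1 (n := 2))
      linarith
    · rw [hΛ, hL] at hU
      rw [hL] at hG
      refine uniformProb_ge _ (fun A : Fin K → Fin n → U => ∃ c, mult A c = 0) _
        ((pr_exists_not_sum_le hK hn0 (by omega : 0 < a) hG hU).trans ?_) ?_
      · rw [ha, pow_mul_one_div_le hn0]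
        exact hprob1
      · intro A hA
        push Not at hA
        exact fun c => ⟨true, hmem c, by simp [hA c]⟩
  · push Not at hU
    have ha0 : 0 < a := by omega
    have hΛ0 : 0 < Λ := by rw [hΛ]; positivity
    obtain ⟨M, hM⟩ : ∃ M, M = (9 * Λ) ^ K := ⟨_, rfl⟩
    -- Λ is of order L^K, so M is of order L^(K^2); the number of tables adds one more L, whence D =
    -- K^2 + 1.
    have hMeq : M = c₁ * L ^ K ^ 2 := by
      rw [hM, hΛ, hc₁, sq, pow_mul, ← mul_pow]
      congr 1
      rw [mul_pow 2 (a * L), mul_pow a L, mul_pow 2 a]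
      ring
    have hM1 : Λ ≤ M := by
      calc Λ ≤ 9 * Λ := by omega
        _ ≤ M := by rw [hM]; exact Nat.le_self_pow hK.ne' _
    obtain ⟨R, hR⟩ : ∃ R, R = 33 * (3 ^ K * M * K * L) := ⟨_, rfl⟩
    have hRC : R * (26 * K + 130) ≤ C * L ^ D := by
      have : R * (26 * K + 130) = c₂ * L ^ D := by
        rw [hR, hMeq, hc₂, hD, pow_succ]; ring
      rw [this]
      exact Nat.mul_le_mul_right _ (by omega)
    have hRC' : (R : ℝ) * (26 * K + 130) ≤ C * (L : ℝ) ^ D := by exact_mod_cast hRC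
    have hRX : (R : ℝ) * (26 * K + 130) * X ≤ C * (L : ℝ) ^ D * X := by gcongr
    have hRX' := hRX.trans hsize
    rw [hX] at hRX'
    obtain ⟨s, T, hs, hT, hgood⟩ := exists_memory_of_lt_card hK hn0 ht htn (by omega) hM1 hU hL hR
      hRX' henc hw hw8
    rw [← hX] at hs
    -- Instances with a large multiplicity belong to the exceptional event, and their memory is
    -- arbitrary.
    refine ⟨s, T, fun A => if h : ∀ y, mult A y ≤ M then (hgood A h).choose else fun _ => 0,
      hs.trans hRX, ?_, ?_⟩
    · have h3 := hT.trans (Nat.mul_le_mul_right (t ^ 2) hRC)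
      exact_mod_cast h3
    · have haΛ : a * (Nat.log 2 n + 1) ≤ Λ := by
        rw [hΛ, ← hL]
        calc a * L ≤ 2 * (a * L) := by omega
          _ ≤ (2 * (a * L)) ^ K := Nat.le_self_pow hK.ne' _
          _ ≤ _ := by omega
      refine uniformProb_ge _ (fun A : Fin K → Fin n → U => ∃ y, (9 * Λ) ^ K < mult A y) _
        ((pr_exists_mult_gt_le (a := a) hn0 haΛ hU.le).trans ?_) ?_
      · rw [ha, pow_mul_one_div_le hn0, ← mul_div_assoc, mul_one,
          div_le_div_iff₀ (by positivity) (by positivity), one_mul, pow_add, mul_comm]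
        gcongr
        have : (K : ℝ) ≤ n := by exact_mod_cast hKn
        nlinarith
      · intro A hA
        push Not at hA
        rw [← hM] at hA
        have := (hgood A hA).choose_spec
        simp only [Set.mem_ofPred_eq, dif_pos hA]
        exact this

/-! ### Asymptotics and the choice of the chain length -/

open Filter Asymptotics

lemma one_le_log {n : ℕ} (hn : 3 ≤ n) : (1 : ℝ) ≤ Real.log n := by
  have h0 : (0 : ℝ) < n := by positivity
  rw [Real.le_log_iff_exp_le h0]
  have h4 : (3 : ℝ) ≤ n := by exact_mod_cast hn
  linarith [Real.exp_one_lt_d9]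

lemma natLog_succ_le {n : ℕ} (hn : 3 ≤ n) : ((Nat.log 2 n + 1 : ℕ) : ℝ) ≤ 3 * Real.log n := by
  have h1 : (2 : ℝ) ^ Nat.log 2 n ≤ n := by
    exact_mod_cast Nat.pow_log_le_self 2 (by omega : n ≠ 0)
  have h2 := Real.log_le_log (by positivity) h1
  rw [Real.log_pow] at h2
  have h3 := one_le_log hn
  have h5 : (1 / 2 : ℝ) * Nat.log 2 n ≤ Real.log 2 * Nat.log 2 n := by
    gcongr
    linarith [Real.log_two_gt_d9]
  push_cast
  linarith

lemma eventually_mul_natLog_pow_le (c a : ℕ) {p : ℝ} (hp : 0 < p) :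
    ∀ᶠ n : ℕ in atTop, (c : ℝ) * ((Nat.log 2 n + 1 : ℕ) : ℝ) ^ a ≤ (n : ℝ) ^ p := by
  have h1 := (isLittleO_log_rpow_rpow_atTop (a : ℝ) hp).bound
    (c := 1 / (c * 3 ^ a + 1)) (by positivity)
  filter_upwards [tendsto_natCast_atTop_atTop.eventually h1, eventually_ge_atTop 3] with n h2 h3
  have h4 := one_le_log h3
  rw [Real.rpow_natCast, Real.norm_of_nonneg (by positivity), Real.norm_of_nonneg (by positivity),
    div_mul_eq_mul_div, one_mul, le_div_iff₀ (by positivity)] at h2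
  calc (c : ℝ) * ((Nat.log 2 n + 1 : ℕ) : ℝ) ^ a ≤ c * (3 * Real.log n) ^ a := by
        gcongr
        exact natLog_succ_le h3
    _ = Real.log n ^ a * (c * 3 ^ a) := by rw [mul_pow]; ring
    _ ≤ Real.log n ^ a * (c * 3 ^ a + 1) := by gcongr; linarith
    _ ≤ _ := h2

/-- Reduction of solvability to a choice of the length `t n` of the chains. -/
lemma solvableOnRandom_of_chain_length {k D : ℕ} (hk : 3 ≤ k) (hD : D = (k - 1) ^ 2 + 1)
    (t : ℕ → ℕ) (time space : ℕ → ℝ)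
    (h1 : ∀ᶠ n in atTop, 1 ≤ t n ∧ t n ≤ n)
    (h2 : ∀ C : ℕ, ∀ᶠ n : ℕ in atTop, (C : ℝ) * (((Nat.log 2 n + 1 : ℕ) : ℝ) ^ D *
      (t n * n + (n : ℝ) ^ (k - 1) / t n)) ≤ (n : ℝ) ^ (k - 1))
    (h3 : ∃ B : ℝ, 0 ≤ B ∧ ∀ᶠ n : ℕ in atTop,
      ((Nat.log 2 n + 1 : ℕ) : ℝ) ^ D * (t n * n + (n : ℝ) ^ (k - 1) / t n) ≤ B * space n ∧
      ((Nat.log 2 n + 1 : ℕ) : ℝ) ^ D * (t n : ℝ) ^ 2 ≤ B * time n) :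
    SolvableOnRandom k time space := by
  intro q
  obtain ⟨C, hC⟩ := exists_preprocess (k - 1) q (by omega)
  obtain ⟨B, hB, h3⟩ := h3
  -- The constant C depends on q, so `h2` is asked for every C; the program is the same for all q.
  obtain ⟨n₀, hn₀⟩ := eventually_atTop.1 (h1.and ((h2 C).and h3))
  refine ⟨queryProgram, C * B, n₀, fun n hn U _ _ w enc henc hw => ?_⟩
  obtain ⟨⟨ht1, htn⟩, hsize, hspace, htime⟩ := hn₀ n hn
  rw [hD] at hsize hspace htime
  obtain ⟨s, T, pre, hs, hT, hp⟩ := hC n (t n) ht1 htn (by rw [mul_assoc]; exact hsize) U w enc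
    henc hw
  refine ⟨s, T, pre, ?_, ?_, hp.trans (le_of_eq ?_)⟩
  · rw [mul_assoc] at hs ⊢
    exact hs.trans (mul_le_mul_of_nonneg_left hspace (Nat.cast_nonneg C))
  · rw [mul_assoc] at hT ⊢
    exact hT.trans (mul_le_mul_of_nonneg_left htime (Nat.cast_nonneg C))
  · congr 1
    ext A
    simp only [Set.mem_ofPred_eq, AnswersAll, isSum_iff_mult_ne_zero]

/-- Here P is the polylogarithmic factor, x = n^(δ/2), ν = n and N = n^(k-1). Shortening the chains
by P removes P from the time and leaves P^2 in the space. Rounding t up at most doubles it, since x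
/ P ≥ 1. The cost t ν of the column functions stays below N / x even after the factor P. -/
lemma bounds_of_chain_length_div {P x ν N t : ℝ} (hP : 1 ≤ P) (hPx : P ≤ x)
    (hν : 2 * P ^ 2 * x ^ 2 ≤ ν) (hN : ν ^ 2 ≤ N) (ht : x / P ≤ t) (ht' : t ≤ x / P + 1) :
    1 ≤ t ∧ t ≤ ν ∧ P * (t * ν + N / t) ≤ 2 * P ^ 2 * (N / x) ∧ P * t ^ 2 ≤ 4 * x ^ 2 := by
  have hP0 : 0 < P := by linarith
  have hx1 : 1 ≤ x := hP.trans hPx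
  have hx0 : 0 < x := by linarith
  have hy : 1 ≤ x / P := by rwa [le_div_iff₀ hP0, one_mul]
  have ht1 : 1 ≤ t := hy.trans ht
  have ht0 : 0 < t := by linarith
  have htP : t * P ≤ 2 * x := by
    have : t ≤ 2 * x / P := by rw [mul_div_assoc]; linarith
    rwa [le_div_iff₀ hP0] at this
  have ht2 : x ≤ t * P := (div_le_iff₀ hP0).1 ht
  have hP2 : 1 ≤ P ^ 2 := one_le_pow₀ hP
  have hx2 : 2 * x ^ 2 ≤ ν := by nlinarith [sq_nonneg x]
  have hν0 : 0 < ν := lt_of_lt_of_le (by positivity) hx2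
  have hN0 : 0 < N := lt_of_lt_of_le (by positivity) hN
  have htx : t ≤ 2 * x := (le_mul_of_one_le_right ht0.le hP).trans htP
  refine ⟨ht1, ?_, ?_, ?_⟩
  · nlinarith
  · have h1 : P * (t * ν) ≤ N / x := by
      rw [le_div_iff₀ hx0]
      calc P * (t * ν) * x = (t * P) * (ν * x) := by ring
        _ ≤ 2 * x * (ν * x) := by gcongr
        _ = 2 * x ^ 2 * ν := by ring
        _ ≤ ν * ν := by gcongr
        _ = ν ^ 2 := by ring
        _ ≤ N := hN
    have h2 : P * (N / t) ≤ P ^ 2 * (N / x) := by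
      rw [← mul_div_assoc, ← mul_div_assoc, div_le_div_iff₀ ht0 hx0]
      calc P * N * x ≤ P * N * (t * P) := by gcongr
        _ = _ := by ring
    have h3 : N / x ≤ P ^ 2 * (N / x) := le_mul_of_one_le_left (by positivity) hP2
    linarith
  · calc P * t ^ 2 ≤ P ^ 2 * t ^ 2 := by gcongr; nlinarith
      _ = (t * P) ^ 2 := by ring
      _ ≤ (2 * x) ^ 2 := by gcongr
      _ = _ := by ring

/-- Lengthening the chains by P instead cleans the space and leaves P^3 in the time. -/
lemma bounds_of_chain_length_mul {P x ν N t : ℝ} (hP : 1 ≤ P) (hx1 : 1 ≤ x)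
    (hν : 2 * P ^ 2 * x ^ 2 ≤ ν) (hN : ν ^ 2 ≤ N) (ht : x * P ≤ t) (ht' : t ≤ x * P + 1) :
    1 ≤ t ∧ t ≤ ν ∧ P * (t * ν + N / t) ≤ 2 * (N / x) ∧ P * t ^ 2 ≤ 4 * P ^ 3 * x ^ 2 := by
  have hP0 : 0 < P := by linarith
  have hx0 : 0 < x := by linarith
  have hy : 1 ≤ x * P := one_le_mul_of_one_le_of_one_le hx1 hP
  have ht1 : 1 ≤ t := hy.trans ht
  have ht0 : 0 < t := by linarith
  have ht2 : t ≤ 2 * (x * P) := by linarith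
  have hν0 : 0 < ν := lt_of_lt_of_le (by positivity) hν
  have hN0 : 0 < N := lt_of_lt_of_le (by positivity) hN
  refine ⟨ht1, ?_, ?_, ?_⟩
  · nlinarith
  · have h1 : P * (t * ν) ≤ N / x := by
      rw [le_div_iff₀ hx0]
      calc P * (t * ν) * x ≤ P * (2 * (x * P) * ν) * x := by gcongr
        _ = 2 * P ^ 2 * x ^ 2 * ν := by ring
        _ ≤ ν * ν := by gcongr
        _ = ν ^ 2 := by ring
        _ ≤ N := hN
    have h2 : P * (N / t) ≤ N / x := by
      rw [← mul_div_assoc, div_le_div_iff₀ ht0 hx0]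
      calc P * N * x = N * (x * P) := by ring
        _ ≤ N * t := by gcongr
    linarith
  · calc P * t ^ 2 ≤ P * (2 * (x * P)) ^ 2 := by gcongr
      _ = _ := by ring

theorem exists_solvableOnRandom {k : ℕ} (hk : 3 ≤ k) {δ : ℝ} (hδ : 0 < δ) (hδ' : δ < 1) :
    ∃ d : ℕ,
      SolvableOnRandom k (fun n => (n : ℝ) ^ δ)
        (fun n => (n : ℝ) ^ ((k : ℝ) - 1 - δ / 2) * Real.log n ^ d) ∧
      SolvableOnRandom k (fun n => (n : ℝ) ^ δ * Real.log n ^ d)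
        (fun n => (n : ℝ) ^ ((k : ℝ) - 1 - δ / 2)) := by
  obtain ⟨D, hD⟩ : ∃ D, D = (k - 1) ^ 2 + 1 := ⟨_, rfl⟩
  have hx : ∀ n : ℕ, 3 ≤ n → (n : ℝ) ^ ((k : ℝ) - 1 - δ / 2)
      = (n : ℝ) ^ (k - 1) / (n : ℝ) ^ (δ / 2) := by
    intro n hn
    rw [Real.rpow_sub (by positivity), ← Real.rpow_natCast, Nat.cast_sub (by omega), Nat.cast_one]
  have hx2 : ∀ n : ℕ, ((n : ℝ) ^ (δ / 2)) ^ 2 = (n : ℝ) ^ δ := by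
    intro n
    rw [← Real.rpow_natCast, ← Real.rpow_mul (Nat.cast_nonneg n)]
    congr 1
    push_cast
    ring
  have hP : ∀ n : ℕ, (1 : ℝ) ≤ ((Nat.log 2 n + 1 : ℕ) : ℝ) ^ D := fun n =>
    one_le_pow₀ (by exact_mod_cast Nat.succ_pos _)
  have hPlog : ∀ n : ℕ, 3 ≤ n → ∀ j ≤ 3, (((Nat.log 2 n + 1 : ℕ) : ℝ) ^ D) ^ j
      ≤ 3 ^ (3 * D) * Real.log n ^ (3 * D) := by
    intro n hn j hj
    calc (((Nat.log 2 n + 1 : ℕ) : ℝ) ^ D) ^ j ≤ (((Nat.log 2 n + 1 : ℕ) : ℝ) ^ D) ^ 3 :=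
          pow_le_pow_right₀ (hP n) hj
      _ = ((Nat.log 2 n + 1 : ℕ) : ℝ) ^ (3 * D) := by rw [← pow_mul, mul_comm]
      _ ≤ (3 * Real.log n) ^ (3 * D) := by gcongr; exact natLog_succ_le hn
      _ = _ := mul_pow _ _ _
  -- This is where δ < 1 enters: n^(1 - δ) beats every power of the logarithm.
  have hν : ∀ᶠ n : ℕ in atTop,
      2 * (((Nat.log 2 n + 1 : ℕ) : ℝ) ^ D) ^ 2 * ((n : ℝ) ^ (δ / 2)) ^ 2 ≤ n := by
    filter_upwards [eventually_mul_natLog_pow_le 2 (D * 2) (sub_pos.2 hδ'), eventually_ge_atTop 3]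
      with n hn hn3
    have hn0 : (0 : ℝ) < n := by positivity
    rw [hx2, ← pow_mul]
    calc _ ≤ (n : ℝ) ^ (1 - δ) * (n : ℝ) ^ δ := by
          gcongr
          exact_mod_cast hn
      _ = n := by rw [← Real.rpow_add hn0, sub_add_cancel, Real.rpow_one]
  have hN : ∀ n : ℕ, 3 ≤ n → (n : ℝ) ^ 2 ≤ (n : ℝ) ^ (k - 1) := fun n hn =>
    pow_le_pow_right₀ (by exact_mod_cast (by omega : 1 ≤ n)) (by omega)
  -- The exponent 3 D covers both P^2 in the space of (i) and P^3 in the time of (ii), with P = L^D.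
  refine ⟨3 * D, ?_, ?_⟩
  · obtain ⟨t, ht⟩ : ∃ t : ℕ → ℕ, ∀ n, t n
        = ⌈(n : ℝ) ^ (δ / 2) / ((Nat.log 2 n + 1 : ℕ) : ℝ) ^ D⌉₊ := ⟨_, fun _ => rfl⟩
    have key : ∀ᶠ n : ℕ in atTop, (1 : ℝ) ≤ t n ∧ (t n : ℝ) ≤ n ∧
        ((Nat.log 2 n + 1 : ℕ) : ℝ) ^ D * (t n * n + (n : ℝ) ^ (k - 1) / t n)
          ≤ 2 * (((Nat.log 2 n + 1 : ℕ) : ℝ) ^ D) ^ 2 *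
            ((n : ℝ) ^ (k - 1) / (n : ℝ) ^ (δ / 2)) ∧
        ((Nat.log 2 n + 1 : ℕ) : ℝ) ^ D * (t n : ℝ) ^ 2 ≤ 4 * ((n : ℝ) ^ (δ / 2)) ^ 2 := by
      filter_upwards [hν, eventually_ge_atTop 3,
        eventually_mul_natLog_pow_le 1 D (half_pos hδ)] with n h1 h2 h3
      rw [Nat.cast_one, one_mul] at h3
      refine bounds_of_chain_length_div (hP n) h3 h1 (hN n h2) ?_ ?_
      · rw [ht]; exact Nat.le_ceil _
      · rw [ht]; exact (Nat.ceil_lt_add_one (by positivity)).le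
    refine solvableOnRandom_of_chain_length hk hD t _ _ ?_ ?_ ⟨2 * 3 ^ (3 * D) + 4, by positivity, ?_⟩
    · filter_upwards [key] with n h
      exact ⟨by exact_mod_cast h.1, by exact_mod_cast h.2.1⟩
    · intro C
      filter_upwards [key, eventually_ge_atTop 3,
        eventually_mul_natLog_pow_le (C * 2) (D * 2) (half_pos hδ)] with n h h2 h3
      have hx0 : (0 : ℝ) < (n : ℝ) ^ (δ / 2) := by positivity
      refine (mul_le_mul_of_nonneg_left h.2.2.1 (Nat.cast_nonneg C)).trans ?_
      rw [← mul_div_assoc, ← mul_div_assoc, div_le_iff₀ hx0]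
      rw [pow_mul] at h3
      push_cast at h3 ⊢
      calc _ = (n : ℝ) ^ (k - 1) * (C * 2 * (((Nat.log 2 n : ℝ) + 1) ^ D) ^ 2) := by ring
        _ ≤ _ := by gcongr
    · filter_upwards [key, eventually_ge_atTop 3] with n h h2
      have hl := one_le_log h2
      refine ⟨h.2.2.1.trans ?_, h.2.2.2.trans ?_⟩
      · rw [hx n h2]
        have h4 := hPlog n h2 2 (by norm_num)
        calc _ ≤ 2 * (3 ^ (3 * D) * Real.log n ^ (3 * D)) *
              ((n : ℝ) ^ (k - 1) / (n : ℝ) ^ (δ / 2)) := by gcongr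
          _ = 2 * 3 ^ (3 * D) *
              ((n : ℝ) ^ (k - 1) / (n : ℝ) ^ (δ / 2) * Real.log n ^ (3 * D)) := by ring
          _ ≤ _ := by gcongr; linarith
      · rw [hx2]
        gcongr
        have : (0 : ℝ) < 3 ^ (3 * D) := by positivity
        linarith
  · obtain ⟨t, ht⟩ : ∃ t : ℕ → ℕ, ∀ n, t n
        = ⌈(n : ℝ) ^ (δ / 2) * ((Nat.log 2 n + 1 : ℕ) : ℝ) ^ D⌉₊ := ⟨_, fun _ => rfl⟩
    have key : ∀ᶠ n : ℕ in atTop, (1 : ℝ) ≤ t n ∧ (t n : ℝ) ≤ n ∧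
        ((Nat.log 2 n + 1 : ℕ) : ℝ) ^ D * (t n * n + (n : ℝ) ^ (k - 1) / t n)
          ≤ 2 * ((n : ℝ) ^ (k - 1) / (n : ℝ) ^ (δ / 2)) ∧
        ((Nat.log 2 n + 1 : ℕ) : ℝ) ^ D * (t n : ℝ) ^ 2
          ≤ 4 * (((Nat.log 2 n + 1 : ℕ) : ℝ) ^ D) ^ 3 * ((n : ℝ) ^ (δ / 2)) ^ 2 := by
      filter_upwards [hν, eventually_ge_atTop 3] with n h1 h2
      refine bounds_of_chain_length_mul (hP n) ?_ h1 (hN n h2) ?_ ?_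
      · exact Real.one_le_rpow (by exact_mod_cast (by omega : 1 ≤ n)) (half_pos hδ).le
      · rw [ht]; exact Nat.le_ceil _
      · rw [ht]; exact (Nat.ceil_lt_add_one (by positivity)).le
    refine solvableOnRandom_of_chain_length hk hD t _ _ ?_ ?_ ⟨2 + 4 * 3 ^ (3 * D), by positivity, ?_⟩
    · filter_upwards [key] with n h
      exact ⟨by exact_mod_cast h.1, by exact_mod_cast h.2.1⟩
    · intro C
      filter_upwards [key, eventually_ge_atTop 3,
        eventually_mul_natLog_pow_le (C * 2) 0 (half_pos hδ)] with n h h2 h3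
      have hx0 : (0 : ℝ) < (n : ℝ) ^ (δ / 2) := by positivity
      refine (mul_le_mul_of_nonneg_left h.2.2.1 (Nat.cast_nonneg C)).trans ?_
      rw [← mul_div_assoc, ← mul_div_assoc, div_le_iff₀ hx0]
      rw [pow_zero, mul_one] at h3
      push_cast at h3
      calc _ = (n : ℝ) ^ (k - 1) * (C * 2) := by ring
        _ ≤ _ := by gcongr
    · filter_upwards [key, eventually_ge_atTop 3] with n h h2
      have hl := one_le_log h2
      refine ⟨h.2.2.1.trans ?_, h.2.2.2.trans ?_⟩
      · rw [hx n h2]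
        gcongr
        have : (0 : ℝ) < 4 * 3 ^ (3 * D) := by positivity
        linarith
      · rw [hx2]
        have h4 := hPlog n h2 3 le_rfl
        calc _ ≤ 4 * (3 ^ (3 * D) * Real.log n ^ (3 * D)) * (n : ℝ) ^ δ := by gcongr
          _ = 4 * 3 ^ (3 * D) * ((n : ℝ) ^ δ * Real.log n ^ (3 * D)) := by ring
          _ ≤ _ := by gcongr; linarith

end KSumIndexing

theorem mainTheorem3 :
    (∀ k : ℕ, 3 ≤ k → ∀ δ : ℝ, 0 < δ → δ < 1 → ∃ d : ℕ,
      KSumIndexing.SolvableOnRandom k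
        (fun n => (n : ℝ) ^ δ)
        (fun n => (n : ℝ) ^ ((k : ℝ) - 1 - δ / 2) * Real.log n ^ d) ∧
      KSumIndexing.SolvableOnRandom k
        (fun n => (n : ℝ) ^ δ * Real.log n ^ d)
        (fun n => (n : ℝ) ^ ((k : ℝ) - 1 - δ / 2))) ∧
    (∃ d : ℕ,
      KSumIndexing.SolvableOnRandom 3
        (fun n => (n : ℝ) ^ (0.75 : ℝ))
        (fun n => (n : ℝ) ^ (1.625 : ℝ) * Real.log n ^ d) ∧
      KSumIndexing.SolvableOnRandom 3
        (fun n => (n : ℝ) ^ (0.75 : ℝ) * Real.log n ^ d)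
        (fun n => (n : ℝ) ^ (1.625 : ℝ))) := by
  refine ⟨fun k hk δ hδ hδ' => KSumIndexing.exists_solvableOnRandom hk hδ hδ', ?_⟩
  have h := KSumIndexing.exists_solvableOnRandom (le_refl 3) (δ := 0.75) (by norm_num) (by norm_num)
  rwa [show ((3 : ℕ) : ℝ) - 1 - 0.75 / 2 = 1.625 by norm_num] at h
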